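/- Let $(V_n,g)$ be a smooth $n$-dimensional manifold with a smooth metric of Lorentzian signature $(-1,1,\dots,1)$, and let $\ell$ be a smooth, nowhere vanishing null 1-form field on $V_n$. A Kerr--Schild vector field with gauges $h,m$ on an open set $U\subseteq V_n$ is a smooth vector field $\xi$ on $U$, together with smooth functions $h,m$ on $U$, such that $$\mathcal L_\xi g=2h\,\ell\otimes\ell,\qquad \mathcal L_\xi\ell=m\,\ell .$$ The data are $g$ and $\ell$. Put $\xi_{\alpha\beta}=\nabla_\alpha\xi_\beta$. The Kerr--Schild system is called *closed* if, in every chart, there are smooth coefficient functions, depending only on the data, such that for every solution $(\xi,h,m)$ on every open set the gauge $h$ is isolated, that is, equal to a linear combination, with these coefficients, of the unknowns $\xi_\alpha,\ \xi_{[\alpha\beta]}$, and the system can be written in normal form, that is, all first partial derivatives of $\xi_\alpha,\ \xi_{[\alpha\beta]}$ are linear combinations of $\xi_\alpha,\ \xi_{[\alpha\beta]}$ with these coefficients. Conventions: $R^\alpha{}_{\beta\gamma\delta}=\partial_\gamma\Gamma^\alpha_{\beta\delta}-\partial_\delta\Gamma^\alpha_{\beta\gamma}+\Gamma^\alpha_{\gamma\lambda}\Gamma^\lambda_{\beta\delta}-\Gamma^\alpha_{\delta\lambda}\Gamma^\lambda_{\beta\gamma}$,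 $R_{\alpha\beta}=R^\lambda{}_{\alpha\lambda\beta}$, $R=g^{\alpha\beta}R_{\alpha\beta}$, $D=\ell^\lambda\nabla_\lambda$, $a^\alpha=D\ell^\alpha$, $a^2=g_{\lambda\mu}a^\lambda a^\mu$, $\theta=\tfrac12\nabla_\lambda\ell^\lambda$, $\bar R=R_{\lambda\mu}\ell^\lambda\ell^\mu$, and $A_{(\alpha\beta)}=\tfrac12(A_{\alpha\beta}+A_{\beta\alpha})$, $A_{[\alpha\beta]}=\tfrac12(A_{\alpha\beta}-A_{\beta\alpha})$. 1. Suppose $\ell$ is non-geodesic, i.e. $a^2\neq0$ everywhere. Then the Kerr--Schild system is closed, and every solution satisfies $$h=-\frac{\ell^\lambda\ell^\mu\,\mathcal L_\xi R_{\lambda\mu}}{2a^2}.$$ 2. Suppose $\ell$ is geodesic, $D\ell=M\ell$ with a smooth function $M$, and put $$\Delta=-2D\theta+4\theta^2-3\bar R+2\,\ell^\mu\nabla_\sigma\nabla^\sigma\ell_\mu+DM-2M\theta .$$ Then every solution satisfies $$2\Delta\,h\,\ell_\alpha\ell_\beta=(\mathcal L_\xi R)\,\ell_\alpha\ell_\beta-4\,(\mathcal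 L_\xi R_{\mu(\alpha})\,\ell_{\beta)}\ell^\mu-2\,(\mathcal L_\xi R_{\alpha\sigma\beta\mu})\,\ell^\sigma\ell^\mu ,$$ and if $\Delta\neq0$ everywhere, then the Kerr--Schild system is closed. -/

import Mathlib

open scoped Manifold ContDiff

namespace KerrSchild

/-- The coordinate space `ℝⁿ`. -/
abbrev Coord (n : ℕ) : Type := EuclideanSpace ℝ (Fin n)

noncomputable section

/-! ### Tensor calculus in a coordinate system

A tensor field is given by its component functions. `G a b` are the components of the metric,
`l a` those of a covector field, `X a` those of a vector field. -/

section Coordinates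

variable {n : ℕ}

/-- The partial derivative `∂_i f`. -/
def pd (i : Fin n) (f : Coord n → ℝ) (y : Coord n) : ℝ :=
  fderiv ℝ f y (EuclideanSpace.single i (1 : ℝ))

/-- The inverse metric `g^{ab}`. -/
def ginv (G : Fin n → Fin n → Coord n → ℝ) (a b : Fin n) (y : Coord n) : ℝ :=
  (Matrix.of fun i j => G i j y)⁻¹ a b

/-- The Christoffel symbols `Γ^a_{bc}` of the Levi-Civita connection. -/
def christoffel (G : Fin n → Fin n → Coord n → ℝ) (a b c : Fin n) (y : Coord n) : ℝ :=
  1 / 2 * ∑ d, ginv G a d y * (pd b (G d c) y + pd c (G d b) y - pd d (G b c) y)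

/-- The curvature tensor
`R^a_{bcd} = ∂_c Γ^a_{bd} - ∂_d Γ^a_{bc} + Γ^a_{ce} Γ^e_{bd} - Γ^a_{de} Γ^e_{bc}`. -/
def riemann (G : Fin n → Fin n → Coord n → ℝ) (a b c d : Fin n) (y : Coord n) : ℝ :=
  pd c (christoffel G a b d) y - pd d (christoffel G a b c) y
    + ∑ e, (christoffel G a c e y * christoffel G e b d y
        - christoffel G a d e y * christoffel G e b c y)

/-- The fully covariant curvature tensor `R_{abcd} = g_{ae} R^e_{bcd}`. -/
def riemannLow (G : Fin n → Fin n → Coord n → ℝ) (a b c d : Fin n) (y : Coord n) : ℝ :=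
  ∑ e, G a e y * riemann G e b c d y

/-- The Ricci tensor `R_{ab} = R^c_{acb}`. -/
def ricci (G : Fin n → Fin n → Coord n → ℝ) (a b : Fin n) (y : Coord n) : ℝ :=
  ∑ c, riemann G c a c b y

/-- The scalar curvature `R = g^{ab} R_{ab}`. -/
def scalarCurv (G : Fin n → Fin n → Coord n → ℝ) (y : Coord n) : ℝ :=
  ∑ a, ∑ b, ginv G a b y * ricci G a b y

/-- Raising an index, `l^a = g^{ab} l_b`. -/
def raise (G : Fin n → Fin n → Coord n → ℝ) (l : Fin n → Coord n → ℝ)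
    (a : Fin n) (y : Coord n) : ℝ :=
  ∑ b, ginv G a b y * l b y

/-- Lowering an index, `X_a = g_{ab} X^b`. -/
def lower (G : Fin n → Fin n → Coord n → ℝ) (X : Fin n → Coord n → ℝ)
    (a : Fin n) (y : Coord n) : ℝ :=
  ∑ b, G a b y * X b y

/-- `∇_a l_b` for a covector field `l`. -/
def covD (G : Fin n → Fin n → Coord n → ℝ) (l : Fin n → Coord n → ℝ)
    (a b : Fin n) (y : Coord n) : ℝ :=
  pd a (l b) y - ∑ c, christoffel G c a b y * l c y

/-- `∇_a X^b` for a vector field `X`. -/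
def covDVec (G : Fin n → Fin n → Coord n → ℝ) (X : Fin n → Coord n → ℝ)
    (a b : Fin n) (y : Coord n) : ℝ :=
  pd a (X b) y + ∑ c, christoffel G b a c y * X c y

/-- `∇_c T_{ab}` for a tensor field `T` with two lower indices. -/
def covD2 (G : Fin n → Fin n → Coord n → ℝ) (T : Fin n → Fin n → Coord n → ℝ)
    (c a b : Fin n) (y : Coord n) : ℝ :=
  pd c (T a b) y - ∑ d, christoffel G d c a y * T d b y - ∑ d, christoffel G d c b y * T a d y

/-- The Lie derivative of a function. -/
def lieFun (X : Fin n → Coord n → ℝ) (f : Coord n → ℝ) (y : Coord n) : ℝ :=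
  ∑ c, X c y * pd c f y

/-- The Lie derivative `(L_X l)_a` of a covector field. -/
def lie1 (X l : Fin n → Coord n → ℝ) (a : Fin n) (y : Coord n) : ℝ :=
  ∑ c, (X c y * pd c (l a) y + l c y * pd a (X c) y)

/-- The Lie derivative `(L_X T)_{ab}` of a tensor field with two lower indices. -/
def lie2 (X : Fin n → Coord n → ℝ) (T : Fin n → Fin n → Coord n → ℝ)
    (a b : Fin n) (y : Coord n) : ℝ :=
  ∑ c, (X c y * pd c (T a b) y + T c b y * pd a (X c) y + T a c y * pd b (X c) y)

/-- The Lie derivative `(L_X T)_{abcd}` of a tensor field with four lower indices. -/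
def lie4 (X : Fin n → Coord n → ℝ) (T : Fin n → Fin n → Fin n → Fin n → Coord n → ℝ)
    (a b c d : Fin n) (y : Coord n) : ℝ :=
  ∑ e, (X e y * pd e (T a b c d) y + T e b c d y * pd a (X e) y + T a e c d y * pd b (X e) y
    + T a b e d y * pd c (X e) y + T a b c e y * pd d (X e) y)

/-- `D f = l^a ∇_a f`, the derivative of a function along `l`. -/
def dAlong (G : Fin n → Fin n → Coord n → ℝ) (l : Fin n → Coord n → ℝ)
    (f : Coord n → ℝ) (y : Coord n) : ℝ :=
  ∑ a, raise G l a y * pd a f y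

/-- The acceleration `a^b = l^a ∇_a l^b`. -/
def accel (G : Fin n → Fin n → Coord n → ℝ) (l : Fin n → Coord n → ℝ)
    (b : Fin n) (y : Coord n) : ℝ :=
  ∑ a, raise G l a y * covDVec G (raise G l) a b y

/-- `a² = g_{bc} a^b a^c`. -/
def accelSq (G : Fin n → Fin n → Coord n → ℝ) (l : Fin n → Coord n → ℝ) (y : Coord n) : ℝ :=
  ∑ b, ∑ c, G b c y * accel G l b y * accel G l c y

/-- The expansion `θ = (1/2) ∇_a l^a`. -/
def expansion (G : Fin n → Fin n → Coord n → ℝ) (l : Fin n → Coord n → ℝ) (y : Coord n) : ℝ :=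
  1 / 2 * ∑ a, covDVec G (raise G l) a a y

/-- `R̄ = R_{ab} l^a l^b`. -/
def ricciBar (G : Fin n → Fin n → Coord n → ℝ) (l : Fin n → Coord n → ℝ) (y : Coord n) : ℝ :=
  ∑ a, ∑ b, ricci G a b y * raise G l a y * raise G l b y

/-- `l^b □ l_b = l^b g^{ca} ∇_c ∇_a l_b`. -/
def lBoxl (G : Fin n → Fin n → Coord n → ℝ) (l : Fin n → Coord n → ℝ) (y : Coord n) : ℝ :=
  ∑ b, ∑ c, ∑ a, raise G l b y * ginv G c a y * covD2 G (covD G l) c a b y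

/-- The scalar `Δ = -2 Dθ + 4 θ² - 3 R̄ + 2 l^b □ l_b + DM - 2 M θ` of a geodesic covector field
with `D l = M l`. -/
def Delta (G : Fin n → Fin n → Coord n → ℝ) (l : Fin n → Coord n → ℝ) (Mf : Coord n → ℝ)
    (y : Coord n) : ℝ :=
  -2 * dAlong G l (expansion G l) y + 4 * expansion G l y ^ 2 - 3 * ricciBar G l y
    + 2 * lBoxl G l y + dAlong G l Mf y - 2 * Mf y * expansion G l y

/-- The unknowns `ξ_a` and `ξ_{[ab]}`, where `ξ_{ab} = ∇_a ξ_b`. -/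
def unknowns (G : Fin n → Fin n → Coord n → ℝ) (X : Fin n → Coord n → ℝ) :
    Fin n ⊕ Fin n × Fin n → Coord n → ℝ
  | Sum.inl a => lower G X a
  | Sum.inr (a, b) => fun y => 1 / 2 * (covD G (lower G X) a b y - covD G (lower G X) b a y)

end Coordinates

/-! ### Tensor fields on a manifold and their components in the charts -/

section Manifolds

variable {n : ℕ} {M : Type*} [TopologicalSpace M] [ChartedSpace (Coord n) M]

/-- The coordinate vector `∂_i` of the chart `φ` at the point with coordinates `y`. -/
def coordVec (φ : OpenPartialHomeomorph M (Coord n)) (y : Coord n) (i : Fin n) :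
    TangentSpace (𝓡 n) (φ.symm y) :=
  mfderiv (𝓡 n) (𝓡 n) φ.symm y (EuclideanSpace.single i (1 : ℝ) : Coord n)

/-- The components in the chart `φ` of a tensor field with two lower indices. -/
def comp2 (φ : OpenPartialHomeomorph M (Coord n))
    (T : ∀ x : M, TangentSpace (𝓡 n) x →ₗ[ℝ] TangentSpace (𝓡 n) x →ₗ[ℝ] ℝ)
    (i j : Fin n) (y : Coord n) : ℝ :=
  T (φ.symm y) (coordVec φ y i) (coordVec φ y j)

/-- The components in the chart `φ` of a covector field. -/
def comp1 (φ : OpenPartialHomeomorph M (Coord n))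
    (l : ∀ x : M, TangentSpace (𝓡 n) x →ₗ[ℝ] ℝ) (i : Fin n) (y : Coord n) : ℝ :=
  l (φ.symm y) (coordVec φ y i)

/-- The components in the chart `φ` of a vector field. -/
def compVec (φ : OpenPartialHomeomorph M (Coord n))
    (X : ∀ x : M, TangentSpace (𝓡 n) x) (i : Fin n) (y : Coord n) : ℝ :=
  (EuclideanSpace.proj i : Coord n →L[ℝ] ℝ) (mfderiv (𝓡 n) (𝓡 n) φ (φ.symm y) (X (φ.symm y)))

variable (n M) in
/-- The charts of the smooth structure of `M`. -/
abbrev charts : Set (OpenPartialHomeomorph M (Coord n)) :=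
  IsManifold.maximalAtlas (𝓡 n) ∞ M

variable (n M) in
/-- A smooth Lorentz metric, of signature `(-1, 1, …, 1)`: there is a timelike vector at every
point, and the metric is positive definite on its orthogonal complement. -/
structure LorentzMetric where
  val : ∀ x : M, TangentSpace (𝓡 n) x →ₗ[ℝ] TangentSpace (𝓡 n) x →ₗ[ℝ] ℝ
  symm : ∀ x v w, val x v w = val x w v
  lorentz : ∀ x, ∃ t, val x t t < 0 ∧ ∀ v, val x t v = 0 → v ≠ 0 → 0 < val x v v
  smooth : ∀ φ ∈ charts n M, ∀ i j, ContDiffOn ℝ ∞ (comp2 φ val i j) φ.target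

/-- `l` is a smooth null 1-form field: it vanishes nowhere and its metric dual `v` is null. -/
structure IsNullForm (g : LorentzMetric n M) (l : ∀ x : M, TangentSpace (𝓡 n) x →ₗ[ℝ] ℝ) :
    Prop where
  smooth : ∀ φ ∈ charts n M, ∀ i, ContDiffOn ℝ ∞ (comp1 φ l i) φ.target
  ne_zero : ∀ x, l x ≠ 0
  null : ∀ x, ∃ v, g.val x v = l x ∧ g.val x v v = 0

/-- On the open set `U`, `X` is a Kerr-Schild vector field with respect to `l`, with gauges
`h` and `m`: `L_X g = 2 h l ⊗ l` and `L_X l = m l`. -/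
structure IsKerrSchild (g : LorentzMetric n M) (l : ∀ x : M, TangentSpace (𝓡 n) x →ₗ[ℝ] ℝ)
    (U : Set M) (X : ∀ x : M, TangentSpace (𝓡 n) x) (h m : M → ℝ) : Prop where
  isOpen : IsOpen U
  smooth : ∀ φ ∈ charts n M, ∀ i, ContDiffOn ℝ ∞ (compVec φ X i) (φ.target ∩ φ.symm ⁻¹' U)
  smooth_h : ContMDiffOn (𝓡 n) 𝓘(ℝ, ℝ) ∞ h U
  smooth_m : ContMDiffOn (𝓡 n) 𝓘(ℝ, ℝ) ∞ m U
  lie_metric : ∀ φ ∈ charts n M, ∀ y ∈ φ.target ∩ φ.symm ⁻¹' U, ∀ a b,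
    lie2 (compVec φ X) (comp2 φ g.val) a b y
      = 2 * h (φ.symm y) * comp1 φ l a y * comp1 φ l b y
  lie_form : ∀ φ ∈ charts n M, ∀ y ∈ φ.target ∩ φ.symm ⁻¹' U, ∀ a,
    lie1 (compVec φ X) (comp1 φ l) a y = m (φ.symm y) * comp1 φ l a y

/-- The Kerr-Schild system of the data `(g, l)` is closed. In every chart there are smooth
coefficients `c` and `K`, depending on the data only, such that for all solutions `(X, h, m)` on
all open sets the gauge is isolated as a linear expression `h = ∑ c_A Y_A` in the unknowns
`Y = (ξ_a, ξ_{[ab]})`, and the unknowns satisfy the first-order linear system in normal form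
`∂_k Y_A = ∑ K_{kAB} Y_B`. -/
def SystemClosed (g : LorentzMetric n M) (l : ∀ x : M, TangentSpace (𝓡 n) x →ₗ[ℝ] ℝ) : Prop :=
  ∀ φ ∈ charts n M,
    ∃ (c : Fin n ⊕ Fin n × Fin n → Coord n → ℝ)
      (K : Fin n → Fin n ⊕ Fin n × Fin n → Fin n ⊕ Fin n × Fin n → Coord n → ℝ),
      (∀ A, ContDiffOn ℝ ∞ (c A) φ.target) ∧
      (∀ k A B, ContDiffOn ℝ ∞ (K k A B) φ.target) ∧
      ∀ (U : Set M) (X : ∀ x : M, TangentSpace (𝓡 n) x) (h m : M → ℝ),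
        IsKerrSchild g l U X h m → ∀ y ∈ φ.target ∩ φ.symm ⁻¹' U,
          h (φ.symm y) = ∑ A, c A y * unknowns (comp2 φ g.val) (compVec φ X) A y ∧
          ∀ k A, pd k (unknowns (comp2 φ g.val) (compVec φ X) A) y
            = ∑ B, K k A B y * unknowns (comp2 φ g.val) (compVec φ X) B y

/-- `l` is nowhere geodesic: `a² ≠ 0` everywhere. -/
def NonGeodesic (g : LorentzMetric n M) (l : ∀ x : M, TangentSpace (𝓡 n) x →ₗ[ℝ] ℝ) : Prop :=
  ∀ φ ∈ charts n M, ∀ y ∈ φ.target, accelSq (comp2 φ g.val) (comp1 φ l) y ≠ 0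

/-- `l` is geodesic, `D l = M l` with the smooth function `M = Mf`. -/
def Geodesic (g : LorentzMetric n M) (l : ∀ x : M, TangentSpace (𝓡 n) x →ₗ[ℝ] ℝ)
    (Mf : M → ℝ) : Prop :=
  ContMDiff (𝓡 n) 𝓘(ℝ, ℝ) ∞ Mf ∧
  ∀ φ ∈ charts n M, ∀ y ∈ φ.target, ∀ a,
    accel (comp2 φ g.val) (comp1 φ l) a y
      = Mf (φ.symm y) * raise (comp2 φ g.val) (comp1 φ l) a y

/-- `Δ ≠ 0` everywhere, for a geodesic `l` with `D l = M l`. -/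
def DeltaNeZero (g : LorentzMetric n M) (l : ∀ x : M, TangentSpace (𝓡 n) x →ₗ[ℝ] ℝ)
    (Mf : M → ℝ) : Prop :=
  ∀ φ ∈ charts n M, ∀ y ∈ φ.target,
    Delta (comp2 φ g.val) (comp1 φ l) (fun z => Mf (φ.symm z)) y ≠ 0

end Manifolds

end

end KerrSchild

open KerrSchild

/-! All tensor identities are algebra over a commutative ring with commuting derivations
(`DiffMetric`). The ring used at the end consists of families of smooth functions indexed by all
solutions, each member living on the domain of its solution in a fixed chart. All solutions become
one vector field `X` with one pair of gauges `h`, `m`, while the data lie in the subalgebra `S` of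
families whose members agree on overlaps. Coefficients valid for every solution at once are then
elements of `S`. Closedness says that `h` and the derivatives of the unknowns lie in the `S`-span
`lin` of the unknowns.

The equation for `L_X g` prescribes the symmetric part of `∇ξ`, so `∂_a X^c` equals `h l_a l^c`
modulo `lin` (`d_X_mem`). By the Koszul formula it also expresses `L_X Γ` through `h` and `dh`
(`low_lieΓ`), hence the second derivatives of `X`. In the derivative `∂_k ξ_{[ab]}` the gradient of
`h` enters only through `(∂_a h l_b - ∂_b h l_a) l_k`. Because of the factor `l_k`, a gauge in `lin`
has its gradient in `lin` too (`d_gauge_mem`), and the system closes. Only the isolation of `h`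
remains.

The Lie derivative of the curvature is the covariant exterior derivative of `L_X Γ` (`lieRiem_eq`),
and the trace of `L_X Γ` vanishes because `l` is null (`lieΓ_trace`). Contracting `L_X Ric` twice
with `l` leaves `-2 h a²`, which settles the non-geodesic case.

In the geodesic case, contractions of `L_X R`, `L_X Ric` and `L_X Riem` with `l` give three
second-order equations for `h` along `l`. The combination in `delta_mul` cancels `DDh` and `Dh` and
leaves `Δ h`. However, `L_X Ric` itself contains `h`, so modulo `lin` this yields only `(Δ + 2 R̄)
h`, whose factor may vanish. Further equations are needed. With `f = ∇·l - M` one has `L_X f = m f`,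
and differentiating gives a first-order equation for `h` (`dvg_condition`). Elimination gives two
more factors of `h`: the squared length `|∇l|²`, and one equal to `2 (Df)²` wherever `f = 0`
(`gauge_factors`). Where `|∇l|² = 0`, the Lorentz signature makes the screen part of `∇l` vanish, so
`f = 0` there (`trace_eq_of_trace_mul_eq_zero`). If all three factors vanished at a point, then
`Df`, `R̄` and finally `Δ` would vanish there. Hence their sum of squares is invertible when `Δ ≠
0`, and `h` is isolated. -/

namespace KerrSchild

/-! ### Tensor calculus over a commutative ring with commuting derivations -/

/-- A metric with components in a commutative `ℝ`-algebra with `n` commuting derivations. -/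
structure DiffMetric (n : ℕ) (R : Type*) [CommRing R] [Algebra ℝ R] where
  d : Fin n → Derivation ℝ R R
  d_comm : ∀ i j f, d i (d j f) = d j (d i f)
  G : Fin n → Fin n → R
  g : Fin n → Fin n → R
  G_symm : ∀ a b, G a b = G b a
  g_mul_G : ∀ a b, ∑ c, g a c * G c b = if a = b then 1 else 0

noncomputable section

namespace DiffMetric

variable {n : ℕ} {R : Type*} [CommRing R] [Algebra ℝ R] (T : DiffMetric n R)

/-- The Christoffel symbols. -/
def Γ (a b c : Fin n) : R :=
  (1 / 2 : ℝ) • ∑ e, T.g a e * (T.d b (T.G e c) + T.d c (T.G e b) - T.d e (T.G b c))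

/-- The curvature tensor. -/
def riem (a b c e : Fin n) : R :=
  T.d c (T.Γ a b e) - T.d e (T.Γ a b c) + ∑ f, (T.Γ a c f * T.Γ f b e - T.Γ a e f * T.Γ f b c)

/-- The covariant curvature tensor. -/
def riemLow (a b c e : Fin n) : R := ∑ f, T.G a f * T.riem f b c e

/-- The Ricci tensor. -/
def ric (a b : Fin n) : R := ∑ c, T.riem c a c b

/-- The scalar curvature. -/
def scal : R := ∑ a, ∑ b, T.g a b * T.ric a b

/-- Raising an index. -/
def up (l : Fin n → R) (a : Fin n) : R := ∑ b, T.g a b * l b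

/-- Lowering an index. -/
def low (u : Fin n → R) (a : Fin n) : R := ∑ b, T.G a b * u b

/-- The covariant derivative of a covector field. -/
def nabl (l : Fin n → R) (a b : Fin n) : R := T.d a (l b) - ∑ c, T.Γ c a b * l c

/-- The covariant derivative of a vector field. -/
def nabv (u : Fin n → R) (a b : Fin n) : R := T.d a (u b) + ∑ c, T.Γ b a c * u c

/-- The covariant derivative of a tensor field with two lower indices. -/
def nabl2 (S : Fin n → Fin n → R) (c a b : Fin n) : R :=
  T.d c (S a b) - ∑ e, T.Γ e c a * S e b - ∑ e, T.Γ e c b * S a e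

/-- The derivative along a vector field. -/
def along (u : Fin n → R) : Derivation ℝ R R := ∑ c, u c • T.d c

/-- The Lie derivative of a tensor field with two lower indices. -/
def lieTwo (X : Fin n → R) (S : Fin n → Fin n → R) (a b : Fin n) : R :=
  ∑ c, (X c * T.d c (S a b) + S c b * T.d a (X c) + S a c * T.d b (X c))

/-- The Lie derivative of a covector field. -/
def lieOne (X l : Fin n → R) (a : Fin n) : R :=
  ∑ c, (X c * T.d c (l a) + l c * T.d a (X c))

/-- The Lie derivative of a tensor field with four lower indices. -/
def lieFour (X : Fin n → R) (S : Fin n → Fin n → Fin n → Fin n → R) (a b c d : Fin n) : R :=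
  ∑ e, (X e * T.d e (S a b c d) + S e b c d * T.d a (X e) + S a e c d * T.d b (X e)
    + S a b e d * T.d c (X e) + S a b c e * T.d d (X e))

/-- The acceleration of a covector field. -/
def acc (l : Fin n → R) (b : Fin n) : R := ∑ a, T.up l a * T.nabv (T.up l) a b

/-- The squared length of the acceleration. -/
def accSq (l : Fin n → R) : R := ∑ b, ∑ c, T.G b c * T.acc l b * T.acc l c

/-- The expansion. -/
def exps (l : Fin n → R) : R := (1 / 2 : ℝ) • ∑ a, T.nabv (T.up l) a a

/-- The Ricci tensor contracted twice with a covector field. -/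
def ricBar (l : Fin n → R) : R := ∑ a, ∑ b, T.ric a b * T.up l a * T.up l b

/-- The contraction of a covector field with its wave operator. -/
def boxl (l : Fin n → R) : R :=
  ∑ b, ∑ c, ∑ a, T.up l b * T.g c a * T.nabl2 (T.nabl l) c a b

/-- The scalar `Δ` of a geodesic covector field. -/
def delta (l : Fin n → R) (Mf : R) : R :=
  -2 * T.along (T.up l) (T.exps l) + 4 * T.exps l ^ 2 - 3 * T.ricBar l
    + 2 * T.boxl l + T.along (T.up l) Mf - 2 * Mf * T.exps l

theorem along_apply (u : Fin n → R) (f : R) : T.along u f = ∑ c, u c * T.d c f := by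
  simp only [along, ← Derivation.coeFnAddMonoidHom_apply]
  simp [map_sum, Finset.sum_apply]

theorem two_smul_half (x : R) : 2 * ((1 / 2 : ℝ) • x) = x := by
  rw [two_mul, ← add_smul]
  norm_num

/-- The ring may have zero divisors, but 2 is a unit in every `ℝ`-algebra. -/
theorem two_mul_cancel {x y : R} (h : 2 * x = 2 * y) : x = y := by
  have := congrArg (fun z => (1 / 2 : ℝ) • z) h
  simpa only [← mul_smul_comm, two_smul_half] using this

/-! #### Index manipulation -/

theorem mat_g_mul_G : Matrix.of T.g * Matrix.of T.G = 1 := by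
  ext a b
  simp [Matrix.mul_apply, T.g_mul_G, Matrix.one_apply]

theorem mat_G_mul_g : Matrix.of T.G * Matrix.of T.g = 1 :=
  mul_eq_one_comm.1 T.mat_g_mul_G

theorem mat_G_transpose : (Matrix.of T.G).transpose = Matrix.of T.G := by
  ext a b
  simp [T.G_symm a b]

theorem g_symm (a b : Fin n) : T.g a b = T.g b a := by
  have h : (Matrix.of T.g).transpose = Matrix.of T.g := by
    have h1 := congrArg Matrix.transpose T.mat_g_mul_G
    rw [Matrix.transpose_mul, T.mat_G_transpose, Matrix.transpose_one] at h1
    calc (Matrix.of T.g).transpose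
        = (Matrix.of T.g * Matrix.of T.G) * (Matrix.of T.g).transpose := by
          rw [T.mat_g_mul_G, one_mul]
      _ = Matrix.of T.g := by rw [mul_assoc, h1, mul_one]
  exact congrFun (congrFun h b) a

theorem low_up (l : Fin n → R) : T.low (T.up l) = l := by
  have := congrArg (fun A => A.mulVec l) T.mat_G_mul_g
  simp only [← Matrix.mulVec_mulVec, Matrix.one_mulVec] at this
  exact this

theorem up_low (u : Fin n → R) : T.up (T.low u) = u := by
  have := congrArg (fun A => A.mulVec u) T.mat_g_mul_G
  simp only [← Matrix.mulVec_mulVec, Matrix.one_mulVec] at this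
  exact this

theorem sum_up_mul (l k : Fin n → R) : ∑ a, T.up l a * k a = ∑ a, l a * T.up k a := by
  simp only [up, Finset.sum_mul, Finset.mul_sum]
  rw [Finset.sum_comm]
  refine Finset.sum_congr rfl fun a _ => Finset.sum_congr rfl fun b _ => ?_
  rw [T.g_symm]; ring

theorem sum_low_mul (l k : Fin n → R) : ∑ a, T.low l a * k a = ∑ a, l a * T.low k a := by
  simp only [low, Finset.sum_mul, Finset.mul_sum]
  rw [Finset.sum_comm]
  refine Finset.sum_congr rfl fun a _ => Finset.sum_congr rfl fun b _ => ?_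
  rw [T.G_symm]; ring

/-! #### The Levi-Civita connection -/

theorem Γ_symm (a b c : Fin n) : T.Γ a b c = T.Γ a c b := by
  unfold Γ
  congr 1
  refine Finset.sum_congr rfl fun e _ => ?_
  rw [T.G_symm b c]; ring

theorem two_mul_low_Γ (a b c : Fin n) :
    2 * ∑ e, T.G a e * T.Γ e b c
      = T.d b (T.G a c) + T.d c (T.G a b) - T.d a (T.G b c) := by
  have h := congrFun (T.low_up fun e => T.d b (T.G e c) + T.d c (T.G e b) - T.d e (T.G b c)) a
  rw [← h, low, Finset.mul_sum]
  refine Finset.sum_congr rfl fun e _ => ?_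
  rw [mul_left_comm, Γ, two_smul_half, up]

theorem d_G (a b c : Fin n) :
    T.d c (T.G a b) = ∑ e, T.Γ e c a * T.G e b + ∑ e, T.G a e * T.Γ e c b := by
  apply two_mul_cancel (R := R)
  have h1 := T.two_mul_low_Γ a c b
  have h2 := T.two_mul_low_Γ b c a
  have h3 : ∑ e, T.Γ e c a * T.G e b = ∑ e, T.G b e * T.Γ e c a :=
    Finset.sum_congr rfl fun e _ => by rw [T.G_symm e b, mul_comm]
  rw [mul_add, h3, h1, h2, T.G_symm b a, T.G_symm c a, T.G_symm c b]; ring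

theorem d_pairing (l u : Fin n → R) (c : Fin n) :
    T.d c (∑ a, l a * u a) = ∑ a, T.nabl l c a * u a + ∑ a, l a * T.nabv u c a := by
  simp only [nabl, nabv, map_sum, Derivation.leibniz, smul_eq_mul, sub_mul, mul_add,
    Finset.sum_add_distrib, Finset.sum_sub_distrib, Finset.sum_mul, Finset.mul_sum]
  rw [Finset.sum_comm (f := fun x i => T.Γ i c x * l i * u x)]
  have : ∀ x y, T.Γ x c y * l x * u y = l x * (T.Γ x c y * u y) := fun x y => by ring
  simp only [this, fun x => mul_comm (u x) (T.d c (l x))]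
  ring

theorem nabl_low (u : Fin n → R) (c b : Fin n) :
    T.nabl (T.low u) c b = T.low (T.nabv u c) b := by
  simp only [nabl, nabv, low, map_sum, Derivation.leibniz, smul_eq_mul, T.d_G, mul_add,
    Finset.sum_add_distrib, Finset.mul_sum]
  rw [Finset.sum_comm (f := fun x i => T.Γ x c b * (T.G x i * u i)),
    Finset.sum_comm (f := fun x i => T.G b x * (T.Γ x c i * u i))]
  have h1 : ∀ x y, u x * (T.Γ y c b * T.G y x) = T.Γ y c b * (T.G y x * u x) :=
    fun x y => by ring
  have h2 : ∀ x y, u x * (T.G b y * T.Γ y c x) = T.G b y * (T.Γ y c x * u x) :=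
    fun x y => by ring
  simp only [h1, h2]
  ring

theorem nabl_eq_low (l : Fin n → R) (c b : Fin n) :
    T.nabl l c b = T.low (T.nabv (T.up l) c) b := by
  rw [← nabl_low, low_up]

theorem nabv_up (l : Fin n → R) (c b : Fin n) :
    T.nabv (T.up l) c b = T.up (T.nabl l c) b := by
  have : T.nabl l c = T.low (T.nabv (T.up l) c) := funext fun b => T.nabl_eq_low l c b
  rw [this, up_low]

theorem nabl_sub_nabl (l : Fin n → R) (a b : Fin n) :
    T.nabl l a b - T.nabl l b a = T.d a (l b) - T.d b (l a) := by
  simp only [nabl, fun c => T.Γ_symm c b a]; ring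

/-- The Ricci identity. -/
theorem riem_mul (u : Fin n → R) (a c e : Fin n) :
    ∑ b, T.riem a b c e * u b
      = (T.d c (T.nabv u e a) + ∑ b, T.Γ a c b * T.nabv u e b)
        - (T.d e (T.nabv u c a) + ∑ b, T.Γ a e b * T.nabv u c b) := by
  simp only [riem, nabv, map_add, map_sum, Derivation.leibniz, smul_eq_mul, mul_add, add_mul,
    sub_mul, Finset.sum_add_distrib, Finset.sum_sub_distrib, Finset.mul_sum, Finset.sum_mul,
    T.d_comm e c]
  rw [Finset.sum_comm (f := fun x i => T.Γ a c x * (T.Γ x e i * u i)),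
    Finset.sum_comm (f := fun x i => T.Γ a e x * (T.Γ x c i * u i))]
  have h1 : ∀ x y, T.Γ a c y * T.Γ y x e * u x = T.Γ a c y * (T.Γ y e x * u x) :=
    fun x y => by rw [T.Γ_symm y x e]; ring
  have h2 : ∀ x y, T.Γ a e y * T.Γ y x c * u x = T.Γ a e y * (T.Γ y c x * u x) :=
    fun x y => by rw [T.Γ_symm y x c]; ring
  simp only [h1, h2, fun x y => mul_comm (u x) (T.d y (T.Γ a c x)),
    fun x y => mul_comm (u x) (T.d y (T.Γ a e x)), T.Γ_symm a _ e, T.Γ_symm a _ c]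
  ring

end DiffMetric

end

end KerrSchild

namespace KerrSchild

noncomputable section

namespace DiffMetric

variable {n : ℕ} {R : Type*} [CommRing R] [Algebra ℝ R] (T : DiffMetric n R)

/-! #### The Lie derivative of the connection -/

/-- The entrywise derivative of a matrix. -/
def dm (c : Fin n) : Matrix (Fin n) (Fin n) R →+ Matrix (Fin n) (Fin n) R where
  toFun A := A.map (T.d c)
  map_zero' := by ext; simp
  map_add' A B := by ext; simp

theorem dm_apply (c : Fin n) (A : Matrix (Fin n) (Fin n) R) (a b : Fin n) :
    T.dm c A a b = T.d c (A a b) := rfl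

theorem dm_mul (c : Fin n) (A B : Matrix (Fin n) (Fin n) R) :
    T.dm c (A * B) = T.dm c A * B + A * T.dm c B := by
  ext a b
  simp only [dm_apply, Matrix.mul_apply, Matrix.add_apply, map_sum, Derivation.leibniz,
    smul_eq_mul, Finset.sum_add_distrib]
  rw [add_comm]
  simp only [fun x => mul_comm (B x b) (T.d c (A a x))]

theorem dm_smul (c : Fin n) (r : R) (A : Matrix (Fin n) (Fin n) R) :
    T.dm c (r • A) = T.d c r • A + r • T.dm c A := by
  ext a b
  simp only [dm_apply, Matrix.smul_apply, Matrix.add_apply, Derivation.leibniz, smul_eq_mul]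
  ring

theorem dm_comm (c e : Fin n) (A : Matrix (Fin n) (Fin n) R) :
    T.dm c (T.dm e A) = T.dm e (T.dm c A) := by
  ext a b
  simp only [dm_apply, T.d_comm c e]

theorem dm_sum (c : Fin n) (F : Fin n → Matrix (Fin n) (Fin n) R) :
    T.dm c (∑ e, F e) = ∑ e, T.dm c (F e) := map_sum (T.dm c) F Finset.univ

/-- The derivative of a matrix along a vector field. -/
def dmAlong (X : Fin n → R) (A : Matrix (Fin n) (Fin n) R) : Matrix (Fin n) (Fin n) R :=
  ∑ e, X e • T.dm e A

theorem dmAlong_add (X : Fin n → R) (A B : Matrix (Fin n) (Fin n) R) :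
    T.dmAlong X (A + B) = T.dmAlong X A + T.dmAlong X B := by
  simp [dmAlong, Finset.sum_add_distrib]

theorem dmAlong_sub (X : Fin n → R) (A B : Matrix (Fin n) (Fin n) R) :
    T.dmAlong X (A - B) = T.dmAlong X A - T.dmAlong X B := by
  simp [dmAlong, smul_sub]

theorem dmAlong_mul (X : Fin n → R) (A B : Matrix (Fin n) (Fin n) R) :
    T.dmAlong X (A * B) = T.dmAlong X A * B + A * T.dmAlong X B := by
  simp [dmAlong, dm_mul, Finset.sum_add_distrib, Finset.sum_mul, Finset.mul_sum]

theorem dm_dmAlong (X : Fin n → R) (c : Fin n) (A : Matrix (Fin n) (Fin n) R) :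
    T.dm c (T.dmAlong X A) = ∑ e, T.d c (X e) • T.dm e A + T.dmAlong X (T.dm c A) := by
  simp only [dmAlong, dm_sum, dm_smul, Finset.sum_add_distrib, T.dm_comm c]

/-- The Lie derivative of a matrix-valued 1-form, with an inhomogeneous term. -/
def lieConn (X : Fin n → R) (Y : Matrix (Fin n) (Fin n) R)
    (F : Fin n → Matrix (Fin n) (Fin n) R) (c : Fin n) : Matrix (Fin n) (Fin n) R :=
  T.dmAlong X (F c) - Y * F c + F c * Y + ∑ e, T.d c (X e) • F e + T.dm c Y

/-- The curvature of a matrix-valued 1-form. -/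
def curvMat (F : Fin n → Matrix (Fin n) (Fin n) R) (c e : Fin n) : Matrix (Fin n) (Fin n) R :=
  T.dm c (F e) - T.dm e (F c) + F c * F e - F e * F c

/-- `lieConn` is the change of the connection under the flow of `X` combined with the infinitesimal
frame change `Y`. Curvature is natural under both, so its change is the covariant exterior
derivative of the change of the connection. No relation between `X`, `Y` and `F` is needed. -/
theorem lie_curvMat (X : Fin n → R) (Y : Matrix (Fin n) (Fin n) R)
    (F : Fin n → Matrix (Fin n) (Fin n) R) (c e : Fin n) :
    T.dmAlong X (T.curvMat F c e) - Y * T.curvMat F c e + T.curvMat F c e * Y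
        + ∑ f, T.d c (X f) • T.curvMat F f e + ∑ f, T.d e (X f) • T.curvMat F c f
      = (T.dm c (T.lieConn X Y F e) + F c * T.lieConn X Y F e - T.lieConn X Y F e * F c)
        - (T.dm e (T.lieConn X Y F c) + F e * T.lieConn X Y F c - T.lieConn X Y F c * F e) := by
  simp only [lieConn, curvMat, map_add, map_sub, dm_dmAlong, dmAlong_add, dmAlong_sub,
    dmAlong_mul, dm_mul, dm_sum, dm_smul, smul_add, smul_sub, Finset.sum_add_distrib,
    Finset.sum_sub_distrib, mul_add, add_mul, mul_sub, sub_mul, Finset.mul_sum, Finset.sum_mul,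
    mul_smul_comm, smul_mul_assoc, T.dm_comm e c, T.d_comm e c, mul_assoc]
  abel

/-- The compatibility condition `∂G = F' G + G F` is itself varied. The left and right connections
are kept apart so that the identity is bare matrix algebra; later `F'` is the transpose of `F`. -/
theorem lie_compat (X : Fin n → R) (Y Y' G : Matrix (Fin n) (Fin n) R)
    (F F' : Fin n → Matrix (Fin n) (Fin n) R) (h : ∀ c, T.dm c G = F' c * G + G * F c)
    (c : Fin n) :
    T.dm c (T.dmAlong X G + Y' * G + G * Y)
        - F' c * (T.dmAlong X G + Y' * G + G * Y) - (T.dmAlong X G + Y' * G + G * Y) * F c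
      = (T.dmAlong X (F' c) - F' c * Y' + Y' * F' c + ∑ e, T.d c (X e) • F' e + T.dm c Y') * G
        + G * T.lieConn X Y F c := by
  simp only [lieConn, map_add, dm_dmAlong, dmAlong_add, dmAlong_mul, dm_mul, h, smul_add, Finset.sum_add_distrib,
    mul_add, add_mul, mul_sub, sub_mul, Finset.mul_sum, Finset.sum_mul,
    mul_smul_comm, smul_mul_assoc, mul_assoc]
  abel

/-- The Lie derivative of the Christoffel symbols. -/
def lieΓ (X : Fin n → R) (a b c : Fin n) : R :=
  T.d b (T.d c (X a)) + ∑ e, X e * T.d e (T.Γ a b c) - ∑ e, T.d e (X a) * T.Γ e b c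
    + ∑ e, T.Γ a e c * T.d b (X e) + ∑ e, T.Γ a b e * T.d c (X e)

theorem lieΓ_symm (X : Fin n → R) (a b c : Fin n) : T.lieΓ X a b c = T.lieΓ X a c b := by
  have h : ∀ b c, ∑ e, T.Γ a e c * T.d b (X e) = ∑ e, T.Γ a c e * T.d b (X e) := fun b c =>
    Finset.sum_congr rfl fun e _ => by rw [T.Γ_symm]
  simp only [lieΓ, T.d_comm b c, T.Γ_symm _ c b, h]
  ring

/-- The connection matrices. -/
def Γm (c : Fin n) : Matrix (Fin n) (Fin n) R := Matrix.of fun a b => T.Γ a c b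

/-- The Jacobian matrix of a vector field. -/
def jac (X : Fin n → R) : Matrix (Fin n) (Fin n) R := Matrix.of fun a b => T.d b (X a)

theorem lieConn_Γm (X : Fin n → R) (a b c : Fin n) :
    T.lieConn X (T.jac X) T.Γm c a b = T.lieΓ X a c b := by
  simp only [lieConn, lieΓ, jac, Γm, dmAlong, Matrix.add_apply, Matrix.sub_apply,
    Matrix.mul_apply, Matrix.of_apply, Matrix.sum_apply, Matrix.smul_apply, dm_apply, smul_eq_mul,
    fun e => mul_comm (T.Γ a e b) (T.d c (X e))]
  ring

theorem curvMat_Γm (a b c e : Fin n) : T.curvMat T.Γm c e a b = T.riem a b c e := by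
  simp only [curvMat, riem, Γm, Matrix.add_apply, Matrix.sub_apply,
    Matrix.mul_apply, Matrix.of_apply, dm_apply, Finset.sum_sub_distrib, fun x => T.Γ_symm x b e,
    fun x => T.Γ_symm x b c]
  ring

/-- The Lie derivative of the mixed curvature tensor. -/
def lieRiem (X : Fin n → R) (a b c e : Fin n) : R :=
  ∑ f, (X f * T.d f (T.riem a b c e) - T.d f (X a) * T.riem f b c e
    + T.riem a f c e * T.d b (X f) + T.riem a b f e * T.d c (X f) + T.riem a b c f * T.d e (X f))

/-- This is the Palatini identity `L_X R = ∇_c (L_X Γ)_e - ∇_e (L_X Γ)_c`, obtained from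
`lie_curvMat` with `Y` the Jacobian of `X`. The connection terms acting on the form indices `c`, `e`
cancel by the symmetry of `Γ` and do not appear. -/
theorem lieRiem_eq (X : Fin n → R) (a b c e : Fin n) :
    T.lieRiem X a b c e
      = (T.d c (T.lieΓ X a e b) + ∑ f, T.Γ a c f * T.lieΓ X f e b
          - ∑ f, T.lieΓ X a e f * T.Γ f c b)
        - (T.d e (T.lieΓ X a c b) + ∑ f, T.Γ a e f * T.lieΓ X f c b
          - ∑ f, T.lieΓ X a c f * T.Γ f e b) := by
  have h := congrFun (congrFun (T.lie_curvMat X (T.jac X) T.Γm c e) a) b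
  simp only [Matrix.add_apply, Matrix.sub_apply, Matrix.mul_apply, Matrix.sum_apply,
    Matrix.smul_apply, dm_apply, smul_eq_mul, curvMat_Γm, lieConn_Γm, dmAlong] at h
  simp only [jac, Γm, Matrix.of_apply] at h
  rw [← h, lieRiem]
  simp only [Finset.sum_add_distrib, Finset.sum_sub_distrib, fun f => mul_comm (T.d c (X f)),
    fun f => mul_comm (T.d e (X f))]

/-- The covariant derivative of the Lie derivative of the metric. -/
theorem nabl2_lieTwo_G (X : Fin n → R) (c a b : Fin n) :
    T.nabl2 (T.lieTwo X T.G) c a b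
      = ∑ e, T.G b e * T.lieΓ X e c a + ∑ e, T.G a e * T.lieΓ X e c b := by
  have hH : T.dmAlong X (Matrix.of T.G) + (T.jac X).transpose * Matrix.of T.G
      + Matrix.of T.G * T.jac X = Matrix.of (T.lieTwo X T.G) := by
    ext a b
    simp only [dmAlong, jac, lieTwo, Matrix.add_apply, Matrix.mul_apply, Matrix.sum_apply,
      Matrix.smul_apply, dm_apply, smul_eq_mul, Matrix.of_apply, Matrix.transpose_apply,
      Finset.sum_add_distrib, fun e => mul_comm (T.G e b)]
  have hc : ∀ c, T.dm c (Matrix.of T.G)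
      = (T.Γm c).transpose * Matrix.of T.G + Matrix.of T.G * T.Γm c := by
    intro c
    ext a b
    simp only [Γm, dm_apply, Matrix.add_apply, Matrix.mul_apply, Matrix.of_apply,
      Matrix.transpose_apply, T.d_G]
  have hT : T.dmAlong X (T.Γm c).transpose - (T.Γm c).transpose * (T.jac X).transpose
      + (T.jac X).transpose * (T.Γm c).transpose
      + ∑ e, T.d c (X e) • (T.Γm e).transpose + T.dm c (T.jac X).transpose
      = (T.lieConn X (T.jac X) T.Γm c).transpose := by
    have h1 : ∀ A : Matrix (Fin n) (Fin n) R, T.dm c A.transpose = (T.dm c A).transpose :=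
      fun _ => rfl
    have h2 : ∀ A : Matrix (Fin n) (Fin n) R,
        T.dmAlong X A.transpose = (T.dmAlong X A).transpose := by
      intro A
      simp only [dmAlong, Matrix.transpose_sum, Matrix.transpose_smul]
      rfl
    simp only [lieConn, Matrix.transpose_add, Matrix.transpose_sub, Matrix.transpose_mul, h1, h2,
      Matrix.transpose_sum, Matrix.transpose_smul]
  have h := T.lie_compat X (T.jac X) (T.jac X).transpose (Matrix.of T.G) T.Γm
    (fun c => (T.Γm c).transpose) hc c
  beta_reduce at h
  rw [hH, hT] at h
  have h' := congrFun (congrFun h a) b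
  simp only [Matrix.add_apply, Matrix.sub_apply, Matrix.mul_apply, dm_apply, lieConn_Γm,
    Matrix.of_apply, Matrix.transpose_apply, Γm] at h'
  rw [nabl2]
  simp only [fun e => T.G_symm b e, fun e => mul_comm (T.G e b),
    fun e => mul_comm (T.Γ e c b)]
  exact h'

/-- The Lie derivative of the connection in terms of that of the metric. -/
theorem two_mul_low_lieΓ (X : Fin n → R) (a b c : Fin n) :
    2 * ∑ e, T.G a e * T.lieΓ X e b c
      = T.nabl2 (T.lieTwo X T.G) b a c + T.nabl2 (T.lieTwo X T.G) c a b
        - T.nabl2 (T.lieTwo X T.G) a b c := by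
  simp only [nabl2_lieTwo_G, fun e => T.lieΓ_symm X e c b, fun e => T.lieΓ_symm X e b a,
    fun e => T.lieΓ_symm X e c a]
  ring

end DiffMetric

end

end KerrSchild

namespace KerrSchild

noncomputable section

namespace DiffMetric

variable {n : ℕ} {R : Type*} [CommRing R] [Algebra ℝ R] (T : DiffMetric n R)

/-! #### Null covector fields -/

variable {T}

theorem nabl_mul_up {l : Fin n → R} (hn : ∑ a, l a * T.up l a = 0) (c : Fin n) :
    ∑ a, T.nabl l c a * T.up l a = 0 := by
  have h := T.d_pairing l (T.up l) c
  rw [hn, map_zero] at h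
  have h2 : ∑ a, l a * T.nabv (T.up l) c a = ∑ a, T.nabl l c a * T.up l a := by
    simp only [nabv_up]
    rw [← sum_up_mul]
    exact Finset.sum_congr rfl fun a _ => mul_comm _ _
  rw [h2, ← two_mul] at h
  exact two_mul_cancel (by rw [← h, mul_zero])

theorem mul_nabv_up {l : Fin n → R} (hn : ∑ a, l a * T.up l a = 0) (c : Fin n) :
    ∑ a, l a * T.nabv (T.up l) c a = 0 := by
  rw [← T.nabl_mul_up hn c]
  simp only [nabv_up]
  rw [← sum_up_mul]
  exact Finset.sum_congr rfl fun a _ => mul_comm _ _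

variable (T)

/-- The acceleration covector. -/
def accLow (l : Fin n → R) (b : Fin n) : R := ∑ a, T.up l a * T.nabl l a b

theorem acc_eq_up (l : Fin n → R) (b : Fin n) : T.acc l b = T.up (T.accLow l) b := by
  simp only [acc, accLow, nabv_up, up, Finset.mul_sum]
  rw [Finset.sum_comm]
  exact Finset.sum_congr rfl fun a _ => Finset.sum_congr rfl fun c _ => by ring

theorem accSq_eq (l : Fin n → R) : T.accSq l = ∑ a, T.accLow l a * T.acc l a := by
  have h : T.accLow l = T.low (T.acc l) := by
    rw [show T.acc l = T.up (T.accLow l) from funext (T.acc_eq_up l), low_up]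
  rw [h, sum_low_mul]
  simp only [accSq, low, Finset.mul_sum]
  exact Finset.sum_congr rfl fun a _ => Finset.sum_congr rfl fun c _ => by ring

/-- The transposed covariant derivative `∇^a l_b` of a covector field. -/
def nablT (l : Fin n → R) (b a : Fin n) : R := T.up (fun e => T.nabl l e b) a

/-- The divergence of the vector field metrically dual to a covector field. -/
def dvg (l : Fin n → R) : R := ∑ a, T.nabv (T.up l) a a

theorem sum_nablT (l : Fin n → R) : ∑ a, T.nablT l a a = T.dvg l := by
  simp only [nablT, dvg, nabv_up, up]
  rw [Finset.sum_comm]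
  exact Finset.sum_congr rfl fun a _ => Finset.sum_congr rfl fun c _ => by rw [T.g_symm]

theorem sum_g_nabl (l : Fin n → R) : ∑ a, ∑ b, T.g a b * T.nabl l a b = T.dvg l := by
  simp only [dvg, nabv_up, up]

theorem mul_nablT (l : Fin n → R) (b : Fin n) : ∑ a, l a * T.nablT l b a = T.accLow l b := by
  simp only [nablT, ← sum_up_mul, accLow]

theorem sum_up_g (l : Fin n → R) (p : Fin n → R) :
    ∑ a, ∑ b, T.g a b * (l a * p b) = ∑ a, T.up l a * p a := by
  simp only [up, Finset.sum_mul]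
  rw [Finset.sum_comm]
  exact Finset.sum_congr rfl fun a _ => Finset.sum_congr rfl fun c _ => by rw [T.g_symm]; ring

theorem nablT_mul_up {l : Fin n → R} (hn : ∑ a, l a * T.up l a = 0) (a : Fin n) :
    ∑ c, T.nablT l c a * T.up l c = 0 := by
  simp only [nablT, up, Finset.sum_mul]
  rw [Finset.sum_comm]
  have h : ∀ e, ∑ c, T.nabl l e c * ∑ b, T.g c b * l b = 0 := fun e => T.nabl_mul_up hn e
  simp only [mul_assoc, ← Finset.mul_sum, h, mul_zero, Finset.sum_const_zero]

/-! #### Kerr-Schild deformations of the connection -/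

section KerrSchild

variable {T} {X l : Fin n → R} {h : R}

/-- The Koszul formula `two_mul_low_lieΓ` for the deformation `2 h l ⊗ l`. Derivatives of `h` enter
the later identities through this formula. -/
theorem low_lieΓ (hX : ∀ a b, T.lieTwo X T.G a b = 2 * h * l a * l b) (a b c : Fin n) :
    ∑ e, T.G a e * T.lieΓ X e b c
      = T.d b h * l a * l c + T.d c h * l a * l b - T.d a h * l b * l c
        + h * (T.nabl l b c * l a + l c * T.nabl l b a + T.nabl l c b * l a + l b * T.nabl l c a
          - T.nabl l a b * l c - l b * T.nabl l a c) := by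
  have hH : ∀ c a b, T.nabl2 (T.lieTwo X T.G) c a b
      = 2 * (T.d c h * l a * l b + h * T.nabl l c a * l b + h * l a * T.nabl l c b) := by
    intro c a b
    simp only [nabl2, hX, Derivation.leibniz, smul_eq_mul, nabl]
    have h1 : ∑ e, T.Γ e c a * (2 * h * l e * l b) = 2 * h * l b * ∑ e, T.Γ e c a * l e := by
      rw [Finset.mul_sum]; exact Finset.sum_congr rfl fun _ _ => by ring
    have h2 : ∑ e, T.Γ e c b * (2 * h * l a * l e) = 2 * h * l a * ∑ e, T.Γ e c b * l e := by
      rw [Finset.mul_sum]; exact Finset.sum_congr rfl fun _ _ => by ring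
    have h3 : T.d c (2 : R) = 0 := (T.d c).map_natCast 2
    rw [h1, h2, h3]; ring
  apply two_mul_cancel (R := R)
  rw [two_mul_low_lieΓ, hH, hH, hH]; ring

theorem lieΓ_eq (hX : ∀ a b, T.lieTwo X T.G a b = 2 * h * l a * l b) (a b c : Fin n) :
    T.lieΓ X a b c
      = T.d b h * T.up l a * l c + T.d c h * T.up l a * l b
        - T.up (fun e => T.d e h) a * l b * l c
        + h * (T.nabl l b c * T.up l a + l c * T.nabv (T.up l) b a + T.nabl l c b * T.up l a
          + l b * T.nabv (T.up l) c a - T.nablT l b a * l c - l b * T.nablT l c a) := by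
  have h1 : T.lieΓ X a b c = T.up (T.low fun e => T.lieΓ X e b c) a := by rw [up_low]
  have h2 : (T.low fun e => T.lieΓ X e b c) = _ := funext fun a => low_lieΓ hX a b c
  rw [h1, h2]
  simp only [nablT, nabv_up, up, mul_add, mul_sub, Finset.sum_add_distrib,
    Finset.sum_sub_distrib, Finset.sum_mul, Finset.mul_sum]
  simp only [← Finset.sum_add_distrib, ← Finset.sum_sub_distrib]
  exact Finset.sum_congr rfl fun _ _ => by ring

/-- Derivatives of `h` in directions other than `l` come with a factor `l_c l^c` and drop out. -/
theorem lieΓ_mul_up (hn : ∑ a, l a * T.up l a = 0)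
    (hX : ∀ a b, T.lieTwo X T.G a b = 2 * h * l a * l b) (a b : Fin n) :
    ∑ c, T.lieΓ X a b c * T.up l c
      = (T.along (T.up l) h * l b + h * T.accLow l b) * T.up l a + h * l b * T.acc l a := by
  have e : ∀ c, T.lieΓ X a b c * T.up l c
      = (T.d b h * T.up l a - T.up (fun e => T.d e h) a * l b
            + h * (T.nabv (T.up l) b a - T.nablT l b a)) * (l c * T.up l c)
        + (T.up l a * l b) * (T.up l c * T.d c h)
        + h * T.up l a * (T.nabl l b c * T.up l c) + h * T.up l a * (T.up l c * T.nabl l c b)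
        + h * l b * (T.up l c * T.nabv (T.up l) c a)
        - h * l b * (T.nablT l c a * T.up l c) := fun c => by
    rw [lieΓ_eq hX]; ring
  simp only [e, Finset.sum_add_distrib, Finset.sum_sub_distrib, ← Finset.mul_sum, hn,
    T.nabl_mul_up hn, T.nablT_mul_up hn, along_apply, accLow, acc]
  ring

/-- The trace of `Γ` is the logarithmic derivative of the volume density, and `X` preserves the
volume because `2 h l ⊗ l` is trace-free. This removes one of the two divergences from the varied
Ricci tensor. -/
theorem lieΓ_trace (hn : ∑ a, l a * T.up l a = 0)
    (hX : ∀ a b, T.lieTwo X T.G a b = 2 * h * l a * l b) (b : Fin n) :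
    ∑ a, T.lieΓ X a a b = 0 := by
  have e : ∀ a, T.lieΓ X a a b
      = l b * (T.up l a * T.d a h) + T.d b h * (l a * T.up l a)
        - l b * (l a * T.up (fun e => T.d e h) a)
        + h * (T.up l a * T.nabl l a b) + h * l b * T.nabv (T.up l) a a
        + h * (T.nabl l b a * T.up l a) + h * (l a * T.nabv (T.up l) b a)
        - h * l b * T.nablT l a a - h * (l a * T.nablT l b a) := fun a => by
    rw [lieΓ_eq hX]; ring
  simp only [e, Finset.sum_add_distrib, Finset.sum_sub_distrib, ← Finset.mul_sum, hn,
    T.nabl_mul_up hn, T.mul_nabv_up hn, mul_nablT, sum_nablT, ← sum_up_mul, accLow, dvg]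
  ring

theorem lieΓ_mul (hn : ∑ a, l a * T.up l a = 0)
    (hX : ∀ a b, T.lieTwo X T.G a b = 2 * h * l a * l b) (b c : Fin n) :
    ∑ a, T.lieΓ X a b c * l a
      = -(T.along (T.up l) h * l b * l c) - h * (T.accLow l b * l c + l b * T.accLow l c) := by
  have e : ∀ a, T.lieΓ X a b c * l a
      = (T.d b h * l c + T.d c h * l b + h * T.nabl l b c + h * T.nabl l c b) * (l a * T.up l a)
        - l b * l c * (l a * T.up (fun e => T.d e h) a)
        + h * l c * (l a * T.nabv (T.up l) b a) + h * l b * (l a * T.nabv (T.up l) c a)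
        - h * l c * (l a * T.nablT l b a) - h * l b * (l a * T.nablT l c a) := fun a => by
    rw [lieΓ_eq hX]; ring
  simp only [e, Finset.sum_add_distrib, Finset.sum_sub_distrib, ← Finset.mul_sum, hn,
    T.mul_nabv_up hn, mul_nablT, ← sum_up_mul, along_apply]
  ring

/-- The divergence of this vector is the metric trace of `L_X Ric`; see `g_mul_lieTwo_ric`. -/
theorem g_mul_lieΓ (hn : ∑ a, l a * T.up l a = 0)
    (hX : ∀ a b, T.lieTwo X T.G a b = 2 * h * l a * l b) (a : Fin n) :
    ∑ b, ∑ c, T.g b c * T.lieΓ X a b c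
      = 2 * ((T.along (T.up l) h + h * T.dvg l) * T.up l a + h * T.acc l a) := by
  have e : ∀ b c, T.g b c * T.lieΓ X a b c
      = T.up l a * (T.g c b * (l c * T.d b h)) + T.up l a * (T.g b c * (l b * T.d c h))
        - T.up (fun e => T.d e h) a * (T.g b c * (l b * l c))
        + h * T.up l a * (T.g b c * T.nabl l b c) + h * T.up l a * (T.g c b * T.nabl l c b)
        + h * (T.g c b * (l c * T.nabv (T.up l) b a)) + h * (T.g b c * (l b * T.nabv (T.up l) c a))
        - h * (T.g c b * (l c * T.nablT l b a)) - h * (T.g b c * (l b * T.nablT l c a)) :=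
    fun b c => by
      rw [lieΓ_eq hX, T.g_symm c b]; ring
  have s : ∀ F : Fin n → Fin n → R, ∑ b, ∑ c, F c b = ∑ b, ∑ c, F b c :=
    fun F => Finset.sum_comm
  have hn' : ∑ a, T.up l a * l a = 0 := by rw [← hn]; simp only [mul_comm]
  have hT : ∑ c, T.up l c * T.nablT l c a = 0 := by
    rw [← T.nablT_mul_up hn a]; simp only [mul_comm]
  simp only [e, Finset.sum_add_distrib, Finset.sum_sub_distrib, ← Finset.mul_sum]
  rw [s fun b c => T.g b c * (l b * T.d c h), s fun b c => T.g b c * T.nabl l b c,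
    s fun b c => T.g b c * (l b * T.nabv (T.up l) c a),
    s fun b c => T.g b c * (l b * T.nablT l c a)]
  simp only [sum_up_g, sum_g_nabl, hn', hT, along_apply, acc]
  ring

/-! #### Deformations of the curvature -/

/-- The Leibniz form of `lieRiem_eq`, moving `u` under the derivative. The form index of `L_X Γ · u`
is a mere label for `nabv`; the omitted connection terms are symmetric in `c`, `e` and cancel. -/
theorem lieRiem_mul (T : DiffMetric n R) (X u : Fin n → R) (a c e : Fin n) :
    ∑ b, T.lieRiem X a b c e * u b
      = T.nabv (fun f => ∑ b, T.lieΓ X f e b * u b) c a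
        - T.nabv (fun f => ∑ b, T.lieΓ X f c b * u b) e a
        - ∑ f, T.lieΓ X a e f * T.nabv u c f + ∑ f, T.lieΓ X a c f * T.nabv u e f := by
  simp only [lieRiem_eq, nabv, map_sum, Derivation.leibniz, smul_eq_mul, mul_add, add_mul, sub_mul,
    Finset.sum_add_distrib, Finset.sum_sub_distrib, Finset.mul_sum, Finset.sum_mul]
  rw [Finset.sum_comm (f := fun x i => T.Γ a c x * (T.lieΓ X x e i * u i)),
    Finset.sum_comm (f := fun x i => T.Γ a e x * (T.lieΓ X x c i * u i)),
    Finset.sum_comm (f := fun x i => T.lieΓ X a e x * (T.Γ x c i * u i)),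
    Finset.sum_comm (f := fun x i => T.lieΓ X a c x * (T.Γ x e i * u i))]
  simp only [mul_assoc, fun x => mul_comm (u x) (T.d c (T.lieΓ X a e x)),
    fun x => mul_comm (u x) (T.d e (T.lieΓ X a c x))]
  ring

/-- Contraction of an upper with a lower index commutes with `L_X`: the two Jacobian terms on the
contracted pair cancel. -/
theorem lieTwo_ric (T : DiffMetric n R) (X : Fin n → R) (a b : Fin n) :
    T.lieTwo X T.ric a b = ∑ c, T.lieRiem X c a c b := by
  simp only [lieTwo, lieRiem, ric, map_sum, Finset.sum_add_distrib, Finset.sum_sub_distrib,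
    Finset.mul_sum, Finset.sum_mul]
  rw [Finset.sum_comm (f := fun x i => X x * _), Finset.sum_comm (f := fun x i => _ * T.d a (X x)),
    Finset.sum_comm (f := fun x i => T.riem i a i x * T.d b (X x)),
    Finset.sum_comm (f := fun x i => T.d i (X x) * _)]
  simp only [mul_comm (T.d _ (X _))]
  ring

/-- In the trace of `lieRiem_mul`, every term with a traced `L_X Γ` vanishes by `lieΓ_trace`. The
second divergence leaves only the connection term, which corrects the free index `e` that the first
one treats as a label. -/
theorem lieTwo_ric_mul_up (hn : ∑ a, l a * T.up l a = 0)
    (hX : ∀ a b, T.lieTwo X T.G a b = 2 * h * l a * l b) (e : Fin n) :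
    ∑ a, T.lieTwo X T.ric a e * T.up l a
      = ∑ c, T.nabv (fun f => ∑ b, T.lieΓ X f e b * T.up l b) c c
        - ∑ c, ∑ f, T.Γ c e f * ∑ b, T.lieΓ X f c b * T.up l b
        - ∑ c, ∑ f, T.lieΓ X c e f * T.nabv (T.up l) c f := by
  have h0 : ∑ c, ∑ b, T.lieΓ X c c b * T.up l b = 0 := by
    rw [Finset.sum_comm]
    simp only [← Finset.sum_mul, lieΓ_trace hn hX, zero_mul, Finset.sum_const_zero]
  have h1 : ∑ c, T.nabv (fun f => ∑ b, T.lieΓ X f c b * T.up l b) e c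
      = ∑ c, ∑ f, T.Γ c e f * ∑ b, T.lieΓ X f c b * T.up l b := by
    simp only [nabv, Finset.sum_add_distrib, ← map_sum, h0, map_zero, zero_add]
  have h2 : ∑ c, ∑ f, T.lieΓ X c c f * T.nabv (T.up l) e f = 0 := by
    rw [Finset.sum_comm]
    simp only [← Finset.sum_mul, lieΓ_trace hn hX, zero_mul, Finset.sum_const_zero]
  simp only [lieTwo_ric, Finset.sum_mul]
  rw [Finset.sum_comm]
  simp only [lieRiem_mul, Finset.sum_add_distrib, Finset.sum_sub_distrib, h1, h2, add_zero]

/-- The Lie derivative of the Ricci tensor, contracted twice with the null vector. -/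
theorem lieTwo_ric_mul_up_up (hn : ∑ a, l a * T.up l a = 0)
    (hX : ∀ a b, T.lieTwo X T.G a b = 2 * h * l a * l b) :
    ∑ a, ∑ b, T.up l a * T.up l b * T.lieTwo X T.ric a b = -2 * h * T.accSq l := by
  set w : Fin n → Fin n → R := fun e f => ∑ b, T.lieΓ X f e b * T.up l b with hw
  have hw' : ∀ e f, w e f = (T.along (T.up l) h * l e + h * T.accLow l e) * T.up l f
      + h * l e * T.acc l f := fun e f => lieΓ_mul_up hn hX f e
  have hn' : ∑ a, T.up l a * l a = 0 := by rw [← hn]; simp only [mul_comm]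
  have hacc : ∑ e, T.up l e * T.accLow l e = 0 := by
    simp only [accLow, Finset.mul_sum]
    rw [Finset.sum_comm]
    have : ∀ x y, T.up l y * (T.up l x * T.nabl l x y)
      = T.up l x * (T.nabl l x y * T.up l y) := fun x y => by ring
    simp only [this, ← Finset.mul_sum, T.nabl_mul_up hn, mul_zero, Finset.sum_const_zero]
  -- Since `w` annihilates `l` in its form index, the derivative in the divergence of `w` can be
  -- moved onto `l`.
  have hvw : ∀ f, ∑ e, T.up l e * w e f = 0 := by
    intro f
    have : ∀ e, T.up l e * w e f = (T.along (T.up l) h * T.up l f + h * T.acc l f)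
        * (T.up l e * l e) + h * T.up l f * (T.up l e * T.accLow l e) := fun e => by
      rw [hw']; ring
    simp only [this, Finset.sum_add_distrib, ← Finset.mul_sum, hn', hacc]
    ring
  have hdw : ∀ f, ∑ e, T.up l e * T.d f (w e f) = - ∑ e, w e f * T.d f (T.up l e) := by
    intro f
    have := congrArg (T.d f) (hvw f)
    simp only [map_sum, Derivation.leibniz, smul_eq_mul, Finset.sum_add_distrib, map_zero] at this
    exact eq_neg_of_add_eq_zero_left this
  -- The terms of `w` proportional to `l_e` drop out by `l_e ∇_c l^e = 0`; the remaining one pairs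
  -- the acceleration with itself.
  have hfin : ∑ e, ∑ c, w e c * T.nabv (T.up l) c e = h * T.accSq l := by
    have : ∀ e c, w e c * T.nabv (T.up l) c e
      = (T.along (T.up l) h * T.up l c + h * T.acc l c) * (l e * T.nabv (T.up l) c e)
        + h * (T.accLow l e * (T.up l c * T.nabv (T.up l) c e)) := fun e c => by
      rw [hw']; ring
    simp only [this, Finset.sum_add_distrib]
    rw [Finset.sum_comm]
    simp only [← Finset.mul_sum, T.mul_nabv_up hn, mul_zero, Finset.sum_const_zero, accSq_eq, acc]
    ring
  have h1 : ∑ e, T.up l e * ∑ c, T.nabv (w e) c c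
      = - ∑ e, ∑ c, w e c * T.d c (T.up l e) := by
    simp only [nabv, Finset.sum_add_distrib, mul_add, Finset.mul_sum]
    rw [Finset.sum_comm]
    simp only [hdw, Finset.sum_neg_distrib]
    rw [Finset.sum_comm (f := fun c e => w e c * _)]
    have : ∑ e, ∑ c, ∑ f, T.up l e * (T.Γ c c f * w e f) = 0 := by
      rw [Finset.sum_comm]
      refine Finset.sum_eq_zero fun c _ => ?_
      rw [Finset.sum_comm]
      refine Finset.sum_eq_zero fun f _ => ?_
      have : ∀ e, T.up l e * (T.Γ c c f * w e f) = T.Γ c c f * (T.up l e * w e f) :=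
        fun e => by ring
      simp only [this, ← Finset.mul_sum, hvw, mul_zero]
    rw [this, add_zero]
  have h2 : ∑ e, T.up l e * ∑ c, ∑ f, T.Γ c e f * w c f
      = ∑ e, ∑ c, w e c * ∑ f, T.Γ e c f * T.up l f := by
    simp only [Finset.mul_sum]
    rw [Finset.sum_comm]
    refine Finset.sum_congr rfl fun c _ => ?_
    rw [Finset.sum_comm]
    refine Finset.sum_congr rfl fun f _ => Finset.sum_congr rfl fun e _ => ?_
    rw [T.Γ_symm c e f]; ring
  have h3 : ∑ e, T.up l e * ∑ c, ∑ f, T.lieΓ X c e f * T.nabv (T.up l) c f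
      = ∑ e, ∑ c, w e c * T.nabv (T.up l) c e := by
    simp only [Finset.mul_sum, hw, Finset.sum_mul]
    rw [Finset.sum_comm]
    conv_rhs => rw [Finset.sum_comm]
    refine Finset.sum_congr rfl fun c _ => ?_
    rw [Finset.sum_comm]
    refine Finset.sum_congr rfl fun f _ => Finset.sum_congr rfl fun e _ => ?_
    rw [T.lieΓ_symm X c e f]; ring
  have hκ : ∑ e, ∑ c, w e c * T.nabv (T.up l) c e = ∑ e, ∑ c, w e c * T.d c (T.up l e)
      + ∑ e, ∑ c, w e c * ∑ f, T.Γ e c f * T.up l f := by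
    simp only [nabv, mul_add, Finset.sum_add_distrib]
  have hmain : ∑ a, ∑ b, T.up l a * T.up l b * T.lieTwo X T.ric a b
      = ∑ e, T.up l e * ∑ a, T.lieTwo X T.ric a e * T.up l a := by
    simp only [Finset.mul_sum]
    rw [Finset.sum_comm]
    exact Finset.sum_congr rfl fun _ _ => Finset.sum_congr rfl fun _ _ => by ring
  rw [hmain]
  simp only [lieTwo_ric_mul_up hn hX, mul_sub, Finset.sum_sub_distrib]
  rw [h1, h2, h3, hfin]
  -- The partial derivatives from `h1` and the connection terms from `h2` add up to one copy of `w ·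
  -- ∇l`, and `h3` is another. Hence the factor 2 in `-2 h a²`.
  linear_combination (-1 : R) * hfin + hκ

end KerrSchild

end DiffMetric

end

end KerrSchild

namespace KerrSchild

noncomputable section

namespace DiffMetric

variable {n : ℕ} {R : Type*} [CommRing R] [Algebra ℝ R]

/-! #### Geodesic null covector fields -/

section Geodesic

variable {T : DiffMetric n R} {l : Fin n → R} {Mf : R}

theorem accLow_geodesic (hg : ∀ a, T.acc l a = Mf * T.up l a) (a : Fin n) :
    T.accLow l a = Mf * l a := by
  have h : T.accLow l = T.low (T.acc l) := by
    rw [show T.acc l = T.up (T.accLow l) from funext (T.acc_eq_up l), low_up]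
  have h2 : l a = T.low (T.up l) a := by rw [low_up]
  rw [h, h2]
  simp only [low, hg, Finset.mul_sum, mul_left_comm]

theorem nabv_smul (T : DiffMetric n R) (f : R) (u : Fin n → R) (c a : Fin n) :
    T.nabv (fun b => f * u b) c a = T.d c f * u a + f * T.nabv u c a := by
  simp only [nabv, Derivation.leibniz, smul_eq_mul, mul_add, Finset.mul_sum, mul_left_comm f]
  ring

theorem sum_nabv_smul_up (T : DiffMetric n R) (f : R) (l : Fin n → R) :
    ∑ a, T.nabv (fun b => f * T.up l b) a a = T.along (T.up l) f + f * T.dvg l := by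
  simp only [nabv_smul, Finset.sum_add_distrib, ← Finset.mul_sum, along_apply, dvg,
    mul_comm (T.up l _)]

/-- The trace of the square of the covariant derivative of a vector field. -/
def trSq (T : DiffMetric n R) (l : Fin n → R) : R :=
  ∑ a, ∑ b, T.nabv (T.up l) a b * T.nabv (T.up l) b a

/-- The squared length of the covariant derivative of a covector field. -/
def normSq (T : DiffMetric n R) (l : Fin n → R) : R :=
  ∑ a, ∑ b, T.nablT l b a * T.nabv (T.up l) a b

/-- The Raychaudhuri equation. -/
theorem ricBar_geodesic (hg : ∀ a, T.acc l a = Mf * T.up l a) :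
    T.ricBar l = T.along (T.up l) Mf + Mf * T.dvg l - T.along (T.up l) (T.dvg l) - T.trSq l := by
  have h1 : T.ricBar l = ∑ b, T.up l b * ∑ c, ((T.d c (T.nabv (T.up l) b c)
      + ∑ f, T.Γ c c f * T.nabv (T.up l) b f)
        - (T.d b (T.nabv (T.up l) c c) + ∑ f, T.Γ c b f * T.nabv (T.up l) c f)) := by
    simp only [← riem_mul, ricBar, ric, Finset.sum_mul, Finset.mul_sum]
    rw [Finset.sum_comm]
    refine Finset.sum_congr rfl fun b _ => ?_
    rw [Finset.sum_comm]
    exact Finset.sum_congr rfl fun c _ => Finset.sum_congr rfl fun a _ => by ring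
  have h2 : ∑ b, T.up l b * ∑ c, T.d b (T.nabv (T.up l) c c) = T.along (T.up l) (T.dvg l) := by
    rw [along_apply]
    simp only [dvg, map_sum]
  -- Leibniz brings `l^b` under the derivative, where `l^b ∇_b l^c = M l^c` applies.
  have h3 : ∑ b, T.up l b * ∑ c, T.d c (T.nabv (T.up l) b c)
      = ∑ c, T.d c (Mf * T.up l c) - ∑ b, ∑ c, T.d c (T.up l b) * T.nabv (T.up l) b c := by
    simp only [← hg, acc, map_sum, Derivation.leibniz, smul_eq_mul, Finset.sum_add_distrib,
      Finset.mul_sum]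
    rw [Finset.sum_comm, Finset.sum_comm (f := fun c b => T.nabv (T.up l) b c * _)]
    simp only [mul_comm (T.nabv _ _ _)]
    ring
  have h4 : ∑ b, T.up l b * ∑ c, ∑ f, T.Γ c c f * T.nabv (T.up l) b f
      = ∑ c, ∑ f, T.Γ c c f * (Mf * T.up l f) := by
    simp only [← hg, acc, Finset.mul_sum]
    rw [Finset.sum_comm]
    refine Finset.sum_congr rfl fun c _ => ?_
    rw [Finset.sum_comm]
    exact Finset.sum_congr rfl fun f _ => Finset.sum_congr rfl fun b _ => by ring
  have h5 : ∑ b, T.up l b * ∑ c, ∑ f, T.Γ c b f * T.nabv (T.up l) c f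
      = ∑ b, ∑ c, (∑ f, T.Γ b c f * T.up l f) * T.nabv (T.up l) b c := by
    simp only [Finset.mul_sum, Finset.sum_mul]
    rw [Finset.sum_comm]
    conv_rhs => rw [Finset.sum_comm]
    conv_lhs => enter [2, c]; rw [Finset.sum_comm]
    conv_rhs => rw [Finset.sum_comm]
    refine Finset.sum_congr rfl fun c _ => ?_
    refine Finset.sum_congr rfl fun f _ => Finset.sum_congr rfl fun b _ => ?_
    rw [T.Γ_symm c f b]; ring
  have h6 : T.trSq l = ∑ b, ∑ c, T.d c (T.up l b) * T.nabv (T.up l) b c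
      + ∑ b, ∑ c, (∑ f, T.Γ b c f * T.up l f) * T.nabv (T.up l) b c := by
    rw [trSq]
    simp only [← Finset.sum_add_distrib, ← add_mul]
    exact Finset.sum_congr rfl fun f _ => Finset.sum_congr rfl fun b _ => mul_comm _ _
  have h7 := T.sum_nabv_smul_up Mf l
  simp only [nabv, Finset.sum_add_distrib] at h7
  rw [h1]
  simp only [Finset.sum_add_distrib, Finset.sum_sub_distrib, mul_add, mul_sub]
  rw [h2, h3, h4, h5]
  linear_combination h7 + h6

/-- Differentiating `l^b ∇_a l_b = 0` gives `l^b ∇_c ∇_a l_b = -∇_a l_b ∇_c l^b`; then trace over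
`a`, `c`. -/
theorem boxl_eq (hn : ∑ a, l a * T.up l a = 0) : T.boxl l = - T.normSq l := by
  have h : ∀ c a, ∑ b, T.up l b * T.nabl2 (T.nabl l) c a b
      = - ∑ b, T.nabl l a b * T.nabv (T.up l) c b := by
    intro c a
    have h1 := congrArg (T.d c) (T.nabl_mul_up hn a)
    rw [d_pairing, map_zero] at h1
    rw [← add_eq_zero_iff_eq_neg, ← h1]
    congr 1
    have h2 : ∀ b, T.up l b * T.nabl2 (T.nabl l) c a b
        = T.nabl (T.nabl l a) c b * T.up l b
          - ∑ e, T.Γ e c a * (T.nabl l e b * T.up l b) := fun b => by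
      have h3 : T.nabl (T.nabl l a) c b
        = T.d c (T.nabl l a b) - ∑ e, T.Γ e c b * T.nabl l a e := rfl
      rw [nabl2, h3]
      simp only [← mul_assoc, ← Finset.sum_mul]
      ring
    simp only [h2, Finset.sum_sub_distrib]
    rw [Finset.sum_comm (f := fun b e => T.Γ e c a * _)]
    simp only [← Finset.mul_sum, T.nabl_mul_up hn, mul_zero, Finset.sum_const_zero, sub_zero]
  have h3 : T.boxl l = ∑ c, ∑ a, T.g c a * ∑ b, T.up l b * T.nabl2 (T.nabl l) c a b := by
    rw [boxl, Finset.sum_comm]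
    refine Finset.sum_congr rfl fun c _ => ?_
    rw [Finset.sum_comm]
    refine Finset.sum_congr rfl fun a _ => ?_
    rw [Finset.mul_sum]
    exact Finset.sum_congr rfl fun b _ => by ring
  rw [h3]
  simp only [h, mul_neg, Finset.sum_neg_distrib, normSq, nablT]
  generalize T.nabv (T.up l) = κ
  simp only [up, Finset.sum_mul, Finset.mul_sum]
  congr 1
  refine Finset.sum_congr rfl fun c _ => ?_
  rw [Finset.sum_comm]
  exact Finset.sum_congr rfl fun b _ => Finset.sum_congr rfl fun a _ => by ring

theorem exps_eq (T : DiffMetric n R) (l : Fin n → R) : 2 * T.exps l = T.dvg l := two_smul_half _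

/-- With `f = ∇·l - M` this reads `Δ = -Df + (∇·l) f - 3 R̄ - 2 |∇l|²`, the form from which `Δ = 0`
is deduced when the gauge factors vanish. -/
theorem delta_eq (hn : ∑ a, l a * T.up l a = 0) (Mf : R) :
    T.delta l Mf = - T.along (T.up l) (T.dvg l) + T.dvg l ^ 2 - 3 * T.ricBar l
      - 2 * T.normSq l + T.along (T.up l) Mf - Mf * T.dvg l := by
  have h : T.along (T.up l) (T.dvg l) = 2 * T.along (T.up l) (T.exps l) := by
    rw [← exps_eq, Derivation.leibniz, show T.along (T.up l) (2 : R) = 0 from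
      (T.along (T.up l)).map_natCast 2]
    simp
  rw [delta, boxl_eq hn, h, ← exps_eq]
  ring

variable {X : Fin n → R} {h m : R}

/-- For geodesic `l` the contraction is `φ l_b l^a` with the single scalar `φ = Dh + 2 M h`. The
curvature contractions below are built from `φ` and `Dφ`. -/
theorem lieΓ_mul_up_geodesic (hn : ∑ a, l a * T.up l a = 0)
    (hX : ∀ a b, T.lieTwo X T.G a b = 2 * h * l a * l b)
    (hg : ∀ a, T.acc l a = Mf * T.up l a) (a b : Fin n) :
    ∑ c, T.lieΓ X a b c * T.up l c
      = ((T.along (T.up l) h + 2 * Mf * h) * l b) * T.up l a := by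
  rw [lieΓ_mul_up hn hX, hg, accLow_geodesic hg]; ring

theorem sum_up_mul_nabl (hg : ∀ a, T.acc l a = Mf * T.up l a) (b : Fin n) :
    ∑ c, T.up l c * T.nabl l c b = Mf * l b := accLow_geodesic hg b

theorem sum_up_mul_nabv (hg : ∀ a, T.acc l a = Mf * T.up l a) (b : Fin n) :
    ∑ c, T.up l c * T.nabv (T.up l) c b = Mf * T.up l b := hg b

/-- Antisymmetrised partial and covariant derivatives of `l` agree, and `l^c ∇_b l_c = 0`. -/
theorem sum_up_mul_d_sub (hn : ∑ a, l a * T.up l a = 0)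
    (hg : ∀ a, T.acc l a = Mf * T.up l a) (b : Fin n) :
    ∑ c, T.up l c * T.d b (l c) = ∑ c, T.up l c * T.d c (l b) - Mf * l b := by
  have h0 := T.nabl_mul_up hn b
  rw [← sum_up_mul_nabl hg]
  have h1 : ∀ c, T.up l c * T.d b (l c)
      = T.up l c * T.d c (l b) - T.up l c * T.nabl l c b + T.nabl l b c * T.up l c := fun c => by
    have := T.nabl_sub_nabl l c b
    linear_combination T.up l c * this
  simp only [h1, Finset.sum_add_distrib, Finset.sum_sub_distrib, h0, add_zero]

/-- This is the last term of `lieTwo_ric_mul_up`. Its `trSq` is later traded for `R̄` by the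
Raychaudhuri equation, and its `normSq` is the source of the wave operator in `Δ`. -/
theorem lieΓ_mul_nabv (hn : ∑ a, l a * T.up l a = 0)
    (hX : ∀ a b, T.lieTwo X T.G a b = 2 * h * l a * l b)
    (hg : ∀ a, T.acc l a = Mf * T.up l a) (a : Fin n) :
    ∑ c, ∑ e, T.lieΓ X c a e * T.nabv (T.up l) c e
      = (Mf * T.along (T.up l) h + h * (Mf ^ 2 + T.trSq l - T.normSq l)) * l a := by
  have key : ∀ c e, T.lieΓ X c a e * T.nabv (T.up l) c e
      = (T.d a h * T.up l c - T.up (fun e => T.d e h) c * l a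
            + h * T.nabv (T.up l) a c - h * T.nablT l a c) * (l e * T.nabv (T.up l) c e)
        + l a * (T.d e h * (T.up l c * T.nabv (T.up l) c e))
        + h * (T.nabl l a e * (T.up l c * T.nabv (T.up l) c e))
        + h * (T.nabl l e a * (T.up l c * T.nabv (T.up l) c e))
        + h * l a * (T.nabv (T.up l) c e * T.nabv (T.up l) e c)
        - h * l a * (T.nablT l e c * T.nabv (T.up l) c e) := fun c e => by
    rw [lieΓ_eq hX]; ring
  have s : ∀ F : Fin n → R, ∑ c, ∑ e, F e * (T.up l c * T.nabv (T.up l) c e)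
      = Mf * ∑ e, F e * T.up l e := fun F => by
    rw [Finset.sum_comm]
    simp only [← Finset.mul_sum, sum_up_mul_nabv hg]
    rw [Finset.mul_sum]
    exact Finset.sum_congr rfl fun e _ => by ring
  simp only [key, Finset.sum_add_distrib, Finset.sum_sub_distrib, ← Finset.mul_sum,
    T.mul_nabv_up hn, s, T.nabl_mul_up hn, mul_zero, Finset.sum_const_zero]
  have h1 : ∑ e, T.d e h * T.up l e = T.along (T.up l) h := by
    simp only [along_apply, mul_comm]
  have h2 : ∑ e, T.nabl l e a * T.up l e = Mf * l a := by
    rw [← sum_up_mul_nabl hg]; simp only [mul_comm]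
  rw [h1, h2, trSq, normSq]
  ring

/-- The Lie derivative of the Ricci tensor contracted with a geodesic null vector. -/
theorem lieTwo_ric_mul_up_geodesic (hn : ∑ a, l a * T.up l a = 0)
    (hX : ∀ a b, T.lieTwo X T.G a b = 2 * h * l a * l b)
    (hg : ∀ a, T.acc l a = Mf * T.up l a) (e : Fin n) :
    ∑ a, T.lieTwo X T.ric a e * T.up l a
      = (T.along (T.up l) (T.along (T.up l) h + 2 * Mf * h)
          + (T.dvg l + Mf) * (T.along (T.up l) h + 2 * Mf * h)
          - Mf * T.along (T.up l) h - h * (Mf ^ 2 + T.trSq l - T.normSq l)) * l e := by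
  set φ := T.along (T.up l) h + 2 * Mf * h with hφ
  rw [lieTwo_ric_mul_up hn hX, lieΓ_mul_nabv hn hX hg]
  simp only [lieΓ_mul_up_geodesic hn hX hg, ← hφ, sum_nabv_smul_up]
  have h1 : ∑ c, ∑ f, T.Γ c e f * ((φ * l c) * T.up l f)
      = φ * ∑ c, T.up l c * ∑ f, T.Γ f c e * l f := by
    simp only [Finset.mul_sum]
    rw [Finset.sum_comm]
    exact Finset.sum_congr rfl fun c _ => Finset.sum_congr rfl fun f _ => by
      rw [T.Γ_symm f e c]; ring
  have h2 : T.along (T.up l) (l e) = Mf * l e + ∑ c, T.up l c * ∑ f, T.Γ f c e * l f := by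
    rw [← sum_up_mul_nabl hg]
    simp only [nabl, along_apply, mul_sub, Finset.sum_sub_distrib, sub_add_cancel]
  rw [h1, Derivation.leibniz, h2]
  simp only [smul_eq_mul]
  ring

/-- By `lieRiem_mul` this is an antisymmetrised derivative of `φ l_b l^e`; contraction of the form
index with `l` leaves only `Dφ` and `M φ`. -/
theorem up_mul_lieRiem_mul_up (hn : ∑ a, l a * T.up l a = 0)
    (hX : ∀ a b, T.lieTwo X T.G a b = 2 * h * l a * l b)
    (hg : ∀ a, T.acc l a = Mf * T.up l a) (e b : Fin n) :
    ∑ m, T.up l m * ∑ s, T.lieRiem X e s b m * T.up l s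
      = -((T.along (T.up l) (T.along (T.up l) h + 2 * Mf * h)
          + Mf * (T.along (T.up l) h + 2 * Mf * h)) * l b * T.up l e) := by
  set φ := T.along (T.up l) h + 2 * Mf * h with hφ
  simp only [lieRiem_mul, lieΓ_mul_up_geodesic hn hX hg, ← hφ, nabv_smul]
  have hn' : ∑ a, T.up l a * l a = 0 := by rw [← hn]; simp only [mul_comm]
  have h1 : ∑ m, T.up l m * ∑ f, T.lieΓ X e m f * T.nabv (T.up l) b f = 0 := by
    simp only [Finset.mul_sum]
    rw [Finset.sum_comm]
    have : ∀ f m, T.up l m * (T.lieΓ X e m f * T.nabv (T.up l) b f)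
        = T.nabv (T.up l) b f * (T.lieΓ X e f m * T.up l m) := fun f m => by
      rw [T.lieΓ_symm X e m f]; ring
    simp only [this, ← Finset.mul_sum, lieΓ_mul_up_geodesic hn hX hg]
    have h' : ∀ f, T.nabv (T.up l) b f * ((T.along (T.up l) h + 2 * Mf * h) * l f * T.up l e)
        = (T.along (T.up l) h + 2 * Mf * h) * T.up l e * (l f * T.nabv (T.up l) b f) :=
      fun f => by ring
    simp only [h', ← Finset.mul_sum, T.mul_nabv_up hn, mul_zero]
  have h2 : ∑ m, T.up l m * ∑ f, T.lieΓ X e b f * T.nabv (T.up l) m f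
      = Mf * (φ * l b * T.up l e) := by
    simp only [Finset.mul_sum]
    rw [Finset.sum_comm, hφ, ← lieΓ_mul_up_geodesic hn hX hg]
    have : ∀ f m, T.up l m * (T.lieΓ X e b f * T.nabv (T.up l) m f)
        = T.lieΓ X e b f * (T.up l m * T.nabv (T.up l) m f) := fun f m => by ring
    simp only [this, ← Finset.mul_sum, sum_up_mul_nabv hg]
    rw [Finset.mul_sum]
    exact Finset.sum_congr rfl fun _ _ => by ring
  simp only [mul_add, mul_sub, Finset.sum_add_distrib, Finset.sum_sub_distrib, h1, h2]
  have h3 : ∀ m, T.up l m * (T.d b (φ * l m) * T.up l e)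
      = T.d b φ * T.up l e * (T.up l m * l m)
        + φ * T.up l e * (T.up l m * T.d b (l m)) := fun m => by
    simp only [Derivation.leibniz, smul_eq_mul]; ring
  have h4 : ∀ m, T.up l m * (T.d m (φ * l b) * T.up l e)
      = φ * T.up l e * (T.up l m * T.d m (l b))
        + l b * T.up l e * (T.up l m * T.d m φ) := fun m => by
    simp only [Derivation.leibniz, smul_eq_mul]; ring
  have h5 : ∀ m, T.up l m * (φ * l m * T.nabv (T.up l) b e)
      = φ * T.nabv (T.up l) b e * (T.up l m * l m) := fun m => by ring
  have h6 : ∀ m, T.up l m * (φ * l b * T.nabv (T.up l) m e)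
      = φ * l b * (T.up l m * T.nabv (T.up l) m e) := fun m => by ring
  simp only [h3, h4, h5, h6, Finset.sum_add_distrib, ← Finset.mul_sum, hn',
    sum_up_mul_nabv hg, sum_up_mul_d_sub hn hg, along_apply]
  ring

/-- The skew-symmetry of the curvature in its first pair, in the one case needed. Differentiating
`l_e ∇_c l^e = 0` along `b` shows that `l_e ∇_b ∇_c l^e` is symmetric in `b`, `c`, so it drops out
of the Ricci identity. -/
theorem mul_riem_mul_up (hn : ∑ a, l a * T.up l a = 0) (b c : Fin n) :
    ∑ e, l e * ∑ s, T.riem e s b c * T.up l s = 0 := by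
  have h1 : ∀ b c, ∑ e, l e * (T.d b (T.nabv (T.up l) c e)
      + ∑ f, T.Γ e b f * T.nabv (T.up l) c f)
      = - ∑ e, T.nabl l b e * T.nabv (T.up l) c e := by
    intro b c
    have := congrArg (T.d b) (T.mul_nabv_up hn c)
    rw [d_pairing, map_zero] at this
    exact eq_neg_of_add_eq_zero_right this
  have h2 : ∑ e, T.nabl l b e * T.nabv (T.up l) c e
      = ∑ e, T.nabl l c e * T.nabv (T.up l) b e := by
    simp only [nabv_up]
    rw [← sum_up_mul]
    exact Finset.sum_congr rfl fun _ _ => mul_comm _ _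
  simp only [riem_mul, mul_sub, Finset.sum_sub_distrib, h1, h2, sub_self]

/-- Lowering an index does not commute with `L_X`; the first term is the defect, which
`mul_riem_mul_up` kills after contraction with `l`. -/
theorem lieFour_riemLow (T : DiffMetric n R) (X : Fin n → R) (a s b m : Fin n) :
    T.lieFour X T.riemLow a s b m
      = ∑ e, T.lieTwo X T.G a e * T.riem e s b m + ∑ e, T.G a e * T.lieRiem X e s b m := by
  simp only [lieFour, riemLow, lieTwo, lieRiem, map_sum, Derivation.leibniz, smul_eq_mul,
    Finset.sum_add_distrib, Finset.sum_sub_distrib, Finset.mul_sum, Finset.sum_mul, mul_add,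
    mul_sub, add_mul]
  have h1 : ∑ x, ∑ e, X x * (T.G a e * T.d x (T.riem e s b m))
      = ∑ e, ∑ x, T.G a e * (X x * T.d x (T.riem e s b m)) := by
    rw [Finset.sum_comm]; simp only [mul_left_comm]
  have h2 : ∑ x, ∑ e, X x * (T.riem e s b m * T.d x (T.G a e))
      = ∑ e, ∑ x, X x * T.d x (T.G a e) * T.riem e s b m := by
    rw [Finset.sum_comm]
    exact Finset.sum_congr rfl fun _ _ => Finset.sum_congr rfl fun _ _ => by ring
  have h3 : ∑ x, ∑ e, T.G x e * T.riem e s b m * T.d a (X x)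
      = ∑ e, ∑ x, T.G x e * T.d a (X x) * T.riem e s b m := by
    rw [Finset.sum_comm]
    exact Finset.sum_congr rfl fun _ _ => Finset.sum_congr rfl fun _ _ => by ring
  have h4 : ∑ e, ∑ x, T.G a x * T.d e (X x) * T.riem e s b m
      = ∑ e, ∑ x, T.G a e * (T.d x (X e) * T.riem x s b m) := by
    rw [Finset.sum_comm]
    exact Finset.sum_congr rfl fun _ _ => Finset.sum_congr rfl fun _ _ => by ring
  have h5 : ∀ (F : Fin n → Fin n → R) (y : Fin n → R), ∑ x, ∑ e, T.G a e * F e x * y x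
      = ∑ e, ∑ x, T.G a e * (F e x * y x) := fun F y => by
    rw [Finset.sum_comm]; simp only [mul_assoc]
  rw [h1, h2, h3, h4, h5 (fun e x => T.riem e x b m), h5 (fun e x => T.riem e s x m),
    h5 (fun e x => T.riem e s b x)]
  ring

/-- The Lie derivative of the curvature contracted twice with a geodesic null vector. -/
theorem lieFour_mul_up_up (hn : ∑ a, l a * T.up l a = 0)
    (hX : ∀ a b, T.lieTwo X T.G a b = 2 * h * l a * l b)
    (hg : ∀ a, T.acc l a = Mf * T.up l a) (a b : Fin n) :
    ∑ s, ∑ m, T.lieFour X T.riemLow a s b m * T.up l s * T.up l m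
      = -((T.along (T.up l) (T.along (T.up l) h + 2 * Mf * h)
          + Mf * (T.along (T.up l) h + 2 * Mf * h)) * l a * l b) := by
  have h1 : ∑ s, ∑ m, T.lieFour X T.riemLow a s b m * T.up l s * T.up l m
      = 2 * h * l a * ∑ m, T.up l m * ∑ e, l e * ∑ s, T.riem e s b m * T.up l s
        + ∑ e, T.G a e * ∑ m, T.up l m * ∑ s, T.lieRiem X e s b m * T.up l s := by
    simp only [lieFour_riemLow, hX, add_mul, Finset.sum_add_distrib, Finset.mul_sum,
      Finset.sum_mul]
    congr 1
    · rw [Finset.sum_comm]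
      refine Finset.sum_congr rfl fun m _ => ?_
      rw [Finset.sum_comm]
      exact Finset.sum_congr rfl fun _ _ => Finset.sum_congr rfl fun _ _ => by ring
    · rw [Finset.sum_comm]
      conv_rhs => rw [Finset.sum_comm]
      refine Finset.sum_congr rfl fun m _ => ?_
      rw [Finset.sum_comm]
      exact Finset.sum_congr rfl fun _ _ => Finset.sum_congr rfl fun _ _ => by ring
  have h2 : l a = ∑ e, T.G a e * T.up l e := (congrFun (T.low_up l) a).symm
  rw [h1]
  simp only [mul_riem_mul_up hn, up_mul_lieRiem_mul_up hn hX hg, mul_zero, Finset.sum_const_zero,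
    zero_add]
  conv_rhs => rw [h2]
  simp only [Finset.mul_sum, Finset.sum_mul, ← Finset.sum_neg_distrib]
  exact Finset.sum_congr rfl fun _ _ => by ring

/-! #### Scalars -/

/-- Differentiating `g G = 1` gives `L_X g⁻¹ = -g⁻¹ (L_X g) g⁻¹`, which raises both indices of `2 h
l ⊗ l`. -/
theorem along_g (hX : ∀ a b, T.lieTwo X T.G a b = 2 * h * l a * l b) (a b : Fin n) :
    ∑ e, X e * T.d e (T.g a b) = ∑ e, T.d e (X a) * T.g e b + ∑ e, T.g a e * T.d e (X b)
      - 2 * h * T.up l a * T.up l b := by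
  have hH : T.dmAlong X (Matrix.of T.G) = Matrix.of (fun a b => 2 * h * l a * l b)
      - (T.jac X).transpose * Matrix.of T.G - Matrix.of T.G * T.jac X := by
    ext a b
    simp only [← hX, dmAlong, jac, lieTwo, Matrix.sub_apply, Matrix.mul_apply, Matrix.sum_apply,
      Matrix.smul_apply, dm_apply, smul_eq_mul, Matrix.of_apply, Matrix.transpose_apply,
      Finset.sum_add_distrib, fun e => mul_comm (T.G e b)]
    ring
  have h1 : T.dmAlong X (Matrix.of T.g) * Matrix.of T.G
      = - (Matrix.of T.g * T.dmAlong X (Matrix.of T.G)) := by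
    have h0 : T.dmAlong X (1 : Matrix (Fin n) (Fin n) R) = 0 := by
      have : ∀ e, T.dm e (1 : Matrix (Fin n) (Fin n) R) = 0 := fun e => by
        ext i j
        by_cases hij : i = j <;> simp [dm_apply, hij]
      simp [dmAlong, this]
    rw [← T.mat_g_mul_G, dmAlong_mul] at h0
    exact eq_neg_of_add_eq_zero_left h0
  have h2 : T.dmAlong X (Matrix.of T.g) = T.jac X * Matrix.of T.g
      + Matrix.of T.g * (T.jac X).transpose
      - Matrix.of T.g * Matrix.of (fun a b => 2 * h * l a * l b) * Matrix.of T.g := by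
    calc T.dmAlong X (Matrix.of T.g)
        = T.dmAlong X (Matrix.of T.g) * Matrix.of T.G * Matrix.of T.g := by
          rw [mul_assoc, T.mat_G_mul_g, mul_one]
      _ = (Matrix.of T.g * Matrix.of T.G) * T.jac X * Matrix.of T.g
          + Matrix.of T.g * (T.jac X).transpose * (Matrix.of T.G * Matrix.of T.g)
          - Matrix.of T.g * Matrix.of (fun a b => 2 * h * l a * l b) * Matrix.of T.g := by
          rw [h1, hH]; noncomm_ring
      _ = _ := by rw [T.mat_g_mul_G, T.mat_G_mul_g, one_mul, mul_one]
  have h3 := congrFun (congrFun h2 a) b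
  simp only [dmAlong, jac, Matrix.sub_apply, Matrix.add_apply, Matrix.mul_apply, Matrix.sum_apply,
      Matrix.smul_apply, dm_apply, smul_eq_mul, Matrix.of_apply, Matrix.transpose_apply] at h3
  rw [h3]
  congr 1
  simp only [up, Finset.mul_sum, Finset.sum_mul]
  exact Finset.sum_congr rfl fun _ _ => Finset.sum_congr rfl fun _ _ => by rw [T.g_symm _ b]; ring

theorem along_sum_g (hX : ∀ a b, T.lieTwo X T.G a b = 2 * h * l a * l b)
    (S : Fin n → Fin n → R) :
    T.along X (∑ a, ∑ b, T.g a b * S a b)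
      = ∑ a, ∑ b, T.g a b * T.lieTwo X S a b - 2 * h * ∑ a, ∑ b, S a b * T.up l a * T.up l b := by
  have h1 : T.along X (∑ a, ∑ b, T.g a b * S a b)
      = ∑ a, ∑ b, (T.g a b * ∑ e, X e * T.d e (S a b)
        + S a b * ∑ e, X e * T.d e (T.g a b)) := by
    simp only [map_sum, Derivation.leibniz, smul_eq_mul, along_apply]
  rw [h1]
  simp only [along_g hX, lieTwo, mul_sub, mul_add, Finset.sum_add_distrib,
    Finset.sum_sub_distrib, Finset.mul_sum]
  have h2 : ∑ a, ∑ b, ∑ e, S a b * (T.d e (X a) * T.g e b)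
      = ∑ a, ∑ b, ∑ e, T.g a b * (S e b * T.d a (X e)) := by
    conv_rhs => rw [Finset.sum_comm]
    rw [Finset.sum_comm]
    refine Finset.sum_congr rfl fun b _ => ?_
    rw [Finset.sum_comm]
    exact Finset.sum_congr rfl fun _ _ => Finset.sum_congr rfl fun _ _ => by ring
  have h3 : ∑ a, ∑ b, ∑ e, S a b * (T.g a e * T.d e (X b))
      = ∑ a, ∑ b, ∑ e, T.g a b * (S a e * T.d b (X e)) := by
    refine Finset.sum_congr rfl fun a _ => ?_
    rw [Finset.sum_comm]
    exact Finset.sum_congr rfl fun _ _ => Finset.sum_congr rfl fun _ _ => by ring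
  rw [h2, h3]
  have h4 : ∀ a b, S a b * (2 * h * T.up l a * T.up l b)
      = 2 * h * (S a b * T.up l a * T.up l b) := fun a b => by ring
  simp only [h4]
  ring

end Geodesic

end DiffMetric

end

end KerrSchild

/-! ### Scalar curvature, and Lie derivatives of the divergence and the inaffinity. -/

namespace KerrSchild

noncomputable section

namespace DiffMetric

variable {n : ℕ} {R : Type*} [CommRing R] [Algebra ℝ R]

theorem d_g (T : DiffMetric n R) (a b c : Fin n) :
    T.d c (T.g a b) = - ∑ e, T.Γ a c e * T.g e b - ∑ e, T.g a e * T.Γ b c e := by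
  have hG : T.dm c (Matrix.of T.G)
      = (T.Γm c).transpose * Matrix.of T.G + Matrix.of T.G * T.Γm c := by
    ext a b
    simp only [Γm, dm_apply, Matrix.add_apply, Matrix.mul_apply, Matrix.of_apply,
      Matrix.transpose_apply, T.d_G]
  have h1 : T.dm c (Matrix.of T.g) * Matrix.of T.G
      = - (Matrix.of T.g * T.dm c (Matrix.of T.G)) := by
    have h0 : T.dm c (1 : Matrix (Fin n) (Fin n) R) = 0 := by
      ext i j
      by_cases hij : i = j <;> simp [dm_apply, hij]
    rw [← T.mat_g_mul_G, dm_mul] at h0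
    exact eq_neg_of_add_eq_zero_left h0
  have h2 : T.dm c (Matrix.of T.g) = - (T.Γm c * Matrix.of T.g)
      - Matrix.of T.g * (T.Γm c).transpose := by
    calc T.dm c (Matrix.of T.g)
        = T.dm c (Matrix.of T.g) * Matrix.of T.G * Matrix.of T.g := by
          rw [mul_assoc, T.mat_G_mul_g, mul_one]
      _ = - ((Matrix.of T.g * Matrix.of T.G) * T.Γm c * Matrix.of T.g)
          - Matrix.of T.g * (T.Γm c).transpose * (Matrix.of T.G * Matrix.of T.g) := by
          rw [h1, hG]; noncomm_ring
      _ = _ := by rw [T.mat_g_mul_G, T.mat_G_mul_g, one_mul, mul_one]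
  have h3 := congrFun (congrFun h2 a) b
  simpa only [Γm, Matrix.sub_apply, Matrix.neg_apply, Matrix.mul_apply, dm_apply, Matrix.of_apply,
    Matrix.transpose_apply] using h3

section Scalars

variable {T : DiffMetric n R} {l : Fin n → R} {Mf : R} {X : Fin n → R} {h m : R}

/-- Since `L_X Γ` is trace-free, `L_X Ric` is its divergence in the upper index, and the inverse
metric passes through the covariant derivative by `d_g`. -/
theorem g_mul_lieTwo_ric (hn : ∑ a, l a * T.up l a = 0)
    (hX : ∀ a b, T.lieTwo X T.G a b = 2 * h * l a * l b) :
    ∑ a, ∑ b, T.g a b * T.lieTwo X T.ric a b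
      = ∑ c, T.nabv (fun c => ∑ a, ∑ b, T.g a b * T.lieΓ X c a b) c c := by
  have h1 : ∀ a b, T.lieTwo X T.ric a b = ∑ c, T.d c (T.lieΓ X c a b)
      + ∑ c, ∑ f, T.Γ c c f * T.lieΓ X f a b
      - ∑ c, ∑ f, T.lieΓ X c b f * T.Γ f c a - ∑ c, ∑ f, T.Γ c b f * T.lieΓ X f c a := by
    intro a b
    have h2 : ∑ c, ∑ f, T.lieΓ X c c f * T.Γ f b a = 0 := by
      rw [Finset.sum_comm]
      simp only [← Finset.sum_mul, lieΓ_trace hn hX, zero_mul, Finset.sum_const_zero]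
    simp only [lieTwo_ric, lieRiem_eq, Finset.sum_add_distrib, Finset.sum_sub_distrib, h2,
      ← map_sum, lieΓ_trace hn hX, map_zero, fun c => T.lieΓ_symm X c b a]
    ring
  have h3 : ∑ a, ∑ b, T.g a b * ∑ c, ∑ f, T.lieΓ X c b f * T.Γ f c a
      = ∑ c, ∑ a, ∑ b, (∑ e, T.Γ a c e * T.g e b) * T.lieΓ X c a b := by
    simp only [Finset.mul_sum, Finset.sum_mul]
    calc _ = ∑ a, ∑ c, ∑ b, ∑ f, T.g a b * (T.lieΓ X c b f * T.Γ f c a) :=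
          Finset.sum_congr rfl fun a _ => Finset.sum_comm
      _ = ∑ c, ∑ a, ∑ b, ∑ f, T.g a b * (T.lieΓ X c b f * T.Γ f c a) := Finset.sum_comm
      _ = ∑ c, ∑ a, ∑ f, ∑ b, T.g a b * (T.lieΓ X c b f * T.Γ f c a) :=
          Finset.sum_congr rfl fun c _ => Finset.sum_congr rfl fun a _ => Finset.sum_comm
      _ = ∑ c, ∑ f, ∑ a, ∑ b, T.g a b * (T.lieΓ X c b f * T.Γ f c a) :=
          Finset.sum_congr rfl fun c _ => Finset.sum_comm
      _ = _ := Finset.sum_congr rfl fun c _ => Finset.sum_congr rfl fun f _ => by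
          rw [Finset.sum_comm]
          exact Finset.sum_congr rfl fun b _ => Finset.sum_congr rfl fun a _ => by
            rw [T.lieΓ_symm X c b f]; ring
  have h4 : ∑ a, ∑ b, T.g a b * ∑ c, ∑ f, T.Γ c b f * T.lieΓ X f c a
      = ∑ c, ∑ a, ∑ b, (∑ e, T.g a e * T.Γ b c e) * T.lieΓ X c a b := by
    simp only [Finset.mul_sum, Finset.sum_mul]
    calc _ = ∑ a, ∑ b, ∑ f, ∑ c, T.g a b * (T.Γ c b f * T.lieΓ X f c a) :=
          Finset.sum_congr rfl fun a _ => Finset.sum_congr rfl fun b _ => Finset.sum_comm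
      _ = ∑ a, ∑ f, ∑ b, ∑ c, T.g a b * (T.Γ c b f * T.lieΓ X f c a) :=
          Finset.sum_congr rfl fun a _ => Finset.sum_comm
      _ = ∑ f, ∑ a, ∑ b, ∑ c, T.g a b * (T.Γ c b f * T.lieΓ X f c a) := Finset.sum_comm
      _ = _ := Finset.sum_congr rfl fun f _ => Finset.sum_congr rfl fun a _ => by
          rw [Finset.sum_comm]
          exact Finset.sum_congr rfl fun c _ => Finset.sum_congr rfl fun b _ => by
            rw [T.lieΓ_symm X f c a, T.Γ_symm c b f]; ring
  have h5 : ∑ a, ∑ b, T.g a b * ∑ c, ∑ f, T.Γ c c f * T.lieΓ X f a b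
      = ∑ c, ∑ f, T.Γ c c f * ∑ a, ∑ b, T.g a b * T.lieΓ X f a b := by
    simp only [Finset.mul_sum]
    calc _ = ∑ a, ∑ c, ∑ b, ∑ f, T.g a b * (T.Γ c c f * T.lieΓ X f a b) :=
          Finset.sum_congr rfl fun a _ => Finset.sum_comm
      _ = ∑ c, ∑ a, ∑ b, ∑ f, T.g a b * (T.Γ c c f * T.lieΓ X f a b) := Finset.sum_comm
      _ = ∑ c, ∑ a, ∑ f, ∑ b, T.g a b * (T.Γ c c f * T.lieΓ X f a b) :=
          Finset.sum_congr rfl fun c _ => Finset.sum_congr rfl fun a _ => Finset.sum_comm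
      _ = ∑ c, ∑ f, ∑ a, ∑ b, T.g a b * (T.Γ c c f * T.lieΓ X f a b) :=
          Finset.sum_congr rfl fun c _ => Finset.sum_comm
      _ = _ := by simp only [mul_left_comm]
  have h6 : ∑ c, T.d c (∑ a, ∑ b, T.g a b * T.lieΓ X c a b)
      = ∑ a, ∑ b, T.g a b * ∑ c, T.d c (T.lieΓ X c a b)
        - ∑ c, ∑ a, ∑ b, (∑ e, T.Γ a c e * T.g e b) * T.lieΓ X c a b
        - ∑ c, ∑ a, ∑ b, (∑ e, T.g a e * T.Γ b c e) * T.lieΓ X c a b := by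
    have : ∑ a, ∑ b, T.g a b * ∑ c, T.d c (T.lieΓ X c a b)
        = ∑ c, ∑ a, ∑ b, T.g a b * T.d c (T.lieΓ X c a b) := by
      simp only [Finset.mul_sum]
      rw [Finset.sum_comm (s := Finset.univ (α := Fin n)) (f := fun c a => ∑ b, T.g a b * _)]
      exact Finset.sum_congr rfl fun a _ => Finset.sum_comm
    rw [this]
    simp only [map_sum, Derivation.leibniz, smul_eq_mul, d_g, ← Finset.sum_sub_distrib]
    exact Finset.sum_congr rfl fun c _ => Finset.sum_congr rfl fun a _ =>
      Finset.sum_congr rfl fun b _ => by ring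
  simp only [nabv, h1, mul_add, mul_sub, Finset.sum_add_distrib, Finset.sum_sub_distrib]
  rw [h3, h4, h5, h6]
  ring

/-- The Lie derivative of the scalar curvature. -/
theorem along_scal (hn : ∑ a, l a * T.up l a = 0)
    (hX : ∀ a b, T.lieTwo X T.G a b = 2 * h * l a * l b)
    (hg : ∀ a, T.acc l a = Mf * T.up l a) :
    T.along X T.scal = 2 * (T.along (T.up l) (T.along (T.up l) h + h * T.dvg l + h * Mf)
        + (T.along (T.up l) h + h * T.dvg l + h * Mf) * T.dvg l) - 2 * h * T.ricBar l := by
  have h1 : (fun a => ∑ b, ∑ c, T.g b c * T.lieΓ X a b c)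
      = fun a => (2 * (T.along (T.up l) h + h * T.dvg l + h * Mf)) * T.up l a :=
    funext fun a => by rw [g_mul_lieΓ hn hX, hg]; ring
  rw [scal, along_sum_g hX, g_mul_lieTwo_ric hn hX, h1, sum_nabv_smul_up, ricBar,
    Derivation.leibniz, show T.along (T.up l) (2 : R) = 0 from
      (T.along (T.up l)).map_natCast 2]
  simp only [smul_eq_mul]
  ring

/-- The algebraic relation between the gauge and the Lie derivative of the curvature. -/
theorem delta_mul (hn : ∑ a, l a * T.up l a = 0)
    (hX : ∀ a b, T.lieTwo X T.G a b = 2 * h * l a * l b)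
    (hg : ∀ a, T.acc l a = Mf * T.up l a) (a b : Fin n) :
    2 * T.delta l Mf * (h * l a * l b)
      = T.along X T.scal * l a * l b
        - 2 * ∑ c, (T.lieTwo X T.ric c a * l b + T.lieTwo X T.ric c b * l a) * T.up l c
        - 2 * ∑ c, ∑ d, T.lieFour X T.riemLow a c b d * T.up l c * T.up l d := by
  have h1 : ∑ c, (T.lieTwo X T.ric c a * l b + T.lieTwo X T.ric c b * l a) * T.up l c
      = (∑ c, T.lieTwo X T.ric c a * T.up l c) * l b
        + (∑ c, T.lieTwo X T.ric c b * T.up l c) * l a := by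
    simp only [Finset.sum_mul, ← Finset.sum_add_distrib]
    exact Finset.sum_congr rfl fun _ _ => by ring
  have h2 : T.along (T.up l) (2 : R) = 0 := (T.along (T.up l)).map_natCast 2
  -- The three contractions contribute `2`, `-4` and `2` times `DDh`; the terms in `Dh` cancel as
  -- well, and the Raychaudhuri equation removes `trSq`.
  rw [h1, lieFour_mul_up_up hn hX hg, lieTwo_ric_mul_up_geodesic hn hX hg,
    lieTwo_ric_mul_up_geodesic hn hX hg, along_scal hn hX hg, delta_eq hn, ricBar_geodesic hg]
  simp only [map_add, Derivation.leibniz, smul_eq_mul, h2]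
  ring

/-- The Lie derivative of the covariant derivative of a covector field. -/
theorem lieTwo_nabl (hl : ∀ a, T.lieOne X l a = m * l a) (a b : Fin n) :
    T.lieTwo X (T.nabl l) a b
      = T.d a m * l b + m * T.nabl l a b - ∑ e, T.lieΓ X e a b * l e := by
  have h1 := congrArg (T.d a) (hl b)
  have h2 : ∑ e, T.Γ e a b * (∑ c, (X c * T.d c (l e) + l c * T.d e (X c)))
      = m * ∑ e, T.Γ e a b * l e := by
    have h3 : ∀ e, ∑ c, (X c * T.d c (l e) + l c * T.d e (X c)) = m * l e := hl
    simp only [h3, Finset.mul_sum, mul_left_comm]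
  simp only [lieOne, map_add, map_sum, Derivation.leibniz, smul_eq_mul,
    Finset.sum_add_distrib] at h1
  simp only [lieTwo, nabl, lieΓ, map_sub, map_sum, Derivation.leibniz, smul_eq_mul,
    Finset.sum_add_distrib, Finset.sum_sub_distrib, mul_add, mul_sub, add_mul, sub_mul,
    Finset.mul_sum, Finset.sum_mul] at h2 ⊢
  rw [Finset.sum_comm (f := fun e c => T.Γ e a b * (X c * T.d c (l e)))] at h2
  have e1 : ∑ x, ∑ i, X x * (T.Γ i a b * T.d x (l i)) = ∑ x, ∑ i, T.Γ i a b * (X x * T.d x (l i)) :=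
    Finset.sum_congr rfl fun _ _ => Finset.sum_congr rfl fun _ _ => by ring
  have e2 : ∑ x, ∑ i, X x * (l i * T.d x (T.Γ i a b)) = ∑ x, ∑ i, X i * T.d i (T.Γ x a b) * l x := by
    rw [Finset.sum_comm]
    exact Finset.sum_congr rfl fun _ _ => Finset.sum_congr rfl fun _ _ => by ring
  have e3 : ∑ x, ∑ i, T.Γ i x b * l i * T.d a (X x) = ∑ x, ∑ i, T.Γ x i b * T.d a (X i) * l x := by
    rw [Finset.sum_comm]
    exact Finset.sum_congr rfl fun _ _ => Finset.sum_congr rfl fun _ _ => by ring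
  have e4 : ∑ x, ∑ i, T.Γ i a x * l i * T.d b (X x) = ∑ x, ∑ i, T.Γ x a i * T.d b (X i) * l x := by
    rw [Finset.sum_comm]
    exact Finset.sum_congr rfl fun _ _ => Finset.sum_congr rfl fun _ _ => by ring
  have e5 : ∑ x, ∑ i, T.d i (X x) * T.Γ i a b * l x = ∑ x, ∑ i, T.Γ x a b * (l i * T.d x (X i)) := by
    rw [Finset.sum_comm]
    exact Finset.sum_congr rfl fun _ _ => Finset.sum_congr rfl fun _ _ => by ring
  simp only [fun x => T.d_comm x a (l b), fun x => mul_comm (T.d x (l b)) (T.d a (X x)),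
    fun x => mul_comm (T.d a (l x)) (T.d b (X x)), fun x => mul_comm (T.d a (T.d b (X x))) (l x)]
    at h1 ⊢
  rw [e1, e2, e3, e4, e5]
  linear_combination h1 - h2

theorem lieTwo_nabl_geodesic (hn : ∑ a, l a * T.up l a = 0)
    (hX : ∀ a b, T.lieTwo X T.G a b = 2 * h * l a * l b)
    (hg : ∀ a, T.acc l a = Mf * T.up l a) (hl : ∀ a, T.lieOne X l a = m * l a) (a b : Fin n) :
    T.lieTwo X (T.nabl l) a b
      = T.d a m * l b + m * T.nabl l a b + (T.along (T.up l) h + 2 * Mf * h) * l a * l b := by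
  rw [lieTwo_nabl hl, lieΓ_mul hn hX, accLow_geodesic hg, accLow_geodesic hg]; ring

/-- The Lie derivative of the divergence of a geodesic null vector field. -/
theorem along_dvg (hn : ∑ a, l a * T.up l a = 0)
    (hX : ∀ a b, T.lieTwo X T.G a b = 2 * h * l a * l b)
    (hg : ∀ a, T.acc l a = Mf * T.up l a) (hl : ∀ a, T.lieOne X l a = m * l a) :
    T.along X (T.dvg l) = T.along (T.up l) m + m * T.dvg l := by
  have h1 : ∑ a, ∑ b, T.nabl l a b * T.up l a * T.up l b = 0 := by
    have : ∀ a b, T.nabl l a b * T.up l a * T.up l b = T.up l a * (T.nabl l a b * T.up l b) :=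
      fun a b => by ring
    simp only [this, ← Finset.mul_sum, T.nabl_mul_up hn, mul_zero, Finset.sum_const_zero]
  rw [← sum_g_nabl, along_sum_g hX, h1, sum_g_nabl]
  have h2 : ∀ a b, T.g a b * T.lieTwo X (T.nabl l) a b
      = T.g b a * (l b * T.d a m) + m * (T.g a b * T.nabl l a b)
        + (T.along (T.up l) h + 2 * Mf * h) * (T.g a b * (l a * l b)) := fun a b => by
    rw [lieTwo_nabl_geodesic hn hX hg hl, T.g_symm a b]; ring
  have hn' : ∑ a, T.up l a * l a = 0 := by rw [← hn]; simp only [mul_comm]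
  simp only [h2, Finset.sum_add_distrib, ← Finset.mul_sum, sum_up_g, sum_g_nabl, hn']
  rw [Finset.sum_comm, sum_up_g, T.along_apply (T.up l) m]
  ring

/-- The Lie derivative of the dual vector field. -/
theorem along_up (hn : ∑ a, l a * T.up l a = 0)
    (hX : ∀ a b, T.lieTwo X T.G a b = 2 * h * l a * l b)
    (hl : ∀ a, T.lieOne X l a = m * l a) (a : Fin n) :
    T.along X (T.up l a) = ∑ c, T.up l c * T.d c (X a) + m * T.up l a := by
  have h1 : ∀ b, ∑ e, X e * T.d e (l b) = m * l b - ∑ c, l c * T.d b (X c) := fun b => by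
    have := hl b
    rw [lieOne, Finset.sum_add_distrib] at this
    rw [← this]; ring
  have h2 : T.along X (T.up l a) = ∑ b, (T.g a b * ∑ e, X e * T.d e (l b)
      + l b * ∑ e, X e * T.d e (T.g a b)) := by
    simp only [up, map_sum, Derivation.leibniz, smul_eq_mul, along_apply]
  have h3 : ∑ b, l b * ∑ e, T.d e (X a) * T.g e b = ∑ c, T.up l c * T.d c (X a) := by
    simp only [up, Finset.mul_sum, Finset.sum_mul]
    rw [Finset.sum_comm]
    exact Finset.sum_congr rfl fun _ _ => Finset.sum_congr rfl fun _ _ => by ring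
  have h4 : ∑ b, l b * ∑ e, T.g a e * T.d e (X b) = ∑ b, T.g a b * ∑ c, l c * T.d b (X c) := by
    simp only [Finset.mul_sum]
    rw [Finset.sum_comm]
    exact Finset.sum_congr rfl fun _ _ => Finset.sum_congr rfl fun _ _ => by ring
  have h5 : ∑ b, l b * (2 * h * T.up l a * T.up l b) = 0 := by
    have : ∀ b, l b * (2 * h * T.up l a * T.up l b) = 2 * h * T.up l a * (l b * T.up l b) :=
      fun b => by ring
    simp only [this, ← Finset.mul_sum, hn, mul_zero]
  have h6 : ∑ b, T.g a b * (m * l b) = m * T.up l a := by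
    simp only [up, Finset.mul_sum, mul_left_comm]
  rw [h2]
  simp only [h1, along_g hX, mul_add, mul_sub, Finset.sum_add_distrib, Finset.sum_sub_distrib]
  rw [h3, h4, h5, h6]
  ring

/-- The Lie derivative of the inaffinity of a geodesic null vector field. -/
theorem along_inaffinity (hn : ∑ a, l a * T.up l a = 0)
    (hX : ∀ a b, T.lieTwo X T.G a b = 2 * h * l a * l b)
    (hg : ∀ a, T.acc l a = Mf * T.up l a) (hl : ∀ a, T.lieOne X l a = m * l a) (b : Fin n) :
    T.along X Mf * l b = (T.along (T.up l) m + m * Mf) * l b := by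
  have h1 := congrArg (T.along X) (sum_up_mul_nabl hg b)
  have h2 : T.along X (l b) = m * l b - ∑ c, l c * T.d b (X c) := by
    have := hl b
    rw [lieOne, Finset.sum_add_distrib] at this
    rw [← this, along_apply]; ring
  -- The contraction `l^a (L_X ∇l)_{ab}` is evaluated twice: by the formula for `L_X ∇l`, and by
  -- expanding the Lie derivative and using the derivative along `X` of `l^a ∇_a l_b = M l_b`.
  have h3 : ∑ a, T.up l a * T.lieTwo X (T.nabl l) a b
      = T.along (T.up l) m * l b + m * (Mf * l b) := by
    have : ∀ a, T.up l a * T.lieTwo X (T.nabl l) a b = l b * (T.up l a * T.d a m)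
        + m * (T.up l a * T.nabl l a b)
        + (T.along (T.up l) h + 2 * Mf * h) * l b * (l a * T.up l a) := fun a => by
      rw [lieTwo_nabl_geodesic hn hX hg hl]; ring
    simp only [this, Finset.sum_add_distrib, ← Finset.mul_sum, hn, sum_up_mul_nabl hg, along_apply]
    ring
  have h4 : ∑ a, T.up l a * T.lieTwo X (T.nabl l) a b
      = ∑ a, T.up l a * T.along X (T.nabl l a b)
        + ∑ c, T.nabl l c b * ∑ a, T.up l a * T.d a (X c)
        + Mf * ∑ c, l c * T.d b (X c) := by
    have h5 : ∑ c, (∑ a, T.up l a * T.nabl l a c) * T.d b (X c) = Mf * ∑ c, l c * T.d b (X c) := by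
      simp only [sum_up_mul_nabl hg, Finset.mul_sum, mul_assoc]
    rw [← h5]
    simp only [lieTwo, along_apply, Finset.sum_add_distrib, mul_add, Finset.mul_sum, Finset.sum_mul]
    congr 1
    · congr 1
      rw [Finset.sum_comm]
      exact Finset.sum_congr rfl fun _ _ => Finset.sum_congr rfl fun _ _ => by ring
    · rw [Finset.sum_comm]
      exact Finset.sum_congr rfl fun _ _ => Finset.sum_congr rfl fun _ _ => by ring
  simp only [map_sum, Derivation.leibniz, smul_eq_mul, along_up hn hX hl, h2,
    Finset.sum_add_distrib, mul_add] at h1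
  have h5 : ∑ c, T.nabl l c b * (m * T.up l c) = m * (Mf * l b) := by
    rw [← sum_up_mul_nabl hg, Finset.mul_sum]
    exact Finset.sum_congr rfl fun _ _ => by ring
  rw [h5] at h1
  linear_combination (-1 : R) * h1 - h4 + h3

end Scalars

end DiffMetric

end

end KerrSchild

namespace KerrSchild

noncomputable section

namespace DiffMetric

variable {n : ℕ} {R : Type*} [CommRing R] [Algebra ℝ R]

/-! ### Linear combinations of the unknowns -/

/-- The unknowns `ξ_a`, `ξ_{[ab]}`. -/
def unk (T : DiffMetric n R) (X : Fin n → R) : Fin n ⊕ Fin n × Fin n → R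
  | Sum.inl a => T.low X a
  | Sum.inr (a, b) => (1 / 2 : ℝ) • (T.nabl (T.low X) a b - T.nabl (T.low X) b a)

/-- The linear combinations of the unknowns whose coefficients belong to a subalgebra. -/
def lin (T : DiffMetric n R) (S : Subalgebra ℝ R) (X : Fin n → R) : Submodule S R :=
  Submodule.span S (Set.range (T.unk X))

/-- A subalgebra stable under the derivations, containing the metric and a null covector field `l`
which does not vanish. -/
structure IsDataAlg (T : DiffMetric n R) (S : Subalgebra ℝ R) (l : Fin n → R) : Prop where
  d_mem : ∀ i f, f ∈ S → T.d i f ∈ S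
  G_mem : ∀ a b, T.G a b ∈ S
  g_mem : ∀ a b, T.g a b ∈ S
  l_mem : ∀ a, l a ∈ S
  exists_dual : ∃ σ : Fin n → R, (∀ a, σ a ∈ S) ∧ ∑ a, σ a * l a = 1
  null : ∑ a, l a * T.up l a = 0

variable {T : DiffMetric n R} {S : Subalgebra ℝ R} {l : Fin n → R} {X : Fin n → R} {h m Mf : R}

theorem mul_mem_submodule {N : Submodule S R} {c x : R} (hc : c ∈ S) (hx : x ∈ N) : c * x ∈ N :=
  N.smul_mem (⟨c, hc⟩ : S) hx

theorem mul_mem_submodule' {N : Submodule S R} {c x : R} (hc : c ∈ S) (hx : x ∈ N) : x * c ∈ N := by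
  rw [mul_comm]; exact mul_mem_submodule hc hx

theorem mem_of_two_mul_mem {N : Submodule S R} {x : R} (hx : 2 * x ∈ N) : x ∈ N := by
  have h1 : x = (algebraMap ℝ R (1 / 2)) * (2 * x) := by
    rw [← Algebra.smul_def, ← mul_smul_comm, two_smul_half]
  rw [h1]
  exact mul_mem_submodule (S.algebraMap_mem _) hx

theorem low_mem (a : Fin n) : T.low X a ∈ T.lin S X := Submodule.subset_span ⟨Sum.inl a, rfl⟩

theorem two_mul_unk (T : DiffMetric n R) (X : Fin n → R) (a b : Fin n) :
    2 * T.unk X (Sum.inr (a, b)) = T.d a (T.low X b) - T.d b (T.low X a) := by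
  rw [unk, two_smul_half, nabl_sub_nabl]

/-- The linear combinations of the unknowns and the gauge. -/
def linH (T : DiffMetric n R) (S : Subalgebra ℝ R) (X : Fin n → R) (h : R) : Submodule S R :=
  T.lin S X ⊔ Submodule.span S {h}

theorem lin_le_linH : T.lin S X ≤ T.linH S X h := le_sup_left

theorem linH_le_lin (hh : h ∈ T.lin S X) : T.linH S X h ≤ T.lin S X :=
  sup_le le_rfl ((Submodule.span_singleton_le_iff_mem _ _).2 hh)

theorem gauge_mem_linH : h ∈ T.linH S X h :=
  le_sup_right (a := T.lin S X) (Submodule.mem_span_singleton_self h)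

theorem mem_linH_iff {x : R} : x ∈ T.linH S X h ↔ ∃ q ∈ S, x - q * h ∈ T.lin S X := by
  constructor
  · intro hx
    obtain ⟨y, hy, z, hz, rfl⟩ := Submodule.mem_sup.1 hx
    obtain ⟨q, rfl⟩ := Submodule.mem_span_singleton.1 hz
    exact ⟨q, q.2, by simpa [Subalgebra.smul_def] using hy⟩
  · rintro ⟨q, hq, hx⟩
    have := add_mem (lin_le_linH (h := h) hx) (mul_mem_submodule hq gauge_mem_linH)
    simpa using this

namespace IsDataAlg

variable (H : T.IsDataAlg S l)
include H

theorem up_mem {k : Fin n → R} (hk : ∀ a, k a ∈ S) (a : Fin n) : T.up k a ∈ S :=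
  S.sum_mem fun _ _ => S.mul_mem (H.g_mem _ _) (hk _)

theorem Γ_mem (a b c : Fin n) : T.Γ a b c ∈ S :=
  S.smul_mem (S.sum_mem fun _ _ => S.mul_mem (H.g_mem _ _) (S.sub_mem (S.add_mem
    (H.d_mem _ _ (H.G_mem _ _)) (H.d_mem _ _ (H.G_mem _ _))) (H.d_mem _ _ (H.G_mem _ _)))) _

theorem nabl_mem {k : Fin n → R} (hk : ∀ a, k a ∈ S) (a b : Fin n) : T.nabl k a b ∈ S :=
  S.sub_mem (H.d_mem _ _ (hk _)) (S.sum_mem fun _ _ => S.mul_mem (H.Γ_mem _ _ _) (hk _))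

theorem nabv_mem {k : Fin n → R} (hk : ∀ a, k a ∈ S) (a b : Fin n) : T.nabv k a b ∈ S :=
  S.add_mem (H.d_mem _ _ (hk _)) (S.sum_mem fun _ _ => S.mul_mem (H.Γ_mem _ _ _) (hk _))

theorem v_mem (a : Fin n) : T.up l a ∈ S := H.up_mem H.l_mem a

theorem along_mem {f : R} (hf : f ∈ S) : T.along (T.up l) f ∈ S := by
  rw [along_apply]
  exact S.sum_mem fun _ _ => S.mul_mem (H.v_mem _) (H.d_mem _ _ hf)

theorem riem_mem (a b c e : Fin n) : T.riem a b c e ∈ S :=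
  S.add_mem (S.sub_mem (H.d_mem _ _ (H.Γ_mem _ _ _)) (H.d_mem _ _ (H.Γ_mem _ _ _)))
    (S.sum_mem fun _ _ => S.sub_mem (S.mul_mem (H.Γ_mem _ _ _) (H.Γ_mem _ _ _))
      (S.mul_mem (H.Γ_mem _ _ _) (H.Γ_mem _ _ _)))

theorem riemLow_mem (a b c e : Fin n) : T.riemLow a b c e ∈ S :=
  S.sum_mem fun _ _ => S.mul_mem (H.G_mem _ _) (H.riem_mem _ _ _ _)

theorem ric_mem (a b : Fin n) : T.ric a b ∈ S := S.sum_mem fun _ _ => H.riem_mem _ _ _ _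

theorem scal_mem : T.scal ∈ S :=
  S.sum_mem fun _ _ => S.sum_mem fun _ _ => S.mul_mem (H.g_mem _ _) (H.ric_mem _ _)

theorem ricBar_mem : T.ricBar l ∈ S :=
  S.sum_mem fun _ _ => S.sum_mem fun _ _ =>
    S.mul_mem (S.mul_mem (H.ric_mem _ _) (H.v_mem _)) (H.v_mem _)

theorem dvg_mem : T.dvg l ∈ S := S.sum_mem fun _ _ => H.nabv_mem H.v_mem _ _

theorem normSq_mem : T.normSq l ∈ S :=
  S.sum_mem fun _ _ => S.sum_mem fun _ _ =>
    S.mul_mem (H.up_mem (fun _ => H.nabl_mem H.l_mem _ _) _) (H.nabv_mem H.v_mem _ _)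

theorem accSq_mem : T.accSq l ∈ S := by
  have : ∀ a, T.acc l a ∈ S := fun a =>
    S.sum_mem fun _ _ => S.mul_mem (H.v_mem _) (H.nabv_mem H.v_mem _ _)
  exact S.sum_mem fun _ _ => S.sum_mem fun _ _ =>
    S.mul_mem (S.mul_mem (H.G_mem _ _) (this _)) (this _)

/-- Tensor identities carry factors `l_a`; a vector dual to `l` with components in `S` divides them
out without leaving the submodule. -/
theorem mem_of_mul_l_mem {N : Submodule S R} {x : R} (hx : ∀ a, x * l a ∈ N) : x ∈ N := by
  obtain ⟨σ, hσ, h1⟩ := H.exists_dual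
  have : x = ∑ a, σ a * (x * l a) := by
    simp only [mul_left_comm _ x, ← Finset.mul_sum, h1, mul_one]
  rw [this]
  exact N.sum_mem fun a _ => mul_mem_submodule (hσ a) (hx a)

/-! #### The first derivatives of the vector field -/

theorem X_mem (a : Fin n) : X a ∈ T.lin S X := by
  rw [← congrFun (T.up_low X) a]
  exact Submodule.sum_mem _ fun b _ => mul_mem_submodule (H.g_mem _ _) (low_mem b)

theorem X_mul_mem {c : R} (hc : c ∈ S) (a : Fin n) : X a * c ∈ T.lin S X :=
  mul_mem_submodule' hc (H.X_mem a)

theorem along_X_mem {f : R} (hf : f ∈ S) : T.along X f ∈ T.lin S X := by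
  rw [along_apply]
  exact Submodule.sum_mem _ fun b _ => H.X_mul_mem (H.d_mem _ _ hf) b

/-- The equation for `L_X g` gives the symmetric part of the lowered derivative, and `ξ_{[ab]}`
gives the antisymmetric part. -/
theorem d_X_mem (hX : ∀ a b, T.lieTwo X T.G a b = 2 * h * l a * l b) (a c : Fin n) :
    T.d a (X c) - h * l a * T.up l c ∈ T.lin S X := by
  have h1 : ∀ b, ∑ c, T.G b c * T.d a (X c) - h * l a * l b ∈ T.lin S X := by
    intro b
    have h2 := hX a b
    have h3 := T.two_mul_unk X a b
    simp only [low, map_sum, Derivation.leibniz, smul_eq_mul, lieTwo,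
      Finset.sum_add_distrib] at h2 h3
    have h4 : ∑ c, T.G c b * T.d a (X c) = ∑ c, T.G b c * T.d a (X c) := by
      simp only [T.G_symm b]
    apply mem_of_two_mul_mem
    have h5 : 2 * (∑ c, T.G b c * T.d a (X c) - h * l a * l b)
        = 2 * T.unk X (Sum.inr (a, b)) - ∑ c, X c * T.d c (T.G a b)
          - ∑ c, X c * T.d a (T.G b c) + ∑ c, X c * T.d b (T.G a c) := by
      linear_combination h2 - h3 - h4
    rw [h5]
    refine add_mem (sub_mem (sub_mem ?_ ?_) ?_) ?_
    · exact mul_mem_submodule (ofNat_mem S 2) (Submodule.subset_span ⟨_, rfl⟩)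
    all_goals
      exact Submodule.sum_mem _ fun c _ => H.X_mul_mem (H.d_mem _ _ (H.G_mem _ _)) c
  have h2 : T.d a (X c) - h * l a * T.up l c
      = ∑ b, T.g c b * (∑ c, T.G b c * T.d a (X c) - h * l a * l b) := by
    have h3 := congrFun (T.up_low fun c => T.d a (X c)) c
    rw [← h3]
    simp only [mul_sub, Finset.sum_sub_distrib]
    simp only [up, low, Finset.mul_sum, mul_left_comm]
  rw [h2]
  exact Submodule.sum_mem _ fun b _ => mul_mem_submodule (H.g_mem _ _) (h1 b)

/-- Substituting `h l_a l^c` for `∂_a X^c` shows how the Lie derivative of a data tensor depends on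
the gauge; the subtracted term is that dependence. -/
theorem lieTwo_mem (hX : ∀ a b, T.lieTwo X T.G a b = 2 * h * l a * l b)
    {A : Fin n → Fin n → R} (hA : ∀ a b, A a b ∈ S) (a b : Fin n) :
    T.lieTwo X A a b - h * ((∑ c, A c b * T.up l c) * l a + (∑ c, A a c * T.up l c) * l b)
      ∈ T.lin S X := by
  have : T.lieTwo X A a b - h * ((∑ c, A c b * T.up l c) * l a + (∑ c, A a c * T.up l c) * l b)
      = ∑ c, (X c * T.d c (A a b) + A c b * (T.d a (X c) - h * l a * T.up l c)
        + A a c * (T.d b (X c) - h * l b * T.up l c)) := by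
    simp only [lieTwo, Finset.sum_mul, mul_add, Finset.mul_sum, ← Finset.sum_add_distrib,
      ← Finset.sum_sub_distrib]
    exact Finset.sum_congr rfl fun _ _ => by ring
  rw [this]
  exact Submodule.sum_mem _ fun c _ => add_mem (add_mem (H.X_mul_mem (H.d_mem _ _ (hA _ _)) c)
    (mul_mem_submodule (hA _ _) (H.d_X_mem hX _ _))) (mul_mem_submodule (hA _ _) (H.d_X_mem hX _ _))

theorem lieFour_mem (hX : ∀ a b, T.lieTwo X T.G a b = 2 * h * l a * l b)
    {A : Fin n → Fin n → Fin n → Fin n → R} (hA : ∀ a b c d, A a b c d ∈ S) (a b c d : Fin n) :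
    T.lieFour X A a b c d - h * ∑ e, (A e b c d * T.up l e * l a + A a e c d * T.up l e * l b
      + A a b e d * T.up l e * l c + A a b c e * T.up l e * l d) ∈ T.lin S X := by
  have : T.lieFour X A a b c d - h * ∑ e, (A e b c d * T.up l e * l a + A a e c d * T.up l e * l b
      + A a b e d * T.up l e * l c + A a b c e * T.up l e * l d)
      = ∑ e, (X e * T.d e (A a b c d) + A e b c d * (T.d a (X e) - h * l a * T.up l e)
        + A a e c d * (T.d b (X e) - h * l b * T.up l e)
        + A a b e d * (T.d c (X e) - h * l c * T.up l e)
        + A a b c e * (T.d d (X e) - h * l d * T.up l e)) := by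
    simp only [lieFour, Finset.mul_sum, ← Finset.sum_sub_distrib]
    exact Finset.sum_congr rfl fun _ _ => by ring
  rw [this]
  have hd := H.d_X_mem hX
  exact Submodule.sum_mem _ fun e _ => add_mem (add_mem (add_mem (add_mem
    (H.X_mul_mem (H.d_mem _ _ (hA _ _ _ _)) e)
    (mul_mem_submodule (hA _ _ _ _) (hd _ _))) (mul_mem_submodule (hA _ _ _ _) (hd _ _)))
    (mul_mem_submodule (hA _ _ _ _) (hd _ _))) (mul_mem_submodule (hA _ _ _ _) (hd _ _))

/-- The `h`-part of `∂X` enters `L_X l` through `l_c l^c = 0`, so `m` is isolated whether or not `h`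
is. -/
theorem m_mem (hX : ∀ a b, T.lieTwo X T.G a b = 2 * h * l a * l b)
    (hl : ∀ a, T.lieOne X l a = m * l a) : m ∈ T.lin S X := by
  refine H.mem_of_mul_l_mem fun a => ?_
  have : m * l a = ∑ c, (X c * T.d c (l a) + l c * (T.d a (X c) - h * l a * T.up l c))
      + h * l a * ∑ c, l c * T.up l c := by
    rw [← hl, lieOne, Finset.mul_sum, ← Finset.sum_add_distrib]
    exact Finset.sum_congr rfl fun _ _ => by ring
  rw [this, H.null, mul_zero, add_zero]
  exact Submodule.sum_mem _ fun c _ => add_mem (H.X_mul_mem (H.d_mem _ _ (H.l_mem _)) c)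
    (mul_mem_submodule (H.l_mem _) (H.d_X_mem hX _ _))

end IsDataAlg

end DiffMetric

end

end KerrSchild

namespace KerrSchild

noncomputable section

namespace DiffMetric

namespace IsDataAlg

variable {n : ℕ} {R : Type*} [CommRing R] [Algebra ℝ R] {T : DiffMetric n R} {S : Subalgebra ℝ R}
  {l : Fin n → R} {X : Fin n → R} {h m Mf : R} (H : T.IsDataAlg S l)
include H

/-! #### Second derivatives of the vector field -/

theorem d_X_mem_linH (hX : ∀ a b, T.lieTwo X T.G a b = 2 * h * l a * l b) (a c : Fin n) :
    T.d a (X c) ∈ T.linH S X h :=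
  mem_linH_iff.2 ⟨l a * T.up l c, S.mul_mem (H.l_mem _) (H.v_mem _), by
    convert H.d_X_mem hX a c using 1; ring⟩

theorem X_mem_linH (a : Fin n) : X a ∈ T.linH S X h := lin_le_linH (H.X_mem a)

/-- `L_X Γ` equals `∂∂X` up to terms in `X` and `∂X`, which involve `h` but not its gradient. -/
theorem d_d_X_mem (hX : ∀ a b, T.lieTwo X T.G a b = 2 * h * l a * l b) (k a c : Fin n) :
    T.d k (T.d a (X c)) - T.lieΓ X c k a ∈ T.linH S X h := by
  have : T.d k (T.d a (X c)) - T.lieΓ X c k a = ∑ e, T.d e (X c) * T.Γ e k a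
      - ∑ e, X e * T.d e (T.Γ c k a) - ∑ e, T.Γ c e a * T.d k (X e)
      - ∑ e, T.Γ c k e * T.d a (X e) := by
    rw [lieΓ]; ring
  rw [this]
  have hd := H.d_X_mem_linH hX
  refine sub_mem (sub_mem (sub_mem ?_ ?_) ?_) ?_ <;> refine Submodule.sum_mem _ fun e _ => ?_
  · exact mul_mem_submodule' (H.Γ_mem _ _ _) (hd _ _)
  · exact mul_mem_submodule' (H.d_mem _ _ (H.Γ_mem _ _ _)) (H.X_mem_linH _)
  · exact mul_mem_submodule (H.Γ_mem _ _ _) (hd _ _)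
  · exact mul_mem_submodule (H.Γ_mem _ _ _) (hd _ _)

theorem d_low_mem (hX : ∀ a b, T.lieTwo X T.G a b = 2 * h * l a * l b) (k a : Fin n) :
    T.d k (T.low X a) ∈ T.linH S X h := by
  simp only [low, map_sum, Derivation.leibniz, smul_eq_mul]
  exact Submodule.sum_mem _ fun b _ => add_mem
    (mul_mem_submodule (H.G_mem _ _) (H.d_X_mem_linH hX _ _))
    (mul_mem_submodule' (H.d_mem _ _ (H.G_mem _ _)) (H.X_mem_linH _))

theorem d_d_low_mem (hX : ∀ a b, T.lieTwo X T.G a b = 2 * h * l a * l b) (k a b : Fin n) :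
    T.d k (T.d a (T.low X b))
      - (T.d k h * l b * l a + T.d a h * l b * l k - T.d b h * l k * l a) ∈ T.linH S X h := by
  have h1 : T.d k (T.d a (T.low X b))
      - (T.d k h * l b * l a + T.d a h * l b * l k - T.d b h * l k * l a)
      = ∑ c, (T.G b c * (T.d k (T.d a (X c)) - T.lieΓ X c k a)
          + T.d k (T.G b c) * T.d a (X c) + T.d a (T.G b c) * T.d k (X c)
          + X c * T.d k (T.d a (T.G b c)))
        + (T.nabl l k a * l b + l a * T.nabl l k b + T.nabl l a k * l b + l k * T.nabl l a b
          - T.nabl l b k * l a - l k * T.nabl l b a) * h := by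
    have := low_lieΓ hX b k a
    simp only [low, map_sum, map_add, Derivation.leibniz, smul_eq_mul, mul_sub,
      Finset.sum_add_distrib, Finset.sum_sub_distrib, this, mul_comm (T.d _ (X _))]
    ring
  rw [h1]
  have hd := H.d_X_mem_linH hX
  have hk := H.nabl_mem H.l_mem
  refine add_mem (Submodule.sum_mem _ fun c _ => add_mem (add_mem (add_mem ?_ ?_) ?_) ?_) ?_
  · exact mul_mem_submodule (H.G_mem _ _) (H.d_d_X_mem hX _ _ _)
  · exact mul_mem_submodule (H.d_mem _ _ (H.G_mem _ _)) (hd _ _)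
  · exact mul_mem_submodule (H.d_mem _ _ (H.G_mem _ _)) (hd _ _)
  · exact mul_mem_submodule' (H.d_mem _ _ (H.d_mem _ _ (H.G_mem _ _))) (H.X_mem_linH _)
  · refine mul_mem_submodule ?_ gauge_mem_linH
    have hm : ∀ a b c, T.nabl l a b * l c ∈ S := fun a b c => S.mul_mem (hk _ _) (H.l_mem _)
    have hm' : ∀ a b c, l a * T.nabl l b c ∈ S := fun a b c => S.mul_mem (H.l_mem _) (hk _ _)
    exact S.sub_mem (S.sub_mem (S.add_mem (S.add_mem (S.add_mem (hm _ _ _) (hm' _ _ _))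
      (hm _ _ _)) (hm' _ _ _)) (hm _ _ _)) (hm' _ _ _)

/-- Antisymmetrising `d_d_low_mem` in `a`, `b` cancels the term with `∂_k h`. Everything left of the
gradient carries the factor `l_k`, and the closing argument rests on this. -/
theorem d_unk_mem_linH (hX : ∀ a b, T.lieTwo X T.G a b = 2 * h * l a * l b) (k a b : Fin n) :
    T.d k (T.unk X (Sum.inr (a, b))) - (T.d a h * l b - T.d b h * l a) * l k
      ∈ T.linH S X h := by
  apply mem_of_two_mul_mem
  have h1 := congrArg (T.d k) (T.two_mul_unk X a b)
  rw [Derivation.leibniz, show T.d k (2 : R) = 0 from (T.d k).map_natCast 2, map_sub] at h1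
  convert sub_mem (H.d_d_low_mem hX k a b) (H.d_d_low_mem hX k b a) using 1
  simp only [smul_eq_mul, mul_zero, add_zero] at h1
  linear_combination h1

/-! #### Closing the system -/

/-- Differentiating `h = ∑ c_A Y_A` gives `∂_k h = w l_k` modulo `lin`, where `w` pairs the
coefficients with `∂_a h l_b - ∂_b h l_a`. Inserting this into `w` cancels the multiples of `l_a
l_b`, so `w` itself lies in `lin`. -/
theorem d_gauge_mem (hX : ∀ a b, T.lieTwo X T.G a b = 2 * h * l a * l b)
    (hh : h ∈ T.lin S X) (k : Fin n) : T.d k h ∈ T.lin S X := by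
  have hle := linH_le_lin hh
  obtain ⟨c, hc⟩ := (Submodule.mem_span_range_iff_exists_fun S).1 hh
  set w := ∑ x : Fin n × Fin n, (c (Sum.inr x) : R) * (T.d x.1 h * l x.2 - T.d x.2 h * l x.1)
    with hw
  have h1 : ∀ k, T.d k h - w * l k ∈ T.lin S X := by
    intro k
    have h2 := congrArg (T.d k) hc
    simp only [Subalgebra.smul_def, smul_eq_mul, Fintype.sum_sum_type, map_add, map_sum,
      Derivation.leibniz] at h2
    have h3 : T.d k h - w * l k
        = ∑ x, ((c (Sum.inl x) : R) * T.d k (T.unk X (Sum.inl x))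
            + T.unk X (Sum.inl x) * T.d k (c (Sum.inl x)))
          + ∑ x : Fin n × Fin n, ((c (Sum.inr x) : R) * (T.d k (T.unk X (Sum.inr (x.1, x.2)))
              - (T.d x.1 h * l x.2 - T.d x.2 h * l x.1) * l k)
            + T.unk X (Sum.inr x) * T.d k (c (Sum.inr x))) := by
      rw [← h2, hw, Finset.sum_mul, add_sub_assoc, ← Finset.sum_sub_distrib]
      congr 1
      exact Finset.sum_congr rfl fun _ _ => by ring
    rw [h3]
    refine add_mem (Submodule.sum_mem _ fun x _ => add_mem ?_ ?_)
      (Submodule.sum_mem _ fun x _ => add_mem ?_ ?_)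
    · exact mul_mem_submodule (c _).2 (hle (H.d_low_mem hX _ _))
    · exact mul_mem_submodule' (H.d_mem _ _ (c _).2) (Submodule.subset_span ⟨_, rfl⟩)
    · exact mul_mem_submodule (c _).2 (hle (H.d_unk_mem_linH hX _ _ _))
    · exact mul_mem_submodule' (H.d_mem _ _ (c _).2) (Submodule.subset_span ⟨_, rfl⟩)
  have h2 : w ∈ T.lin S X := by
    -- Replacing `∂_a h` by `∂_a h - w l_a` leaves the antisymmetric expression unchanged.
    have h3 : w = ∑ x : Fin n × Fin n, (c (Sum.inr x) : R)
        * ((T.d x.1 h - w * l x.1) * l x.2 - (T.d x.2 h - w * l x.2) * l x.1) := by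
      conv_lhs => rw [hw]
      exact Finset.sum_congr rfl fun _ _ => by ring
    rw [h3]
    exact Submodule.sum_mem _ fun x _ => mul_mem_submodule (c _).2
      (sub_mem (mul_mem_submodule' (H.l_mem _) (h1 _)) (mul_mem_submodule' (H.l_mem _) (h1 _)))
  have := add_mem (h1 k) (mul_mem_submodule' (H.l_mem k) h2)
  rwa [sub_add_cancel] at this

/-- If the gauge is a linear combination of the unknowns, so are the derivatives of the
unknowns. -/
theorem d_unk_mem (hX : ∀ a b, T.lieTwo X T.G a b = 2 * h * l a * l b)
    (hh : h ∈ T.lin S X) (k : Fin n) (A : Fin n ⊕ Fin n × Fin n) :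
    T.d k (T.unk X A) ∈ T.lin S X := by
  have hle := linH_le_lin hh
  have hd := H.d_gauge_mem hX hh
  rcases A with a | ⟨a, b⟩
  · exact hle (H.d_low_mem hX k a)
  · have h1 := add_mem (hle (H.d_unk_mem_linH hX k a b)) (mul_mem_submodule' (H.l_mem k)
      (sub_mem (mul_mem_submodule' (H.l_mem b) (hd a)) (mul_mem_submodule' (H.l_mem a) (hd b))))
    rwa [sub_add_cancel] at h1

/-! #### Isolating the gauge -/

/-- The gauge is isolated where the acceleration is not null. -/
theorem accSq_mul_gauge_mem (hX : ∀ a b, T.lieTwo X T.G a b = 2 * h * l a * l b) :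
    T.accSq l * h ∈ T.lin S X := by
  apply mem_of_two_mul_mem
  have h1 := lieTwo_ric_mul_up_up H.null hX
  -- The `h`-part of `L_X Ric` can be subtracted freely: each of its terms contains `l_a` or `l_b`
  -- and is killed by the contraction.
  have h2 : 2 * (T.accSq l * h) = - ∑ a, ∑ b, T.up l a * T.up l b *
      (T.lieTwo X T.ric a b
        - h * ((∑ c, T.ric c b * T.up l c) * l a + (∑ c, T.ric a c * T.up l c) * l b)) := by
    have h3 : ∀ a b, T.up l a * T.up l b * (T.lieTwo X T.ric a b
        - h * ((∑ c, T.ric c b * T.up l c) * l a + (∑ c, T.ric a c * T.up l c) * l b))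
        = T.up l a * T.up l b * T.lieTwo X T.ric a b
          - h * T.up l b * (∑ c, T.ric c b * T.up l c) * (l a * T.up l a)
          - h * T.up l a * (∑ c, T.ric a c * T.up l c) * (l b * T.up l b) := fun a b => by ring
    simp only [h3, Finset.sum_sub_distrib, h1]
    rw [Finset.sum_comm (f := fun a b => h * T.up l b * (∑ c, T.ric c b * T.up l c) * _)]
    simp only [← Finset.mul_sum, H.null, mul_zero, Finset.sum_const_zero]
    ring
  rw [h2]
  exact neg_mem (Submodule.sum_mem _ fun a _ => Submodule.sum_mem _ fun b _ =>
    mul_mem_submodule (S.mul_mem (H.v_mem _) (H.v_mem _)) (H.lieTwo_mem hX H.ric_mem _ _))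

/-- A first integrability condition, from the Lie derivative of the scalar curvature. -/
theorem scal_condition (hX : ∀ a b, T.lieTwo X T.G a b = 2 * h * l a * l b)
    (hg : ∀ a, T.acc l a = Mf * T.up l a) :
    T.along (T.up l) (T.along (T.up l) h + h * T.dvg l + h * Mf)
      + (T.along (T.up l) h + h * T.dvg l + h * Mf) * T.dvg l - h * T.ricBar l ∈ T.lin S X := by
  apply mem_of_two_mul_mem
  convert H.along_X_mem (X := X) H.scal_mem using 1
  rw [along_scal H.null hX hg]; ring

/-- A second integrability condition, from the Lie derivative of the Ricci tensor. -/
theorem ric_condition (hX : ∀ a b, T.lieTwo X T.G a b = 2 * h * l a * l b)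
    (hg : ∀ a, T.acc l a = Mf * T.up l a) :
    T.along (T.up l) (T.along (T.up l) h + 2 * Mf * h)
      + (T.dvg l + Mf) * (T.along (T.up l) h + 2 * Mf * h)
      - Mf * T.along (T.up l) h - h * (Mf ^ 2 + T.trSq l - T.normSq l) - h * T.ricBar l
      ∈ T.lin S X := by
  refine H.mem_of_mul_l_mem fun e => ?_
  rw [sub_mul, ← lieTwo_ric_mul_up_geodesic H.null hX hg]
  -- With a single contraction, one `h`-term vanishes and the other survives as `h R̄ l_e`. This
  -- shifts `Δ` to `Δ + 2 R̄` in `gauge_factors`.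
  have h2 : ∑ a, T.lieTwo X T.ric a e * T.up l a - h * T.ricBar l * l e
      = ∑ a, T.up l a * (T.lieTwo X T.ric a e
        - h * ((∑ c, T.ric c e * T.up l c) * l a + (∑ c, T.ric a c * T.up l c) * l e)) := by
    have h3 : ∀ a, T.up l a * (T.lieTwo X T.ric a e
        - h * ((∑ c, T.ric c e * T.up l c) * l a + (∑ c, T.ric a c * T.up l c) * l e))
        = T.lieTwo X T.ric a e * T.up l a
          - h * (∑ c, T.ric c e * T.up l c) * (l a * T.up l a)
          - h * l e * (∑ c, T.ric a c * T.up l a * T.up l c) := fun a => by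
      have : ∑ c, T.ric a c * T.up l a * T.up l c = T.up l a * ∑ c, T.ric a c * T.up l c := by
        rw [Finset.mul_sum]
        exact Finset.sum_congr rfl fun _ _ => by ring
      rw [this]; ring
    simp only [h3, Finset.sum_sub_distrib, ← Finset.mul_sum, H.null, ricBar]
    ring
  rw [h2]
  exact Submodule.sum_mem _ fun a _ => mul_mem_submodule (H.v_mem _) (H.lieTwo_mem hX H.ric_mem _ _)

/-- A third integrability condition, from the Lie derivative of the curvature tensor. -/
theorem riem_condition (hX : ∀ a b, T.lieTwo X T.G a b = 2 * h * l a * l b)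
    (hg : ∀ a, T.acc l a = Mf * T.up l a) :
    T.along (T.up l) (T.along (T.up l) h + 2 * Mf * h)
      + Mf * (T.along (T.up l) h + 2 * Mf * h) ∈ T.lin S X := by
  refine H.mem_of_mul_l_mem fun a => H.mem_of_mul_l_mem fun b => ?_
  rw [← neg_mem_iff, ← lieFour_mul_up_up H.null hX hg]
  -- All four `h`-terms vanish here: two by nullity, and two by the skew-symmetry of the curvature
  -- in its first pair (`hlow`) and last pair (`hlast`).
  have hlow : ∀ b c, ∑ e, ∑ s, T.riemLow e s b c * T.up l e * T.up l s = 0 := by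
    intro b c
    rw [← mul_riem_mul_up H.null b c]
    have : ∀ f, l f = ∑ e, T.G f e * T.up l e := fun f => (congrFun (T.low_up l) f).symm
    simp only [riemLow, this, Finset.sum_mul, Finset.mul_sum]
    calc _ = ∑ e, ∑ f, ∑ s, T.G e f * T.riem f s b c * T.up l e * T.up l s :=
          Finset.sum_congr rfl fun e _ => Finset.sum_comm
      _ = ∑ f, ∑ e, ∑ s, T.G e f * T.riem f s b c * T.up l e * T.up l s := Finset.sum_comm
      _ = _ := Finset.sum_congr rfl fun f _ => by
          rw [Finset.sum_comm]
          exact Finset.sum_congr rfl fun s _ => Finset.sum_congr rfl fun e _ => by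
            rw [T.G_symm e f]; ring
  have hlast : ∀ a s, ∑ e, ∑ m, T.riemLow a s e m * T.up l e * T.up l m = 0 := by
    intro a s
    have hanti : ∀ e m, T.riemLow a s e m = - T.riemLow a s m e := fun e m => by
      simp only [riemLow, ← Finset.sum_neg_distrib, riem]
      exact Finset.sum_congr rfl fun _ _ => by
        rw [Finset.sum_sub_distrib, Finset.sum_sub_distrib]; ring
    have h2 : ∑ e, ∑ m, T.riemLow a s e m * T.up l e * T.up l m
        = - ∑ e, ∑ m, T.riemLow a s e m * T.up l e * T.up l m := by
      conv_lhs => rw [Finset.sum_comm]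
      simp only [← Finset.sum_neg_distrib]
      exact Finset.sum_congr rfl fun e _ => Finset.sum_congr rfl fun m _ => by
        rw [hanti]; ring
    exact two_mul_cancel (by linear_combination h2)
  have h2 : ∑ s, ∑ m, T.lieFour X T.riemLow a s b m * T.up l s * T.up l m
      = ∑ s, ∑ m, T.up l s * T.up l m * (T.lieFour X T.riemLow a s b m
        - h * ∑ e, (T.riemLow e s b m * T.up l e * l a + T.riemLow a e b m * T.up l e * l s
          + T.riemLow a s e m * T.up l e * l b + T.riemLow a s b e * T.up l e * l m)) := by
    have h3 : ∀ s m, T.up l s * T.up l m * (T.lieFour X T.riemLow a s b m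
        - h * ∑ e, (T.riemLow e s b m * T.up l e * l a + T.riemLow a e b m * T.up l e * l s
          + T.riemLow a s e m * T.up l e * l b + T.riemLow a s b e * T.up l e * l m))
        = T.lieFour X T.riemLow a s b m * T.up l s * T.up l m
          - h * l a * T.up l m * ∑ e, T.riemLow e s b m * T.up l e * T.up l s
          - h * T.up l m * (∑ e, T.riemLow a e b m * T.up l e) * (l s * T.up l s)
          - h * l b * T.up l s * ∑ e, T.riemLow a s e m * T.up l e * T.up l m
          - h * T.up l s * (∑ e, T.riemLow a s b e * T.up l e) * (l m * T.up l m) := fun s m => by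
      simp only [Finset.sum_add_distrib, ← Finset.sum_mul]
      ring
    simp only [h3, Finset.sum_sub_distrib]
    have t1 : ∑ s, ∑ m, h * l a * T.up l m * ∑ e, T.riemLow e s b m * T.up l e * T.up l s = 0 := by
      rw [Finset.sum_comm]
      refine Finset.sum_eq_zero fun m _ => ?_
      rw [← Finset.mul_sum, Finset.sum_comm, hlow, mul_zero]
    have t2 : ∑ s, ∑ m, h * T.up l m * (∑ e, T.riemLow a e b m * T.up l e) * (l s * T.up l s)
        = 0 := by
      rw [Finset.sum_comm]
      simp only [← Finset.mul_sum, H.null, mul_zero, Finset.sum_const_zero]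
    have t3 : ∑ s, ∑ m, h * l b * T.up l s * ∑ e, T.riemLow a s e m * T.up l e * T.up l m = 0 := by
      refine Finset.sum_eq_zero fun m _ => ?_
      rw [← Finset.mul_sum, Finset.sum_comm, hlast, mul_zero]
    have t4 : ∑ s, ∑ m, h * T.up l s * (∑ e, T.riemLow a s b e * T.up l e) * (l m * T.up l m)
        = 0 := by
      simp only [← Finset.mul_sum, H.null, mul_zero, Finset.sum_const_zero]
    rw [t1, t2, t3, t4]
    ring
  rw [h2]
  exact Submodule.sum_mem _ fun s _ => Submodule.sum_mem _ fun m _ =>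
    mul_mem_submodule (S.mul_mem (H.v_mem _) (H.v_mem _)) (H.lieFour_mem hX H.riemLow_mem _ _ _ _)

/-- The derivative of the gauge `m`. -/
theorem d_m_mem (hX : ∀ a b, T.lieTwo X T.G a b = 2 * h * l a * l b)
    (hg : ∀ a, T.acc l a = Mf * T.up l a) (hl : ∀ a, T.lieOne X l a = m * l a) (a : Fin n) :
    T.d a m + (T.along (T.up l) h + Mf * h) * l a ∈ T.lin S X := by
  refine H.mem_of_mul_l_mem fun b => ?_
  have h1 := lieTwo_nabl_geodesic H.null hX hg hl a b
  have h2 := H.lieTwo_mem hX (H.nabl_mem H.l_mem) a b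
  rw [T.nabl_mul_up H.null, show ∑ c, T.nabl l c b * T.up l c = Mf * l b by
    rw [← sum_up_mul_nabl hg]; simp only [mul_comm]] at h2
  convert sub_mem h2 (mul_mem_submodule' (H.nabl_mem H.l_mem a b) (H.m_mem hX hl)) using 1
  rw [h1]; ring

/-- A fourth integrability condition, from the Lie derivative of the expansion. -/
theorem dvg_condition (hX : ∀ a b, T.lieTwo X T.G a b = 2 * h * l a * l b) (hM : Mf ∈ S)
    (hg : ∀ a, T.acc l a = Mf * T.up l a) (hl : ∀ a, T.lieOne X l a = m * l a) :
    (T.dvg l - Mf) * T.along (T.up l) h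
      + (T.along (T.up l) (T.dvg l - Mf) + (T.dvg l - Mf) * Mf) * h ∈ T.lin S X := by
  set f := T.dvg l - Mf with hf
  have hfS : f ∈ S := S.sub_mem H.dvg_mem hM
  -- The Lie derivatives of `∇·l` and `M` contain the same `Dm`, which cancels in the difference.
  have h1 : T.along X f = m * f := by
    obtain ⟨σ, hσ, hσ1⟩ := H.exists_dual
    have h2 : T.along X Mf = T.along (T.up l) m + m * Mf := by
      have h3 : ∀ b, σ b * (T.along X Mf * l b) = σ b * ((T.along (T.up l) m + m * Mf) * l b) :=
        fun b => by rw [along_inaffinity H.null hX hg hl]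
      have h4 := Finset.sum_congr (rfl : Finset.univ = Finset.univ) fun b _ => h3 b
      simpa only [mul_left_comm (σ _), ← Finset.mul_sum, hσ1, mul_one] using h4
    rw [hf, map_sub, h2, along_dvg H.null hX hg hl]; ring
  refine H.mem_of_mul_l_mem fun a => ?_
  -- The gradient of `m` equals `-(Dh + M h) l_a` modulo `lin`, so differentiating `L_X f = m f`
  -- produces a first-order equation for `h`.
  have h5 := congrArg (T.d a) h1
  simp only [along_apply, map_sum, Derivation.leibniz, smul_eq_mul, Finset.sum_add_distrib] at h5
  have h6 : (f * T.along (T.up l) h + (T.along (T.up l) f + f * Mf) * h) * l a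
      = f * (T.d a m + (T.along (T.up l) h + Mf * h) * l a) + m * T.d a f
        - ∑ c, X c * T.d a (T.d c f) - ∑ c, T.d c f * (T.d a (X c) - h * l a * T.up l c) := by
    have h7 : ∑ c, T.d c f * (T.d a (X c) - h * l a * T.up l c)
        = ∑ c, T.d c f * T.d a (X c) - h * l a * T.along (T.up l) f := by
      simp only [along_apply, mul_sub, Finset.sum_sub_distrib, Finset.mul_sum]
      congr 1
      exact Finset.sum_congr rfl fun _ _ => by ring
    rw [h7]
    linear_combination h5
  rw [h6]
  refine sub_mem (sub_mem (add_mem ?_ ?_) ?_) ?_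
  · exact mul_mem_submodule hfS (H.d_m_mem hX hg hl a)
  · exact mul_mem_submodule' (H.d_mem _ _ hfS) (H.m_mem hX hl)
  · exact Submodule.sum_mem _ fun c _ => H.X_mul_mem (H.d_mem _ _ (H.d_mem _ _ hfS)) c
  · exact Submodule.sum_mem _ fun c _ => mul_mem_submodule (H.d_mem _ _ hfS) (H.d_X_mem hX _ _)

/-- The derivative along the null vector of a combination of the unknowns. -/
theorem along_mem_linH (hX : ∀ a b, T.lieTwo X T.G a b = 2 * h * l a * l b) {x : R}
    (hx : x ∈ T.lin S X) : T.along (T.up l) x ∈ T.linH S X h := by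
  induction hx using Submodule.span_induction with
  | mem x hx =>
    obtain ⟨A, rfl⟩ := hx
    rcases A with a | ⟨a, b⟩
    · rw [along_apply]
      exact Submodule.sum_mem _ fun c _ => mul_mem_submodule (H.v_mem _) (H.d_low_mem hX c a)
    · have h1 : T.along (T.up l) (T.unk X (Sum.inr (a, b)))
          = ∑ k, T.up l k * (T.d k (T.unk X (Sum.inr (a, b)))
            - (T.d a h * l b - T.d b h * l a) * l k) := by
        have : ∀ k, T.up l k * (T.d k (T.unk X (Sum.inr (a, b)))
            - (T.d a h * l b - T.d b h * l a) * l k)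
            = T.up l k * T.d k (T.unk X (Sum.inr (a, b)))
              - (T.d a h * l b - T.d b h * l a) * (l k * T.up l k) := fun k => by ring
        simp only [this, Finset.sum_sub_distrib, ← Finset.mul_sum, H.null, along_apply]
        ring
      rw [h1]
      exact Submodule.sum_mem _ fun k _ => mul_mem_submodule (H.v_mem _) (H.d_unk_mem_linH hX k a b)
  | zero => rw [map_zero]; exact zero_mem _
  | add x y _ _ hx hy => rw [map_add]; exact add_mem hx hy
  | smul c x hx' hx =>
    rw [Subalgebra.smul_def, smul_eq_mul, Derivation.leibniz]
    exact add_mem (mul_mem_submodule c.2 hx)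
      (mul_mem_submodule' (H.along_mem c.2) (lin_le_linH hx'))

/-- The three factors by which the gauge of a geodesic null covector field is isolated. -/
theorem gauge_factors (hX : ∀ a b, T.lieTwo X T.G a b = 2 * h * l a * l b) (hM : Mf ∈ S)
    (hg : ∀ a, T.acc l a = Mf * T.up l a) (hl : ∀ a, T.lieOne X l a = m * l a) :
    (T.delta l Mf + 2 * T.ricBar l) * h ∈ T.lin S X ∧ T.normSq l * h ∈ T.lin S X ∧
    ∃ q ∈ S, ((2 * T.along (T.up l) (T.dvg l - Mf) - 2 * ((T.dvg l - Mf) * Mf))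
      * (T.along (T.up l) (T.dvg l - Mf) + (T.dvg l - Mf) * Mf) + (T.dvg l - Mf) * q) * h
        ∈ T.lin S X := by
  have hA := H.scal_condition hX hg
  have hB := H.ric_condition hX hg
  have hC := H.riem_condition hX hg
  have hE := H.dvg_condition hX hM hg hl
  have hR := ricBar_geodesic hg
  have h2 : T.along (T.up l) (2 : R) = 0 := (T.along (T.up l)).map_natCast 2
  have h3 : (T.delta l Mf + 2 * T.ricBar l) * h ∈ T.lin S X := by
    -- Both `DDh` and `Dh` cancel in `A - 2B + C`.
    convert add_mem (sub_mem hA (mul_mem_submodule (ofNat_mem S 2) hB)) hC using 1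
    rw [delta_eq H.null, hR]
    simp only [map_add, Derivation.leibniz, smul_eq_mul, h2]
    ring
  refine ⟨h3, ?_, ?_⟩
  -- `A - B` has no `DDh`, and its first-order part `f Dh` is that of `E`.
  · convert sub_mem (sub_mem (sub_mem hA hB) hE) h3 using 1
    rw [delta_eq H.null, hR]
    simp only [map_add, map_sub, Derivation.leibniz, smul_eq_mul, h2]
    ring
  · set f := T.dvg l - Mf with hf
    have hfS : f ∈ S := S.sub_mem H.dvg_mem hM
    set e := T.along (T.up l) f + f * Mf with he
    have heS : e ∈ S := S.add_mem (H.along_mem hfS) (S.mul_mem hfS hM)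
    -- `E` is differentiated along `l` and `DDh` removed by `C`. Derivatives along `l` produce no
    -- gradient of `h`, since `l^k l_k = 0` (`along_mem_linH`). Eliminating `Dh` against `E` then
    -- gives the third factor.
    have h4 : (2 * T.along (T.up l) f - 2 * (f * Mf)) * T.along (T.up l) h ∈ T.linH S X h := by
      have h5 : (2 * T.along (T.up l) f - 2 * (f * Mf)) * T.along (T.up l) h
          = T.along (T.up l) (f * T.along (T.up l) h + e * h)
            - f * (T.along (T.up l) (T.along (T.up l) h + 2 * Mf * h)
              + Mf * (T.along (T.up l) h + 2 * Mf * h))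
            + (f * (2 * T.along (T.up l) Mf + 2 * Mf ^ 2) - T.along (T.up l) e) * h := by
        simp only [map_add, Derivation.leibniz, smul_eq_mul, h2, he]
        ring
      rw [h5]
      refine add_mem (sub_mem (H.along_mem_linH hX hE)
        (mul_mem_submodule hfS (lin_le_linH hC))) (mul_mem_submodule ?_ gauge_mem_linH)
      exact S.sub_mem (S.mul_mem hfS (S.add_mem (S.mul_mem (ofNat_mem S 2) (H.along_mem hM))
        (S.mul_mem (ofNat_mem S 2) (S.pow_mem hM 2)))) (H.along_mem heS)
    obtain ⟨q, hq, h5⟩ := mem_linH_iff.1 h4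
    refine ⟨q, hq, ?_⟩
    have hpS : 2 * T.along (T.up l) f - 2 * (f * Mf) ∈ S :=
      S.sub_mem (S.mul_mem (ofNat_mem S 2) (H.along_mem hfS))
        (S.mul_mem (ofNat_mem S 2) (S.mul_mem hfS hM))
    convert sub_mem (mul_mem_submodule hpS hE) (mul_mem_submodule hfS h5) using 1
    ring

end IsDataAlg

end DiffMetric

end

end KerrSchild

namespace KerrSchild

noncomputable section

/-! ### The ring of families of smooth functions -/

section SmoothFamilies

open TopologicalSpace

variable {n : ℕ} {ι : Type*} (W : ι → Opens (Coord n))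

/-- The extension by zero of the members of a family of functions. -/
def extZero (f : (Σ s, W s) → ℝ) (s : ι) (y : Coord n) : ℝ :=
  open Classical in if hy : y ∈ W s then f ⟨s, y, hy⟩ else 0

variable {W} in
theorem extZero_apply (f : (Σ s, W s) → ℝ) {s : ι} {y : Coord n} (hy : y ∈ W s) :
    extZero W f s y = f ⟨s, y, hy⟩ := dif_pos hy

/-- The families of smooth functions on a family of open sets. -/
def SmoothFam : Subalgebra ℝ ((Σ s, W s) → ℝ) where
  carrier := {f | ∀ s, ContDiffOn ℝ ∞ (extZero W f s) (W s)}
  mul_mem' hf hg s := ((hf s).mul (hg s)).congr fun y hy => by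
    simp only [extZero_apply _ hy, Pi.mul_apply]
  add_mem' hf hg s := ((hf s).add (hg s)).congr fun y hy => by
    simp only [extZero_apply _ hy, Pi.add_apply]
  algebraMap_mem' r s := (contDiffOn_const (c := r)).congr fun y hy => by
    rw [extZero_apply _ hy]; rfl

variable {W}

theorem SmoothFam.contDiffOn (f : SmoothFam W) (s : ι) :
    ContDiffOn ℝ ∞ (extZero W f.1 s) (W s) := f.2 s

theorem SmoothFam.contDiffAt (f : SmoothFam W) {s : ι} {y : Coord n} (hy : y ∈ W s) :
    ContDiffAt ℝ ∞ (extZero W f.1 s) y :=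
  (SmoothFam.contDiffOn f s).contDiffAt ((W s).isOpen.mem_nhds hy)

theorem SmoothFam.differentiableAt (f : SmoothFam W) {s : ι} {y : Coord n} (hy : y ∈ W s) :
    DifferentiableAt ℝ (extZero W f.1 s) y := (SmoothFam.contDiffAt f hy).differentiableAt (by simp)

theorem pd_congr {f g : Coord n → ℝ} {U : Opens (Coord n)} (h : ∀ y ∈ U, f y = g y)
    {y : Coord n} (hy : y ∈ U) (i : Fin n) : pd i f y = pd i g y := by
  have : f =ᶠ[nhds y] g := Filter.eventually_of_mem (U.isOpen.mem_nhds hy) h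
  rw [pd, pd, this.fderiv_eq]

theorem contDiffOn_pd {f : Coord n → ℝ} {U : Opens (Coord n)} (hf : ContDiffOn ℝ ∞ f U)
    (i : Fin n) : ContDiffOn ℝ ∞ (pd i f) U :=
  (hf.fderiv_of_isOpen (m := ∞) U.isOpen (by simp)).clm_apply contDiffOn_const

theorem pd_pd {f : Coord n → ℝ} {U : Opens (Coord n)} (hf : ContDiffOn ℝ ∞ f U)
    {y : Coord n} (hy : y ∈ U) (i j : Fin n) : pd i (pd j f) y = pd j (pd i f) y := by
  have hy' := U.isOpen.mem_nhds hy
  have hd : DifferentiableAt ℝ (fderiv ℝ f) y :=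
    ((hf.fderiv_of_isOpen (m := ∞) U.isOpen (by simp)).contDiffAt hy').differentiableAt (by simp)
  have hs := ((hf.contDiffAt hy').isSymmSndFDerivAt
    (by rw [minSmoothness_of_isRCLikeNormedField]; exact WithTop.coe_le_coe.2 le_top)).eq
    (EuclideanSpace.single i (1 : ℝ)) (EuclideanSpace.single j (1 : ℝ))
  have key : ∀ i j : Fin n, pd i (pd j f) y
      = fderiv ℝ (fderiv ℝ f) y (EuclideanSpace.single i (1 : ℝ))
        (EuclideanSpace.single j (1 : ℝ)) := fun i j => by
    have : pd j f = fun z => fderiv ℝ f z (EuclideanSpace.single j (1 : ℝ)) := rfl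
    rw [pd, this, fderiv_clm_apply hd (differentiableAt_const _)]
    simp
  rw [key, key, hs]

/-- The partial derivative of a family. -/
def pdFam (i : Fin n) (f : SmoothFam W) : SmoothFam W :=
  ⟨fun p => pd i (extZero W f.1 p.1) p.2, fun s =>
    (contDiffOn_pd (SmoothFam.contDiffOn f s) i).congr fun y hy => by rw [extZero_apply _ hy]⟩

/-- A family of functions on the whole space represents an element of the ring. -/
def Rep (F : ι → Coord n → ℝ) (r : SmoothFam W) : Prop :=
  ∀ s y (hy : y ∈ W s), F s y = r.1 ⟨s, y, hy⟩

/-- The element of the ring represented by a family of smooth functions. -/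
def mkFam (F : ι → Coord n → ℝ) (hF : ∀ s, ContDiffOn ℝ ∞ (F s) (W s)) : SmoothFam W :=
  ⟨fun p => F p.1 p.2, fun s => (hF s).congr fun y hy => by rw [extZero_apply _ hy]⟩

namespace Rep

theorem mk {F : ι → Coord n → ℝ} (hF : ∀ s, ContDiffOn ℝ ∞ (F s) (W s)) : Rep F (mkFam F hF) :=
  fun _ _ _ => rfl

theorem extZero (r : SmoothFam W) : Rep (extZero W r.1) r := fun _ _ hy => extZero_apply _ hy

variable {F F' : ι → Coord n → ℝ} {r r' : SmoothFam W}

theorem ext (h : Rep F r) (h' : Rep F r') : r = r' :=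
  Subtype.ext (funext fun p => by rw [← h p.1 p.2.1 p.2.2, ← h' p.1 p.2.1 p.2.2])

theorem eq_of_eq (h : Rep F r) (h' : Rep F' r') (e : r = r') {s : ι} {y : Coord n}
    (hy : y ∈ W s) : F s y = F' s y := by
  rw [h s y hy, h' s y hy, e]

theorem of_eq (h : Rep F r) (h' : Rep F' r')
    (e : ∀ s, ∀ y ∈ W s, F s y = F' s y) : r = r' :=
  h.ext fun s y hy => by rw [e s y hy, h' s y hy]

theorem add (h : Rep F r) (h' : Rep F' r') : Rep (fun s y => F s y + F' s y) (r + r') :=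
  fun s y hy => congrArg₂ (· + ·) (h s y hy) (h' s y hy)

theorem sub (h : Rep F r) (h' : Rep F' r') : Rep (fun s y => F s y - F' s y) (r - r') :=
  fun s y hy => congrArg₂ (· - ·) (h s y hy) (h' s y hy)

theorem mul (h : Rep F r) (h' : Rep F' r') : Rep (fun s y => F s y * F' s y) (r * r') :=
  fun s y hy => congrArg₂ (· * ·) (h s y hy) (h' s y hy)

theorem const_mul (c : ℝ) (h : Rep F r) : Rep (fun s y => c * F s y) (c • r) :=
  fun s y hy => congrArg (c * ·) (h s y hy)

theorem zero : Rep (fun _ _ => 0) (0 : SmoothFam W) := fun _ _ _ => rfl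

theorem two : Rep (fun _ _ => 2) (2 : SmoothFam W) := fun _ _ _ => rfl

theorem three : Rep (fun _ _ => 3) (3 : SmoothFam W) := fun _ _ _ => rfl

theorem four : Rep (fun _ _ => 4) (4 : SmoothFam W) := fun _ _ _ => rfl

theorem neg (h : Rep F r) : Rep (fun s y => -F s y) (-r) :=
  fun s y hy => congrArg Neg.neg (h s y hy)

theorem sum {κ : Type*} (t : Finset κ) {F : κ → ι → Coord n → ℝ} {r : κ → SmoothFam W}
    (h : ∀ k, Rep (F k) (r k)) : Rep (fun s y => ∑ k ∈ t, F k s y) (∑ k ∈ t, r k) := by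
  classical
  induction t using Finset.induction_on with
  | empty => simpa using Rep.zero
  | insert a t ha ih => simpa only [Finset.sum_insert ha] using (h a).add ih

theorem pd (h : Rep F r) (i : Fin n) : Rep (fun s => pd i (F s)) (pdFam i r) := fun s y hy =>
  pd_congr (fun z hz => by rw [h s z hz, extZero_apply _ hz]) hy i

end Rep

/-- The partial derivative as a derivation. -/
def pdDer (i : Fin n) : Derivation ℝ (SmoothFam W) (SmoothFam W) :=
  Derivation.mk'
    { toFun := pdFam i
      map_add' := fun f g => by
        refine (((Rep.extZero f).add (Rep.extZero g)).pd i).of_eq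
          (((Rep.extZero f).pd i).add ((Rep.extZero g).pd i)) fun s y hy => ?_
        simp only [pd]
        rw [fderiv_fun_add (SmoothFam.differentiableAt f hy) (SmoothFam.differentiableAt g hy)]
        rfl
      map_smul' := fun c f => by
        refine (((Rep.extZero f).const_mul c).pd i).of_eq
          (((Rep.extZero f).pd i).const_mul c) fun s y hy => ?_
        simp only [pd]
        rw [fderiv_const_mul (SmoothFam.differentiableAt f hy)]
        rfl }
    fun f g => by
      refine (((Rep.extZero f).mul (Rep.extZero g)).pd i).of_eq
        (((Rep.extZero f).mul ((Rep.extZero g).pd i)).add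
          ((Rep.extZero g).mul ((Rep.extZero f).pd i))) fun s y hy => ?_
      simp only [pd]
      rw [fderiv_fun_mul (SmoothFam.differentiableAt f hy) (SmoothFam.differentiableAt g hy)]
      rfl

theorem pdDer_comm (i j : Fin n) (f : SmoothFam W) :
    pdDer i (pdDer j f) = pdDer j (pdDer i f) :=
  (((Rep.extZero f).pd j).pd i).of_eq (((Rep.extZero f).pd i).pd j) fun s _ hy =>
    pd_pd (SmoothFam.contDiffOn f s) hy i j

/-- The families whose members agree with each other. -/
def constFam (W : ι → Opens (Coord n)) : Subalgebra ℝ (SmoothFam W) where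
  carrier := {f | ∀ s s' y (hy : y ∈ W s) (hy' : y ∈ W s'), f.1 ⟨s, y, hy⟩ = f.1 ⟨s', y, hy'⟩}
  mul_mem' {f g} hf hg s s' y hy hy' := by
    have h1 := hf s s' y hy hy'
    have h2 := hg s s' y hy hy'
    change f.1 _ * g.1 _ = f.1 _ * g.1 _
    rw [h1, h2]
  add_mem' {f g} hf hg s s' y hy hy' := by
    have h1 := hf s s' y hy hy'
    have h2 := hg s s' y hy hy'
    change f.1 _ + g.1 _ = f.1 _ + g.1 _
    rw [h1, h2]
  algebraMap_mem' r s s' y hy hy' := rfl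

theorem Rep.mem_constFam {F : Coord n → ℝ} {r : SmoothFam W} (h : Rep (fun _ => F) r) :
    r ∈ constFam W := fun s s' y hy hy' => by rw [← h s y hy, ← h s' y hy']

theorem pdDer_mem_constFam (i : Fin n) {f : SmoothFam W} (hf : f ∈ constFam W) :
    pdDer i f ∈ constFam W := fun s s' y hy hy' =>
  pd_congr (U := W s ⊓ W s') (fun z hz => by
    rw [extZero_apply _ hz.1, extZero_apply _ hz.2]; exact hf s s' z hz.1 hz.2) ⟨hy, hy'⟩ i

/-- The inverse is taken pointwise, so members that agree have inverses that agree: division by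
nonvanishing data keeps the coefficients independent of the solution. -/
theorem exists_mul_eq_one {f : SmoothFam W} (hf : f ∈ constFam W)
    (h : ∀ s y (hy : y ∈ W s), f.1 ⟨s, y, hy⟩ ≠ 0) : ∃ g ∈ constFam W, f * g = 1 := by
  refine ⟨mkFam (fun s y => (extZero W f.1 s y)⁻¹) fun s => (SmoothFam.contDiffOn f s).inv
    fun y hy => by rw [extZero_apply _ hy]; exact h s y hy, ?_, ?_⟩
  · intro s s' y hy hy'
    change (extZero W f.1 s y)⁻¹ = (extZero W f.1 s' y)⁻¹
    rw [extZero_apply _ hy, extZero_apply _ hy', hf s s' y hy hy']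
  · refine Subtype.ext (funext fun p => ?_)
    change f.1 p * (extZero W f.1 p.1 p.2)⁻¹ = 1
    rw [extZero_apply _ p.2.2]
    exact mul_inv_cancel₀ (h _ _ _)

/-- Evaluation at a point. -/
def evalFam (p : Σ s, W s) : SmoothFam W →+* ℝ :=
  (Pi.evalRingHom (fun _ : Σ s, W s => ℝ) p).comp (SmoothFam W).val.toRingHom

theorem evalFam_apply (p : Σ s, W s) (f : SmoothFam W) : evalFam p f = f.1 p := rfl

/-- The components of a metric on a family of open sets. -/
structure IsMetricOn (W : ι → Opens (Coord n)) (G : Fin n → Fin n → Coord n → ℝ) : Prop where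
  smooth : ∀ s a b, ContDiffOn ℝ ∞ (G a b) (W s)
  symm : ∀ a b s, ∀ y ∈ W s, G a b y = G b a y
  det_ne_zero : ∀ s, ∀ y ∈ W s, (Matrix.of fun a b => G a b y).det ≠ 0

namespace IsMetricOn

variable {G : Fin n → Fin n → Coord n → ℝ} (hG : IsMetricOn W G)

/-- The metric as a matrix over the ring of families. -/
def mat : Matrix (Fin n) (Fin n) (SmoothFam W) :=
  Matrix.of fun a b => mkFam (fun _ => G a b) fun s => hG.smooth s a b

theorem rep_mat (a b : Fin n) : Rep (fun _ => G a b) (hG.mat a b) :=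
  Rep.mk fun s => hG.smooth s a b

theorem map_mat (s : ι) (y : Coord n) (hy : y ∈ W s) :
    hG.mat.map (evalFam ⟨s, y, hy⟩) = Matrix.of fun a b => G a b y := rfl

theorem mat_mem (a b : Fin n) : hG.mat a b ∈ constFam W := (hG.rep_mat a b).mem_constFam

theorem exists_inv : ∃ B : Matrix (Fin n) (Fin n) (SmoothFam W), B * hG.mat = 1 := by
  have hd : hG.mat.det ∈ constFam W := by
    rw [Matrix.det_apply]
    exact sum_mem fun σ _ => zsmul_mem (prod_mem fun a _ => hG.mat_mem _ _) _
  obtain ⟨g, -, hg⟩ := exists_mul_eq_one hd fun s y hy => by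
    rw [← evalFam_apply, RingHom.map_det]
    exact hG.det_ne_zero s y hy
  have : IsUnit hG.mat.det := IsUnit.of_mul_eq_one g hg
  exact ⟨hG.mat⁻¹, Matrix.nonsing_inv_mul _ this⟩

/-- The inverse metric over the ring of families. -/
def inv : Matrix (Fin n) (Fin n) (SmoothFam W) := hG.exists_inv.choose

theorem inv_mul : hG.inv * hG.mat = 1 := hG.exists_inv.choose_spec

/-- A left inverse over the ring evaluates to a left inverse at each point, and real matrix inverses
are unique. -/
theorem rep_inv (a b : Fin n) : Rep (fun _ => ginv G a b) (hG.inv a b) := fun s y hy => by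
  have h1 : hG.inv.map (evalFam ⟨s, y, hy⟩) * (Matrix.of fun a b => G a b y) = 1 := by
    rw [← hG.map_mat s y hy, ← Matrix.map_mul, hG.inv_mul, Matrix.map_one _ (map_zero _) (map_one _)]
  have h2 := Matrix.inv_eq_left_inv h1
  exact congrFun (congrFun h2 a) b

/-- The metric over the ring of families. -/
def toDiffMetric : DiffMetric n (SmoothFam W) where
  d := pdDer
  d_comm := pdDer_comm
  G := hG.mat
  g := hG.inv
  G_symm a b := (hG.rep_mat a b).of_eq (hG.rep_mat b a) fun s y hy => hG.symm a b s y hy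
  g_mul_G a b := by
    have := congrFun (congrFun hG.inv_mul a) b
    rwa [Matrix.mul_apply, Matrix.one_apply] at this

/-! #### Comparison of the two tensor calculi -/

variable {l : ι → Fin n → Coord n → ℝ} {k : Fin n → SmoothFam W}

theorem rep_d {F : ι → Coord n → ℝ} {r : SmoothFam W} (h : Rep F r) (i : Fin n) :
    Rep (fun s => pd i (F s)) (hG.toDiffMetric.d i r) := h.pd i

theorem rep_G (a b : Fin n) : Rep (fun _ => G a b) (hG.toDiffMetric.G a b) := hG.rep_mat a b

theorem rep_g (a b : Fin n) : Rep (fun _ => ginv G a b) (hG.toDiffMetric.g a b) := hG.rep_inv a b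

theorem rep_Γ (a b c : Fin n) :
    Rep (fun _ => christoffel G a b c) (hG.toDiffMetric.Γ a b c) :=
  (Rep.sum _ fun _ => (hG.rep_g _ _).mul (((hG.rep_d (hG.rep_G _ _) _).add
    (hG.rep_d (hG.rep_G _ _) _)).sub (hG.rep_d (hG.rep_G _ _) _))).const_mul _

theorem rep_riem (a b c d : Fin n) :
    Rep (fun _ => riemann G a b c d) (hG.toDiffMetric.riem a b c d) :=
  ((hG.rep_d (hG.rep_Γ _ _ _) _).sub (hG.rep_d (hG.rep_Γ _ _ _) _)).add (Rep.sum _ fun _ =>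
    ((hG.rep_Γ _ _ _).mul (hG.rep_Γ _ _ _)).sub ((hG.rep_Γ _ _ _).mul (hG.rep_Γ _ _ _)))

theorem rep_riemLow (a b c d : Fin n) :
    Rep (fun _ => riemannLow G a b c d) (hG.toDiffMetric.riemLow a b c d) :=
  Rep.sum _ fun _ => (hG.rep_G _ _).mul (hG.rep_riem _ _ _ _)

theorem rep_ric (a b : Fin n) : Rep (fun _ => ricci G a b) (hG.toDiffMetric.ric a b) :=
  Rep.sum _ fun _ => hG.rep_riem _ _ _ _

theorem rep_scal : Rep (fun _ => scalarCurv G) hG.toDiffMetric.scal :=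
  Rep.sum _ fun _ => Rep.sum _ fun _ => (hG.rep_g _ _).mul (hG.rep_ric _ _)

theorem rep_up (h : ∀ a, Rep (fun s => l s a) (k a)) (a : Fin n) :
    Rep (fun s => raise G (l s) a) (hG.toDiffMetric.up k a) :=
  Rep.sum _ fun _ => (hG.rep_g _ _).mul (h _)

theorem rep_low (h : ∀ a, Rep (fun s => l s a) (k a)) (a : Fin n) :
    Rep (fun s => lower G (l s) a) (hG.toDiffMetric.low k a) :=
  Rep.sum _ fun _ => (hG.rep_G _ _).mul (h _)

theorem rep_nabl (h : ∀ a, Rep (fun s => l s a) (k a)) (a b : Fin n) :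
    Rep (fun s => covD G (l s) a b) (hG.toDiffMetric.nabl k a b) :=
  (hG.rep_d (h _) _).sub (Rep.sum _ fun _ => (hG.rep_Γ _ _ _).mul (h _))

theorem rep_nabv (h : ∀ a, Rep (fun s => l s a) (k a)) (a b : Fin n) :
    Rep (fun s => covDVec G (l s) a b) (hG.toDiffMetric.nabv k a b) :=
  (hG.rep_d (h _) _).add (Rep.sum _ fun _ => (hG.rep_Γ _ _ _).mul (h _))

theorem rep_nabl2 {A : ι → Fin n → Fin n → Coord n → ℝ} {B : Fin n → Fin n → SmoothFam W}
    (h : ∀ a b, Rep (fun s => A s a b) (B a b)) (c a b : Fin n) :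
    Rep (fun s => covD2 G (A s) c a b) (hG.toDiffMetric.nabl2 B c a b) :=
  ((hG.rep_d (h _ _) _).sub (Rep.sum _ fun _ => (hG.rep_Γ _ _ _).mul (h _ _))).sub
    (Rep.sum _ fun _ => (hG.rep_Γ _ _ _).mul (h _ _))

theorem rep_lieFun (h : ∀ a, Rep (fun s => l s a) (k a)) {F : ι → Coord n → ℝ} {r : SmoothFam W}
    (hF : Rep F r) : Rep (fun s => lieFun (l s) (F s)) (hG.toDiffMetric.along k r) := by
  rw [DiffMetric.along_apply]
  exact Rep.sum _ fun _ => (h _).mul (hG.rep_d hF _)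

theorem rep_lieOne (h : ∀ a, Rep (fun s => l s a) (k a)) {A : ι → Fin n → Coord n → ℝ}
    {B : Fin n → SmoothFam W} (hA : ∀ a, Rep (fun s => A s a) (B a)) (a : Fin n) :
    Rep (fun s => lie1 (l s) (A s) a) (hG.toDiffMetric.lieOne k B a) :=
  Rep.sum _ fun _ => ((h _).mul (hG.rep_d (hA _) _)).add ((hA _).mul (hG.rep_d (h _) _))

theorem rep_lieTwo (h : ∀ a, Rep (fun s => l s a) (k a)) {A : ι → Fin n → Fin n → Coord n → ℝ}
    {B : Fin n → Fin n → SmoothFam W} (hA : ∀ a b, Rep (fun s => A s a b) (B a b)) (a b : Fin n) :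
    Rep (fun s => lie2 (l s) (A s) a b) (hG.toDiffMetric.lieTwo k B a b) :=
  Rep.sum _ fun _ => (((h _).mul (hG.rep_d (hA _ _) _)).add ((hA _ _).mul (hG.rep_d (h _) _))).add
    ((hA _ _).mul (hG.rep_d (h _) _))

theorem rep_lieFour (h : ∀ a, Rep (fun s => l s a) (k a))
    {A : ι → Fin n → Fin n → Fin n → Fin n → Coord n → ℝ}
    {B : Fin n → Fin n → Fin n → Fin n → SmoothFam W}
    (hA : ∀ a b c d, Rep (fun s => A s a b c d) (B a b c d)) (a b c d : Fin n) :
    Rep (fun s => lie4 (l s) (A s) a b c d) (hG.toDiffMetric.lieFour k B a b c d) :=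
  Rep.sum _ fun _ => (((((h _).mul (hG.rep_d (hA _ _ _ _) _)).add
    ((hA _ _ _ _).mul (hG.rep_d (h _) _))).add ((hA _ _ _ _).mul (hG.rep_d (h _) _))).add
    ((hA _ _ _ _).mul (hG.rep_d (h _) _))).add ((hA _ _ _ _).mul (hG.rep_d (h _) _))

theorem rep_unk (h : ∀ a, Rep (fun s => l s a) (k a)) (A : Fin n ⊕ Fin n × Fin n) :
    Rep (fun s => unknowns G (l s) A) (hG.toDiffMetric.unk k A) := by
  rcases A with a | ⟨a, b⟩
  · exact hG.rep_low h a
  · exact ((hG.rep_nabl (hG.rep_low h) a b).sub (hG.rep_nabl (hG.rep_low h) b a)).const_mul _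

section Null

variable {l : Fin n → Coord n → ℝ} (h : ∀ a, Rep (fun _ => l a) (k a))
include h

theorem rep_dAlong {F : Coord n → ℝ} {r : SmoothFam W} (hF : Rep (fun _ => F) r) :
    Rep (fun _ => dAlong G l F) (hG.toDiffMetric.along (hG.toDiffMetric.up k) r) :=
  hG.rep_lieFun (hG.rep_up h) hF

theorem rep_acc (b : Fin n) : Rep (fun _ => accel G l b) (hG.toDiffMetric.acc k b) :=
  Rep.sum _ fun _ => (hG.rep_up h _).mul (hG.rep_nabv (hG.rep_up h) _ _)

theorem rep_accSq : Rep (fun _ => accelSq G l) (hG.toDiffMetric.accSq k) :=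
  Rep.sum _ fun _ => Rep.sum _ fun _ =>
    ((hG.rep_G _ _).mul (hG.rep_acc h _)).mul (hG.rep_acc h _)

theorem rep_exps : Rep (fun _ => expansion G l) (hG.toDiffMetric.exps k) :=
  (Rep.sum _ fun _ => hG.rep_nabv (hG.rep_up h) _ _).const_mul _

theorem rep_ricBar : Rep (fun _ => ricciBar G l) (hG.toDiffMetric.ricBar k) :=
  Rep.sum _ fun _ => Rep.sum _ fun _ =>
    ((hG.rep_ric _ _).mul (hG.rep_up h _)).mul (hG.rep_up h _)

theorem rep_boxl : Rep (fun _ => lBoxl G l) (hG.toDiffMetric.boxl k) :=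
  Rep.sum _ fun _ => Rep.sum _ fun _ => Rep.sum _ fun _ =>
    ((hG.rep_up h _).mul (hG.rep_g _ _)).mul (hG.rep_nabl2 (hG.rep_nabl h) _ _ _)

theorem rep_delta {F : Coord n → ℝ} {r : SmoothFam W} (hF : Rep (fun _ => F) r) :
    Rep (fun _ => Delta G l F) (hG.toDiffMetric.delta k r) := by
  have he := hG.rep_exps h
  have hq : Rep (fun _ y => expansion G l y ^ 2) (hG.toDiffMetric.exps k ^ 2) := by
    simpa only [pow_two] using he.mul he
  exact (((((Rep.two.neg.mul (hG.rep_dAlong h he)).add (Rep.four.mul hq)).sub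
    (Rep.three.mul (hG.rep_ricBar h))).add (Rep.two.mul (hG.rep_boxl h))).add
    (hG.rep_dAlong h hF)).sub ((Rep.two.mul hF).mul he)

end Null

end IsMetricOn

end SmoothFamilies

end

end KerrSchild

namespace KerrSchild

/-! ### Null covectors of a Lorentz metric -/

section Lorentz

open Matrix
open scoped MatrixOrder

variable {ι : Type*} [Fintype ι] [DecidableEq ι]

/-- The plane spanned by `v = g l` and `t` contains a second null vector `N` with `l(N) = 1`. The
orthogonal complement of this plane is positive definite, so the rest of the inverse metric is a
Gram matrix `Cᵀ C`. -/
theorem exists_null_frame {G g : Matrix ι ι ℝ} (hG : Gᵀ = G) (hg : g * G = 1) {t : ι → ℝ}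
    (hpos : ∀ u, t ⬝ᵥ G *ᵥ u = 0 → u ≠ 0 → 0 < u ⬝ᵥ G *ᵥ u)
    {l : ι → ℝ} (hl : l ≠ 0) (hn : l ⬝ᵥ g *ᵥ l = 0) :
    ∃ (N : ι → ℝ) (C : Matrix ι ι ℝ), l ⬝ᵥ N = 1 ∧ (Cᵀ * C) *ᵥ l = 0 ∧
      g = Cᵀ * C + vecMulVec (g *ᵥ l) N + vecMulVec N (g *ᵥ l) := by
  have hGg : G * g = 1 := mul_eq_one_comm.1 hg
  have hgs : gᵀ = g := by
    have : gᵀ * G = 1 := by rw [← hG, ← transpose_mul, hGg, transpose_one]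
    calc gᵀ = gᵀ * (G * g) := by rw [hGg, mul_one]
      _ = g := by rw [← mul_assoc, this, one_mul]
  obtain ⟨v, hv⟩ : ∃ v, v = g *ᵥ l := ⟨_, rfl⟩
  have hGv : G *ᵥ v = l := by rw [hv, mulVec_mulVec, hGg, one_mulVec]
  have hlv : l ⬝ᵥ v = 0 := by rw [hv, hn]
  have hvl : v ⬝ᵥ l = 0 := by rw [dotProduct_comm, hlv]
  have hsym : ∀ x y, x ⬝ᵥ G *ᵥ y = y ⬝ᵥ G *ᵥ x := fun x y => by
    rw [dotProduct_mulVec, ← mulVec_transpose, hG, dotProduct_comm]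
  -- Otherwise the nonzero null vector `v` would be orthogonal to `t`, where the metric is positive.
  have hp : t ⬝ᵥ l ≠ 0 := fun h0 => by
    have h1 := hpos v (by rw [hGv, h0]) (by rintro rfl; exact hl (by rw [← hGv, mulVec_zero]))
    rw [hGv, hvl] at h1
    exact lt_irrefl _ h1
  obtain ⟨τ, hτ⟩ : ∃ τ, τ = t ⬝ᵥ G *ᵥ t := ⟨_, rfl⟩
  obtain ⟨p, hp'⟩ : ∃ p, p = t ⬝ᵥ l := ⟨_, rfl⟩
  rw [← hp'] at hp
  -- The multiple of `v` is chosen to make `N` null, and the prefactor gives `l(N) = 1`.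
  obtain ⟨N, hN⟩ : ∃ N, N = p⁻¹ • (t - (τ / (2 * p)) • v) := ⟨_, rfl⟩
  have hNl : N ⬝ᵥ l = 1 := by
    rw [hN, smul_dotProduct, sub_dotProduct, smul_dotProduct, hvl, ← hp']
    simp [hp]
  have hNN : N ⬝ᵥ G *ᵥ N = 0 := by
    rw [hN]
    simp only [mulVec_smul, mulVec_sub, hGv, smul_dotProduct, dotProduct_smul, sub_dotProduct,
      dotProduct_sub, smul_eq_mul, ← hτ, ← hp', hvl, hsym v t]
    field_simp
    ring
  have ht : t = p • N + (τ / (2 * p)) • v := by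
    rw [hN, smul_smul, mul_inv_cancel₀ hp, one_smul, sub_add_cancel]
  have hQ : (g - vecMulVec v N - vecMulVec N v).PosSemidef := by
    refine posSemidef_iff_dotProduct_mulVec.2 ⟨?_, fun x => ?_⟩
    · rw [IsHermitian, conjTranspose_eq_transpose_of_trivial, transpose_sub, transpose_sub, hgs,
        transpose_vecMulVec, transpose_vecMulVec]
      abel
    -- `w` is the raised `x` projected orthogonally to `v` and `N`, hence to `t`; the quadratic form
    -- at `x` is the metric square of `w`.
    · obtain ⟨w, hw⟩ : ∃ w, w = g *ᵥ x - (N ⬝ᵥ x) • v - (v ⬝ᵥ x) • N := ⟨_, rfl⟩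
      have h1 : G *ᵥ (g *ᵥ x) = x := by rw [mulVec_mulVec, hGg, one_mulVec]
      have h2 : ∀ z, (g *ᵥ x) ⬝ᵥ G *ᵥ z = z ⬝ᵥ x := fun z => by rw [hsym, h1]
      have hvGN : v ⬝ᵥ G *ᵥ N = 1 := by rw [hsym, hGv, hNl]
      have h3 : t ⬝ᵥ G *ᵥ w = 0 := by
        rw [ht, hw]
        simp only [mulVec_smul, mulVec_sub, hGv, smul_dotProduct, dotProduct_smul, add_dotProduct,
          dotProduct_sub, smul_eq_mul, h1, hvl, hNl, hNN, hvGN]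
        ring
      have h4 : star x ⬝ᵥ (g - vecMulVec v N - vecMulVec N v) *ᵥ x = w ⬝ᵥ G *ᵥ w := by
        rw [hw]
        have h5 : g *ᵥ x ⬝ᵥ l = v ⬝ᵥ x := by rw [← hGv, h2]
        simp only [mulVec_smul, mulVec_sub, hGv, smul_dotProduct, dotProduct_smul, sub_dotProduct,
          dotProduct_sub, smul_eq_mul, h1, h2, h5, hvl, hNl, hNN, hvGN, sub_mulVec, vecMulVec_mulVec,
          star_trivial, op_smul_eq_smul, dotProduct_comm x]
        ring
      rw [h4]
      by_cases h0 : w = 0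
      · rw [h0, zero_dotProduct]
      · exact (hpos w h3 h0).le
  obtain ⟨C, hC⟩ : ∃ C : Matrix ι ι ℝ, g - vecMulVec v N - vecMulVec N v = Cᵀ * C := by
    obtain ⟨C, hC⟩ := CStarAlgebra.nonneg_iff_eq_star_mul_self.mp hQ.nonneg
    exact ⟨C, hC⟩
  refine ⟨N, C, by rw [dotProduct_comm, hNl], ?_, ?_⟩
  · rw [← hC, sub_mulVec, sub_mulVec, vecMulVec_mulVec, vecMulVec_mulVec, ← hv, hNl, hvl]
    simp
  · rw [← hv, ← hC]
    abel

/-- In a null frame the squared length of `K` reduces to the Frobenius norm of its screen part `C K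
Cᵀ`, because `K` annihilates `v` on the right and maps it to `μ l` on the left. If that norm is
zero, only the component `μ l(N)` of the trace remains. -/
theorem trace_eq_of_trace_mul_eq_zero {G g K : Matrix ι ι ℝ} (hG : Gᵀ = G) (hg : g * G = 1)
    {t : ι → ℝ} (hpos : ∀ u, t ⬝ᵥ G *ᵥ u = 0 → u ≠ 0 → 0 < u ⬝ᵥ G *ᵥ u)
    {l : ι → ℝ} (hl : l ≠ 0) (hn : l ⬝ᵥ g *ᵥ l = 0) {μ : ℝ}
    (hK : K *ᵥ (g *ᵥ l) = 0) (hK' : (g *ᵥ l) ᵥ* K = μ • l) (h : (g * K * (g * Kᵀ)).trace = 0) :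
    (g * K).trace = μ := by
  obtain ⟨N, C, hN, hC, hgC⟩ := exists_null_frame hG hg hpos hl hn
  obtain ⟨v, hv⟩ : ∃ v, v = g *ᵥ l := ⟨_, rfl⟩
  rw [← hv] at hn hK hK' hgC
  have hCl : l ᵥ* (Cᵀ * C) = 0 := by
    rw [← mulVec_transpose, transpose_mul, transpose_transpose, hC]
  have h1 : g * K = Cᵀ * C * K + vecMulVec v (N ᵥ* K) + μ • vecMulVec N l := by
    rw [hgC, add_mul, add_mul, vecMulVec_mul, vecMulVec_mul, hK', vecMulVec_smul]
  have h2 : g * Kᵀ = Cᵀ * C * Kᵀ + vecMulVec v (K *ᵥ N) := by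
    rw [hgC, add_mul, add_mul, vecMulVec_mul, vecMulVec_mul, vecMul_transpose, vecMul_transpose, hK,
      vecMulVec_zero, add_zero]
  have h3 : (Cᵀ * C * K).trace = (C * K * Cᵀ).trace := by
    rw [mul_assoc, trace_mul_comm]
  have h4 : (N ᵥ* K) ⬝ᵥ v = 0 := by rw [← dotProduct_mulVec, hK, dotProduct_zero]
  have h5 : (C * K * Cᵀ) * (C * K * Cᵀ)ᴴ = C * (K * (Cᵀ * C) * Kᵀ * Cᵀ) := by
    simp only [conjTranspose_eq_transpose_of_trivial, transpose_mul, transpose_transpose, mul_assoc]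
  have h6 : C * K * Cᵀ = 0 := by
    have h7 : (C * (K * (Cᵀ * C) * Kᵀ * Cᵀ)).trace = (Cᵀ * C * K * (Cᵀ * C * Kᵀ)).trace := by
      rw [trace_mul_comm, mul_assoc, trace_mul_comm]
      simp only [mul_assoc]
    rw [← trace_mul_conjTranspose_self_eq_zero_iff, h5, h7, ← h, h1, h2]
    have h8 : (N ᵥ* K) ᵥ* (Cᵀ * C * Kᵀ) = (N ᵥ* K ᵥ* (Cᵀ * C)) ᵥ* Kᵀ := by
      simp only [vecMul_vecMul, mul_assoc]
    have h9 : v ⬝ᵥ ((N ᵥ* K ᵥ* (Cᵀ * C)) ᵥ* Kᵀ) = 0 := by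
      rw [vecMul_transpose, dotProduct_mulVec, hK', smul_dotProduct, dotProduct_comm,
        ← dotProduct_mulVec, hC, dotProduct_zero, smul_zero]
    have h10 : l ᵥ* (Cᵀ * C * Kᵀ) = 0 := by rw [← vecMul_vecMul, hCl, zero_vecMul]
    have h11 : (Cᵀ * C * K) *ᵥ v = 0 := by rw [← mulVec_mulVec, hK, mulVec_zero]
    rw [add_mul, add_mul, mul_add, mul_add, mul_add, vecMulVec_mul, h8,
      vecMulVec_mul_vecMulVec, h4, smul_mul_assoc, smul_mul_assoc, vecMulVec_mul, h10,
      vecMulVec_mul_vecMulVec, hn, mul_vecMulVec, h11]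
    simp only [trace_add, trace_vecMulVec, h9, vecMulVec_zero, zero_vecMulVec, smul_zero, zero_smul,
      add_zero]
  have h7 : (Cᵀ * C * K).trace = 0 := by rw [h3, h6, trace_zero]
  rw [h1, trace_add, trace_add, h7, trace_vecMulVec, trace_smul, trace_vecMulVec,
    dotProduct_comm v, h4, dotProduct_comm N, hN]
  simp

end Lorentz

end KerrSchild

namespace KerrSchild

noncomputable section

/-! ### The components of tensor fields in a chart -/

section Charts

open Matrix

variable {n : ℕ} {M : Type*} [TopologicalSpace M] [ChartedSpace (Coord n) M]

/-- The tangent vector with given components in a chart. -/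
def ofComp (φ : OpenPartialHomeomorph M (Coord n)) (y : Coord n) :
    (Fin n → ℝ) →ₗ[ℝ] TangentSpace (𝓡 n) (φ.symm y) :=
  (mfderiv (𝓡 n) (𝓡 n) φ.symm y).toLinearMap.comp (WithLp.linearEquiv 2 ℝ (Fin n → ℝ)).symm.toLinearMap

theorem ofComp_apply (φ : OpenPartialHomeomorph M (Coord n)) (y : Coord n) (u : Fin n → ℝ) :
    ofComp φ y u = ∑ i, u i • coordVec φ y i := by
  rw [LinearMap.pi_apply_eq_sum_univ]
  refine Finset.sum_congr rfl fun i _ => congrArg _ ?_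
  have : (fun j => if i = j then 1 else 0 : Fin n → ℝ) = Pi.single i 1 := by
    ext j; simp [Pi.single_apply, eq_comm]
  rw [this]
  rfl

theorem bijective_ofComp [IsManifold (𝓡 n) ∞ M] {φ : OpenPartialHomeomorph M (Coord n)}
    (hφ : φ ∈ charts n M) {y : Coord n} (hy : y ∈ φ.target) : Function.Bijective (ofComp φ y) := by
  have h1 : φ.MDifferentiable (𝓡 n) (𝓡 n) :=
    ⟨(contMDiffOn_of_mem_maximalAtlas hφ).mdifferentiableOn (by simp),
      (contMDiffOn_symm_of_mem_maximalAtlas hφ).mdifferentiableOn (by simp)⟩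
  exact (h1.symm.mfderiv_bijective hy).comp (WithLp.linearEquiv 2 ℝ (Fin n → ℝ)).symm.bijective

theorem form_ofComp (φ : OpenPartialHomeomorph M (Coord n)) (y : Coord n)
    (l : ∀ x : M, TangentSpace (𝓡 n) x →ₗ[ℝ] ℝ) (u : Fin n → ℝ) :
    l (φ.symm y) (ofComp φ y u) = u ⬝ᵥ fun a => comp1 φ l a y := by
  simp only [ofComp_apply, map_sum, map_smul, dotProduct, comp1, smul_eq_mul]

/-- The matrix of the components of a tensor field with two lower indices. -/
def gram (φ : OpenPartialHomeomorph M (Coord n))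
    (T : ∀ x : M, TangentSpace (𝓡 n) x →ₗ[ℝ] TangentSpace (𝓡 n) x →ₗ[ℝ] ℝ) (y : Coord n) :
    Matrix (Fin n) (Fin n) ℝ := of fun a b => comp2 φ T a b y

theorem bilin_ofComp (φ : OpenPartialHomeomorph M (Coord n)) (y : Coord n)
    (T : ∀ x : M, TangentSpace (𝓡 n) x →ₗ[ℝ] TangentSpace (𝓡 n) x →ₗ[ℝ] ℝ) (u w : Fin n → ℝ) :
    T (φ.symm y) (ofComp φ y u) (ofComp φ y w) = u ⬝ᵥ gram φ T y *ᵥ w := by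
  simp only [ofComp_apply, map_sum, map_smul, LinearMap.sum_apply, LinearMap.smul_apply, dotProduct,
    gram, comp2, smul_eq_mul, mulVec, of_apply, Finset.mul_sum]
  rw [Finset.sum_comm]
  exact Finset.sum_congr rfl fun a _ => Finset.sum_congr rfl fun b _ => by ring

variable [IsManifold (𝓡 n) ∞ M] {φ : OpenPartialHomeomorph M (Coord n)} (hφ : φ ∈ charts n M)
  {y : Coord n} (hy : y ∈ φ.target)
include hφ hy

theorem LorentzMetric.exists_timelike (g : LorentzMetric n M) : ∃ t : Fin n → ℝ,
    ∀ u, t ⬝ᵥ gram φ g.val y *ᵥ u = 0 → u ≠ 0 → 0 < u ⬝ᵥ gram φ g.val y *ᵥ u := by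
  obtain ⟨t, -, ht⟩ := g.lorentz (φ.symm y)
  obtain ⟨t, rfl⟩ := (bijective_ofComp hφ hy).2 t
  refine ⟨t, fun u hu hu0 => ?_⟩
  rw [← bilin_ofComp] at hu ⊢
  exact ht _ hu fun h => hu0 ((bijective_ofComp hφ hy).1 (h.trans (map_zero _).symm))

theorem LorentzMetric.det_gram_ne_zero (g : LorentzMetric n M) : (gram φ g.val y).det ≠ 0 := by
  intro h
  obtain ⟨u, hu, h⟩ := exists_mulVec_eq_zero_iff.2 h
  obtain ⟨t, ht⟩ := g.exists_timelike hφ hy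
  have := ht u (by rw [h, dotProduct_zero]) hu
  rw [h, dotProduct_zero] at this
  exact lt_irrefl _ this

variable {g : LorentzMetric n M} {l : ∀ x : M, TangentSpace (𝓡 n) x →ₗ[ℝ] ℝ} (hl : IsNullForm g l)
include hl

theorem IsNullForm.comp1_ne_zero : (fun a => comp1 φ l a y) ≠ 0 := by
  intro h
  refine hl.ne_zero (φ.symm y) (LinearMap.ext fun v => ?_)
  obtain ⟨u, rfl⟩ := (bijective_ofComp hφ hy).2 v
  rw [form_ofComp, h, dotProduct_zero, LinearMap.zero_apply]

theorem IsNullForm.sum_mul_raise :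
    ∑ a, comp1 φ l a y * raise (comp2 φ g.val) (comp1 φ l) a y = 0 := by
  obtain ⟨v, hv, hvv⟩ := hl.null (φ.symm y)
  obtain ⟨u, rfl⟩ := (bijective_ofComp hφ hy).2 v
  have h1 : gram φ g.val y *ᵥ u = fun a => comp1 φ l a y := by
    refine dotProduct_eq _ _ fun w => ?_
    rw [dotProduct_comm, ← bilin_ofComp, g.symm, hv, form_ofComp, dotProduct_comm]
  have h2 : (fun a => raise (comp2 φ g.val) (comp1 φ l) a y) = u := by
    have : (fun a => raise (comp2 φ g.val) (comp1 φ l) a y)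
      = (gram φ g.val y)⁻¹ *ᵥ fun a => comp1 φ l a y := rfl
    rw [this, ← h1, mulVec_mulVec,
      nonsing_inv_mul _ (isUnit_iff_ne_zero.2 (g.det_gram_ne_zero hφ hy)), one_mulVec]
  have h3 : (fun a => comp1 φ l a y) ⬝ᵥ (fun a => raise (comp2 φ g.val) (comp1 φ l) a y) = 0 := by
    rw [h2, ← h1, dotProduct_comm, ← bilin_ofComp, hvv]
  exact h3

end Charts

/-! ### Smooth functions in a chart, and the zero solution. -/

section Charts

variable {n : ℕ} {M : Type*} [TopologicalSpace M] [ChartedSpace (Coord n) M]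
  {φ : OpenPartialHomeomorph M (Coord n)}

theorem contDiffOn_comp_symm (hφ : φ ∈ charts n M) {U : Set M} {f : M → ℝ}
    (hf : ContMDiffOn (𝓡 n) 𝓘(ℝ, ℝ) ∞ f U) :
    ContDiffOn ℝ ∞ (fun y => f (φ.symm y)) (φ.target ∩ φ.symm ⁻¹' U) := by
  rw [← contMDiffOn_iff_contDiffOn]
  exact hf.comp ((contMDiffOn_symm_of_mem_maximalAtlas hφ).mono Set.inter_subset_left)
    fun y hy => hy.2

/-- The zero field supplies a member of the family whose coordinate domain is the whole chart
target. -/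
theorem isKerrSchild_zero (g : LorentzMetric n M) (l : ∀ x : M, TangentSpace (𝓡 n) x →ₗ[ℝ] ℝ) :
    IsKerrSchild g l Set.univ 0 0 0 := by
  have h : ∀ φ : OpenPartialHomeomorph M (Coord n), ∀ i,
      compVec φ (0 : ∀ x : M, TangentSpace (𝓡 n) x) i = fun _ => 0 := fun φ i => by
    ext y
    exact map_zero (EuclideanSpace.proj i ∘L mfderiv (𝓡 n) (𝓡 n) φ (φ.symm y))
  have h' : ∀ (i : Fin n) (y : Coord n), pd i (fun _ => (0 : ℝ)) y = 0 := fun i y => by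
    simp [pd]
  refine ⟨isOpen_univ, fun φ _ i => by rw [h]; exact contDiffOn_const, contMDiffOn_const,
    contMDiffOn_const, fun φ _ y _ a b => ?_, fun φ _ y _ a => ?_⟩
  · simp [lie2, h, h']
  · simp [lie1, h, h']

end Charts

end

end KerrSchild

namespace KerrSchild

noncomputable section

/-! ### Isolating the gauge -/

namespace DiffMetric

open Matrix

variable {n : ℕ} {R : Type*} [CommRing R] [Algebra ℝ R] {T : DiffMetric n R} {l : Fin n → R}
  {Mf : R}

/-- Pointwise use of `trace_eq_of_trace_mul_eq_zero` with `K = ∇l`: nullity gives the right kernel,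
and the geodesic equation gives `μ = M`. -/
theorem map_dvg_eq (ev : R →+* ℝ) (hn : ∑ a, l a * T.up l a = 0)
    (hg : ∀ a, T.acc l a = Mf * T.up l a) {t : Fin n → ℝ}
    (ht : ∀ u, t ⬝ᵥ (of T.G).map ev *ᵥ u = 0 → u ≠ 0 → 0 < u ⬝ᵥ (of T.G).map ev *ᵥ u)
    (hl : (fun a => ev (l a)) ≠ 0) (h : ev (T.normSq l) = 0) : ev (T.dvg l) = ev Mf := by
  have hup : (of T.g).map ev *ᵥ (fun a => ev (l a)) = fun a => ev (T.up l a) := by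
    ext a
    simp only [mulVec, dotProduct, map_apply, of_apply, up, map_sum, map_mul]
  have h1 : ev (T.dvg l) = ((of T.g).map ev * (of (T.nabl l)).map ev).trace := by
    rw [← sum_nablT]
    simp only [nablT, up, trace, diag_apply, mul_apply, map_apply, of_apply, map_sum, map_mul]
  rw [h1]
  refine trace_eq_of_trace_mul_eq_zero (G := (of T.G).map ev) ?_ ?_ ht hl ?_ ?_ ?_ ?_
  · ext a b
    exact congrArg ev (T.G_symm b a)
  · ext a b
    have := congrArg ev (T.g_mul_G a b)
    simpa [mul_apply, one_apply, apply_ite ev] using this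
  · rw [hup]
    simpa [dotProduct] using congrArg ev hn
  · rw [hup]
    ext c
    simpa [mulVec, dotProduct] using congrArg ev (T.nabl_mul_up hn c)
  · rw [hup]
    ext c
    simpa [vecMul, dotProduct] using congrArg ev (sum_up_mul_nabl hg c)
  · rw [← h, normSq]
    simp only [nablT, nabv_up, up, trace, diag_apply, mul_apply, map_apply, of_apply, map_sum,
      map_mul, transpose_apply]

/-- Vanishing of `|∇l|²` at a point forces `f = ∇·l - M` to vanish there. This alone says nothing
about `Df`, which is why a third factor is needed. -/
theorem sum_sq_gauge_factors_ne_zero (ev : R →+* ℝ) (hn : ∑ a, l a * T.up l a = 0)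
    (hg : ∀ a, T.acc l a = Mf * T.up l a) {t : Fin n → ℝ}
    (ht : ∀ u, t ⬝ᵥ (of T.G).map ev *ᵥ u = 0 → u ≠ 0 → 0 < u ⬝ᵥ (of T.G).map ev *ᵥ u)
    (hl : (fun a => ev (l a)) ≠ 0) (hΔ : ev (T.delta l Mf) ≠ 0) (q : R) :
    ev ((T.delta l Mf + 2 * T.ricBar l) ^ 2 + T.normSq l ^ 2
      + ((2 * T.along (T.up l) (T.dvg l - Mf) - 2 * ((T.dvg l - Mf) * Mf))
        * (T.along (T.up l) (T.dvg l - Mf) + (T.dvg l - Mf) * Mf) + (T.dvg l - Mf) * q) ^ 2)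
      ≠ 0 := by
  intro h
  rw [map_add, map_add, map_pow, map_pow, map_pow] at h
  have h1 : ev (T.delta l Mf + 2 * T.ricBar l) = 0 := by nlinarith
  have h2 : ev (T.normSq l) = 0 := by nlinarith
  rw [h1, h2] at h
  have h3 := map_dvg_eq ev hn hg ht hl h2
  have h4 : ev (T.dvg l - Mf) = 0 := by rw [map_sub, h3, sub_self]
  -- Where `f = 0` the third factor is `2 (Df)²`, whatever `q` is.
  have h5 : ev (T.along (T.up l) (T.dvg l - Mf)) = 0 := by
    simp only [map_add, map_mul, map_sub ev (2 * _), h4, map_ofNat, zero_mul, mul_zero, sub_zero, add_zero] at h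
    simpa using h
  have h6 : T.delta l Mf + 2 * T.ricBar l = - T.along (T.up l) (T.dvg l - Mf)
      + T.dvg l * (T.dvg l - Mf) - T.ricBar l - 2 * T.normSq l := by
    rw [delta_eq hn, map_sub]
    ring
  have h7 := congrArg ev h6
  rw [h1] at h7
  simp only [map_add, map_mul, map_sub ev (_ - _), map_sub ev (_ + _), map_neg, h2, h4, h5] at h7
  rw [map_add, map_mul] at h1
  have h8 : ev (T.ricBar l) = 0 := by linarith
  rw [h8] at h1
  exact hΔ (by linarith)

theorem IsDataAlg.gauge_mem_of_accSq {S : Subalgebra ℝ R} {X : Fin n → R} {h : R}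
    (H : T.IsDataAlg S l) (hX : ∀ a b, T.lieTwo X T.G a b = 2 * h * l a * l b)
    (ha : ∃ q ∈ S, T.accSq l * q = 1) : h ∈ T.lin S X := by
  obtain ⟨q, hq, hq1⟩ := ha
  have := mul_mem_submodule hq (H.accSq_mul_gauge_mem hX)
  rwa [← mul_assoc, mul_comm q, hq1, one_mul] at this

end DiffMetric

/-! ### Solutions in a chart -/

section Solutions

open TopologicalSpace

variable {n : ℕ} {M : Type*} [TopologicalSpace M] [ChartedSpace (Coord n) M]

/-- A Kerr-Schild vector field together with its domain and its gauges. -/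
structure Solution (g : LorentzMetric n M) (l : ∀ x : M, TangentSpace (𝓡 n) x →ₗ[ℝ] ℝ) where
  U : Set M
  X : ∀ x : M, TangentSpace (𝓡 n) x
  h : M → ℝ
  m : M → ℝ
  isKerrSchild : IsKerrSchild g l U X h m

variable {g : LorentzMetric n M} {l : ∀ x : M, TangentSpace (𝓡 n) x →ₗ[ℝ] ℝ}
  {φ : OpenPartialHomeomorph M (Coord n)}

variable (g l φ) in
/-- The coordinate domains of all solutions. -/
def solDom (s : Solution g l) : Opens (Coord n) :=
  ⟨φ.target ∩ φ.symm ⁻¹' s.U, φ.isOpen_inter_preimage_symm s.isKerrSchild.isOpen⟩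

theorem mem_target {s : Solution g l} {y : Coord n} (hy : y ∈ solDom g l φ s) : y ∈ φ.target := hy.1

/-- The zero vector field as a solution on the whole manifold. -/
def Solution.zero : Solution g l := ⟨Set.univ, 0, 0, 0, isKerrSchild_zero g l⟩

theorem mem_solDom_zero {y : Coord n} (hy : y ∈ φ.target) :
    y ∈ solDom g l φ Solution.zero := ⟨hy, trivial⟩

/-- A family with agreeing members is represented by its member at the zero solution, defined on the
whole chart target. -/
theorem rep_of_mem_constFam {r : SmoothFam (solDom g l φ)} (hr : r ∈ constFam (solDom g l φ)) :
    Rep (fun _ => extZero (solDom g l φ) r.1 Solution.zero) r := fun s y hy => by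
  have hy0 := mem_solDom_zero (g := g) (l := l) (mem_target hy)
  dsimp only
  rw [extZero_apply _ hy0, hr _ s y hy0 hy]

variable (hφ : φ ∈ charts n M)

/-- The null covector field over the ring. -/
def solForm (hl : IsNullForm g l) (a : Fin n) : SmoothFam (solDom g l φ) :=
  mkFam (fun _ => comp1 φ l a) fun _ => (hl.smooth φ hφ a).mono Set.inter_subset_left

/-- The vector fields of all solutions as one vector field over the ring. -/
def solVec (a : Fin n) : SmoothFam (solDom g l φ) :=
  mkFam (fun s => compVec φ s.X a) fun s => s.isKerrSchild.smooth φ hφ a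

/-- The gauges `h` of all solutions as one element of the ring. -/
def solGauge : SmoothFam (solDom g l φ) :=
  mkFam (fun s y => s.h (φ.symm y)) fun s => contDiffOn_comp_symm hφ s.isKerrSchild.smooth_h

/-- The gauges `m` of all solutions as one element of the ring. -/
def solGaugeForm : SmoothFam (solDom g l φ) :=
  mkFam (fun s y => s.m (φ.symm y)) fun s => contDiffOn_comp_symm hφ s.isKerrSchild.smooth_m

/-- A function on the manifold as an element of the ring. -/
def solFun {f : M → ℝ} (hf : ContMDiff (𝓡 n) 𝓘(ℝ, ℝ) ∞ f) : SmoothFam (solDom g l φ) :=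
  mkFam (fun _ y => f (φ.symm y)) fun _ => contDiffOn_comp_symm hφ hf.contMDiffOn

theorem rep_solForm (hl : IsNullForm g l) (a : Fin n) :
    Rep (fun _ => comp1 φ l a) (solForm hφ hl a) := Rep.mk _

theorem rep_solVec (a : Fin n) :
    Rep (fun s => compVec φ s.X a) (solVec hφ a : SmoothFam (solDom g l φ)) := Rep.mk _

theorem rep_solGauge :
    Rep (fun s y => s.h (φ.symm y)) (solGauge hφ : SmoothFam (solDom g l φ)) := Rep.mk _

theorem rep_solGaugeForm :
    Rep (fun s y => s.m (φ.symm y)) (solGaugeForm hφ : SmoothFam (solDom g l φ)) := Rep.mk _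

theorem rep_solFun {f : M → ℝ} (hf : ContMDiff (𝓡 n) 𝓘(ℝ, ℝ) ∞ f) :
    Rep (fun _ y => f (φ.symm y)) (solFun hφ hf : SmoothFam (solDom g l φ)) := Rep.mk _

variable [IsManifold (𝓡 n) ∞ M]

theorem isMetricOn_solDom (hφ : φ ∈ charts n M) :
    IsMetricOn (solDom g l φ) (comp2 φ g.val) where
  smooth _ a b := (g.smooth φ hφ a b).mono Set.inter_subset_left
  symm _ _ _ _ _ := g.symm _ _ _
  det_ne_zero _ _ hy := g.det_gram_ne_zero hφ hy.1

variable (g l) in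
/-- The metric over the ring of families of functions on the domains of the solutions. -/
def solMetric : DiffMetric n (SmoothFam (solDom g l φ)) := (isMetricOn_solDom hφ).toDiffMetric

theorem lieTwo_sol (hl : IsNullForm g l) (a b : Fin n) :
    (solMetric g l hφ).lieTwo (solVec hφ) (solMetric g l hφ).G a b
      = 2 * solGauge hφ * solForm hφ hl a * solForm hφ hl b :=
  ((isMetricOn_solDom hφ).rep_lieTwo (rep_solVec hφ) (isMetricOn_solDom hφ).rep_G a b).of_eq
    (((Rep.two.mul (rep_solGauge hφ)).mul (rep_solForm hφ hl a)).mul (rep_solForm hφ hl b))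
    fun s y hy => s.isKerrSchild.lie_metric φ hφ y hy a b

theorem lieOne_sol (hl : IsNullForm g l) (a : Fin n) :
    (solMetric g l hφ).lieOne (solVec hφ) (solForm hφ hl) a
      = solGaugeForm hφ * solForm hφ hl a :=
  ((isMetricOn_solDom hφ).rep_lieOne (rep_solVec hφ) (rep_solForm hφ hl) a).of_eq
    ((rep_solGaugeForm hφ).mul (rep_solForm hφ hl a))
    fun s y hy => s.isKerrSchild.lie_form φ hφ y hy a

theorem acc_sol (hl : IsNullForm g l) {Mf : M → ℝ} (hM : Geodesic g l Mf) (a : Fin n) :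
    (solMetric g l hφ).acc (solForm hφ hl) a
      = solFun hφ hM.1 * (solMetric g l hφ).up (solForm hφ hl) a :=
  ((isMetricOn_solDom hφ).rep_acc (rep_solForm hφ hl) a).of_eq
    ((rep_solFun hφ hM.1).mul ((isMetricOn_solDom hφ).rep_up (rep_solForm hφ hl) a))
    fun _ y hy => hM.2 φ hφ y hy.1 a

theorem isDataAlg_sol (hl : IsNullForm g l) :
    (solMetric g l hφ).IsDataAlg (constFam (solDom g l φ)) (solForm hφ hl) where
  d_mem i _ hf := pdDer_mem_constFam i hf
  G_mem a b := ((isMetricOn_solDom hφ).rep_G a b).mem_constFam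
  g_mem a b := ((isMetricOn_solDom hφ).rep_g a b).mem_constFam
  l_mem a := (rep_solForm hφ hl a).mem_constFam
  exists_dual := by
    have hm := fun a => (rep_solForm hφ hl a).mem_constFam
    -- The dual vector has components `l_a / ∑ l_b²`; this coordinate sum of squares vanishes
    -- nowhere because `l` does not.
    obtain ⟨q, hq, h⟩ := exists_mul_eq_one
      (f := ∑ a, solForm hφ hl a * solForm hφ hl a)
      (sum_mem fun a _ => mul_mem (hm a) (hm a)) fun s y hy h0 => by
        rw [← Rep.sum _ (fun a => (rep_solForm hφ hl a).mul (rep_solForm hφ hl a)) s y hy] at h0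
        exact hl.comp1_ne_zero hφ hy.1 (dotProduct_self_eq_zero.1 h0)
    refine ⟨fun a => q * solForm hφ hl a, fun a => mul_mem hq (hm a), ?_⟩
    simp only [mul_assoc, ← Finset.mul_sum]
    rw [mul_comm, h]
  null := (Rep.sum _ fun a => (rep_solForm hφ hl a).mul
    ((isMetricOn_solDom hφ).rep_up (rep_solForm hφ hl) a)).of_eq Rep.zero
      fun s y hy => hl.sum_mul_raise hφ hy.1

/-- Membership in the span over `constFam` unfolds to coefficients common to all solutions; read off
at the zero solution, they are smooth on the whole chart target. -/
theorem exists_coeff {F : Solution g l → Coord n → ℝ} {r : SmoothFam (solDom g l φ)}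
    (hF : Rep F r) (hr : r ∈ (solMetric g l hφ).lin (constFam (solDom g l φ)) (solVec hφ)) :
    ∃ c : Fin n ⊕ Fin n × Fin n → Coord n → ℝ, (∀ A, ContDiffOn ℝ ∞ (c A) φ.target) ∧
      ∀ s, ∀ y ∈ solDom g l φ s,
        F s y = ∑ A, c A y * unknowns (comp2 φ g.val) (compVec φ s.X) A y := by
  obtain ⟨c, hc⟩ := (Submodule.mem_span_range_iff_exists_fun _).1 hr
  refine ⟨fun A => extZero _ (c A).1.1 Solution.zero, fun A =>
    (SmoothFam.contDiffOn (c A).1 Solution.zero).mono fun y hy => mem_solDom_zero hy, fun s y hy => ?_⟩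
  exact hF.eq_of_eq (Rep.sum _ fun A => (rep_of_mem_constFam (c A).2).mul
    ((isMetricOn_solDom hφ).rep_unk (rep_solVec hφ) A)) hc.symm hy

theorem systemClosed_of_gauge_mem (hl : IsNullForm g l)
    (H : ∀ (φ : OpenPartialHomeomorph M (Coord n)) (hφ : φ ∈ charts n M), solGauge hφ
      ∈ (solMetric g l hφ).lin (constFam (solDom g l φ)) (solVec hφ)) : SystemClosed g l := by
  intro φ hφ
  obtain ⟨c, hc, hc'⟩ := exists_coeff hφ (rep_solGauge hφ) (H φ hφ)
  choose K hK hK' using fun k A => exists_coeff hφ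
    ((isMetricOn_solDom hφ).rep_d ((isMetricOn_solDom hφ).rep_unk (rep_solVec hφ) A) k)
    ((isDataAlg_sol hφ hl).d_unk_mem (lieTwo_sol hφ hl) (H φ hφ) k A)
  exact ⟨c, K, hc, hK, fun U X h m hs y hy =>
    ⟨hc' ⟨U, X, h, m, hs⟩ y hy, fun k A => hK' k A ⟨U, X, h, m, hs⟩ y hy⟩⟩

theorem systemClosed_of_nonGeodesic (hl : IsNullForm g l) (ha : NonGeodesic g l) :
    SystemClosed g l := systemClosed_of_gauge_mem hl fun φ hφ => by
  have H := isDataAlg_sol hφ hl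
  refine H.gauge_mem_of_accSq (lieTwo_sol hφ hl) (exists_mul_eq_one H.accSq_mem fun s y hy h0 => ?_)
  exact ha φ hφ y hy.1
    (((isMetricOn_solDom hφ).rep_accSq (rep_solForm hφ hl) s y hy).trans h0)

theorem systemClosed_of_geodesic (hl : IsNullForm g l) {Mf : M → ℝ} (hM : Geodesic g l Mf)
    (hΔ : DeltaNeZero g l Mf) : SystemClosed g l := systemClosed_of_gauge_mem hl fun φ hφ => by
  have H := isDataAlg_sol hφ hl
  have hMS := (rep_solFun (g := g) (l := l) hφ hM.1).mem_constFam
  obtain ⟨h1, h2, q, hq, h3⟩ :=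
    H.gauge_factors (lieTwo_sol hφ hl) hMS (acc_sol hφ hl hM) (lieOne_sol hφ hl)
  set T := solMetric g l hφ
  set k := solForm hφ hl
  -- No single factor need be invertible. Multiplying each relation by its own factor and adding
  -- leaves one coefficient of the gauge, a sum of squares that vanishes nowhere.
  have hmem : ∀ c ∈ constFam (solDom g l φ), c * solGauge hφ ∈ T.lin (constFam _) (solVec hφ) →
      c ^ 2 * solGauge hφ ∈ T.lin (constFam _) (solVec hφ) := fun c hc h => by
    rw [pow_two, mul_assoc]
    exact DiffMetric.mul_mem_submodule hc h
  have hf := (constFam (solDom g l φ)).sub_mem H.dvg_mem hMS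
  have hf' := H.along_mem hf
  have hdS : T.delta k (solFun hφ hM.1) + 2 * T.ricBar k ∈ constFam (solDom g l φ) :=
    add_mem (((isMetricOn_solDom hφ).rep_delta (rep_solForm hφ hl)
      (rep_solFun hφ hM.1)).mem_constFam) (mul_mem (ofNat_mem _ 2) H.ricBar_mem)
  have hqS := add_mem (mul_mem (sub_mem (mul_mem (ofNat_mem (constFam (solDom g l φ)) 2) hf')
    (mul_mem (ofNat_mem _ 2) (mul_mem hf hMS))) (add_mem hf' (mul_mem hf hMS))) (mul_mem hf hq)
  have hsum := add_mem (add_mem (hmem _ hdS h1) (hmem _ H.normSq_mem h2)) (hmem _ hqS h3)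
  rw [← add_mul, ← add_mul] at hsum
  obtain ⟨e, he, he1⟩ := exists_mul_eq_one (add_mem (add_mem (pow_mem hdS 2)
    (pow_mem H.normSq_mem 2)) (pow_mem hqS 2)) fun s y hy => by
      obtain ⟨t, ht⟩ := g.exists_timelike hφ hy.1
      refine DiffMetric.sum_sq_gauge_factors_ne_zero (evalFam ⟨s, y, hy⟩) H.null
        (acc_sol hφ hl hM) ht (hl.comp1_ne_zero hφ hy.1) (fun h0 => ?_) q
      exact hΔ φ hφ y hy.1 (((isMetricOn_solDom hφ).rep_delta (rep_solForm hφ hl)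
        (rep_solFun hφ hM.1) s y hy).trans h0)
  have := DiffMetric.mul_mem_submodule he hsum
  rwa [← mul_assoc, mul_comm e, he1, one_mul] at this

include hφ

theorem gauge_eq_of_nonGeodesic (hl : IsNullForm g l) (ha : NonGeodesic g l) (s : Solution g l)
    {y : Coord n} (hy : y ∈ solDom g l φ s) :
    s.h (φ.symm y) =
      -(∑ a, ∑ b, raise (comp2 φ g.val) (comp1 φ l) a y
          * raise (comp2 φ g.val) (comp1 φ l) b y
          * lie2 (compVec φ s.X) (ricci (comp2 φ g.val)) a b y)
        / (2 * accelSq (comp2 φ g.val) (comp1 φ l) y) := by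
  have hG := isMetricOn_solDom (g := g) (l := l) hφ
  have hu := hG.rep_up (rep_solForm hφ hl)
  have h := (Rep.sum Finset.univ fun a => Rep.sum Finset.univ fun b => ((hu a).mul (hu b)).mul
    (hG.rep_lieTwo (rep_solVec hφ) hG.rep_ric a b)).eq_of_eq
    ((Rep.two.neg.mul (rep_solGauge hφ)).mul (hG.rep_accSq (rep_solForm hφ hl)))
    (DiffMetric.lieTwo_ric_mul_up_up (isDataAlg_sol hφ hl).null (lieTwo_sol hφ hl)) hy
  have h0 := ha φ hφ y hy.1
  rw [h]
  field_simp

theorem delta_mul_gauge (hl : IsNullForm g l) {Mf : M → ℝ} (hM : Geodesic g l Mf)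
    (s : Solution g l) {y : Coord n} (hy : y ∈ solDom g l φ s) (a b : Fin n) :
    2 * Delta (comp2 φ g.val) (comp1 φ l) (fun z => Mf (φ.symm z)) y
        * (s.h (φ.symm y) * comp1 φ l a y * comp1 φ l b y) =
      lieFun (compVec φ s.X) (scalarCurv (comp2 φ g.val)) y * comp1 φ l a y * comp1 φ l b y
      - 2 * ∑ c, (lie2 (compVec φ s.X) (ricci (comp2 φ g.val)) c a y * comp1 φ l b y
            + lie2 (compVec φ s.X) (ricci (comp2 φ g.val)) c b y * comp1 φ l a y)
          * raise (comp2 φ g.val) (comp1 φ l) c y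
      - 2 * ∑ c, ∑ d, lie4 (compVec φ s.X) (riemannLow (comp2 φ g.val)) a c b d y
          * raise (comp2 φ g.val) (comp1 φ l) c y
          * raise (comp2 φ g.val) (comp1 φ l) d y := by
  have hG := isMetricOn_solDom (g := g) (l := l) hφ
  have hr := rep_solForm (g := g) hφ hl
  have hv := rep_solVec (g := g) (l := l) hφ
  have hu := hG.rep_up hr
  have hric := hG.rep_lieTwo hv hG.rep_ric
  exact ((Rep.two.mul (hG.rep_delta hr (rep_solFun hφ hM.1))).mul
    (((rep_solGauge hφ).mul (hr a)).mul (hr b))).eq_of_eq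
    (((((hG.rep_lieFun hv hG.rep_scal).mul (hr a)).mul (hr b)).sub (Rep.two.mul (Rep.sum _ fun c =>
      (((hric c a).mul (hr b)).add ((hric c b).mul (hr a))).mul (hu c)))).sub
      (Rep.two.mul (Rep.sum _ fun c => Rep.sum _ fun d =>
        ((hG.rep_lieFour hv hG.rep_riemLow a c b d).mul (hu c)).mul (hu d))))
    (DiffMetric.delta_mul (isDataAlg_sol hφ hl).null (lieTwo_sol hφ hl) (acc_sol hφ hl hM) a b) hy

end Solutions

end

end KerrSchild
theorem mainTheorem2 {n : ℕ} {M : Type*} [TopologicalSpace M] [ChartedSpace (Coord n) M]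
    [IsManifold (𝓡 n) ∞ M] (g : LorentzMetric n M)
    (l : ∀ x : M, TangentSpace (𝓡 n) x →ₗ[ℝ] ℝ) (hl : IsNullForm g l) :
    (NonGeodesic g l →
      SystemClosed g l ∧
      ∀ (U : Set M) (X : ∀ x : M, TangentSpace (𝓡 n) x) (h m : M → ℝ),
        IsKerrSchild g l U X h m →
        ∀ φ ∈ charts n M, ∀ y ∈ φ.target ∩ φ.symm ⁻¹' U,
          h (φ.symm y) =
            -(∑ a, ∑ b, raise (comp2 φ g.val) (comp1 φ l) a y
                * raise (comp2 φ g.val) (comp1 φ l) b y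
                * lie2 (compVec φ X) (ricci (comp2 φ g.val)) a b y)
              / (2 * accelSq (comp2 φ g.val) (comp1 φ l) y)) ∧
    (∀ Mf : M → ℝ, Geodesic g l Mf →
      (DeltaNeZero g l Mf → SystemClosed g l) ∧
      ∀ (U : Set M) (X : ∀ x : M, TangentSpace (𝓡 n) x) (h m : M → ℝ),
        IsKerrSchild g l U X h m →
        ∀ φ ∈ charts n M, ∀ y ∈ φ.target ∩ φ.symm ⁻¹' U, ∀ a b,
          2 * Delta (comp2 φ g.val) (comp1 φ l) (fun z => Mf (φ.symm z)) y
              * (h (φ.symm y) * comp1 φ l a y * comp1 φ l b y) =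
            lieFun (compVec φ X) (scalarCurv (comp2 φ g.val)) y * comp1 φ l a y * comp1 φ l b y
            - 2 * ∑ c, (lie2 (compVec φ X) (ricci (comp2 φ g.val)) c a y * comp1 φ l b y
                  + lie2 (compVec φ X) (ricci (comp2 φ g.val)) c b y * comp1 φ l a y)
                * raise (comp2 φ g.val) (comp1 φ l) c y
            - 2 * ∑ c, ∑ d, lie4 (compVec φ X) (riemannLow (comp2 φ g.val)) a c b d y
                * raise (comp2 φ g.val) (comp1 φ l) c y
                * raise (comp2 φ g.val) (comp1 φ l) d y) := by
  exact ⟨fun ha => ⟨systemClosed_of_nonGeodesic hl ha, fun U X h m hs φ hφ y hy =>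
      gauge_eq_of_nonGeodesic hφ hl ha ⟨U, X, h, m, hs⟩ hy⟩,
    fun Mf hM => ⟨systemClosed_of_geodesic hl hM, fun U X h m hs φ hφ y hy a b =>
      delta_mul_gauge hφ hl hM ⟨U, X, h, m, hs⟩ hy a b⟩⟩
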